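/- **Patrol problem.** There are areas $i\in[I]$, agent types $j\in[J]$ and time slots $t\in[T]$. Each area $i$ has, for type $j$, a neighbourhood $\mathscr B_{i,j}\subset[I]$ with $i\in\mathscr B_{i,j}$, and $i\in\mathscr B_{i',j}$ implies $i'\in\mathscr B_{i,j}$. The pair $(i,j)$ carries a controlled process with a finite state space $\mathscr S_{i,j}$ of pairs $s=(k,\iota(s))$, where $\iota(s)\in\{0,1\}$ tells whether an agent of type $j$ is in area $i$. It has transition probabilities $P_{i,j,t}(s,e,s')$ and costs $c_{i,j}(s,e,t)\ge 0$, where $e\in\{0,1\}$ tells whether area $i$ is patrolled by a type-$j$ agent in slot $t$; the next state satisfies $\iota(s')=e$. In the system scaled by $h\in\{1,2,\dots\}$ every area $i$ has $h$ sub-areas $(i,k)$, $k\in[h]$, each with its own processes $S^k_{i,j}$. Their initial states are $h$ independent copies (over $k$) of a given initial state $(S_{i,j}(1))_{i,j}$, whose marginal laws are denoted $\pi^0_{i,j}$; given the system state and the actions, the processes make independent transitions. An action $a^k_{i,i',j}\in\{0,1\}$ ($=0$ for $i'\notin\mathscr B_{i,j}$) says whether an agent of type $j$ moves from area $i'$ to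 sub-area $(i,k)$. A policy $\phi$ chooses the actions as a function of the system state and $t$; it is *applicable* if always $$\sum_{i'\in\mathscr B_{i,j}}a^k_{i,i',j}\le 1\ \ \forall i,j,k,\qquad \frac1h\sum_{i'\in\mathscr B_{i,j}}\sum_{k}a^k_{i',i,j}=\frac1h\sum_k\iota(S^k_{i,j}(t))\ \ \forall i,j .$$ Put $\Gamma^{h,\phi}=\frac1h\sum_{t,i,j,k}\mathbb E\bigl[c_{i,j}(S^k_{i,j}(t),e^k_{i,j}(t),t)\bigr]$ with $e^k_{i,j}(t)=\mathbf 1\{\sum_{i'}a^k_{i,i',j}>0\}$. In the *relaxed* problem the action of each process is randomised, with probabilities in $\mathscr A_{i,j}=\{a\in[0,1]^I:\sum_{i'\in\mathscr B_{i,j}}a_{i'}\le1,\ a_{i'}=0\ (i'\notin\mathscr B_{i,j})\}$ for the mutually exclusive movements (so that $e(a)=\sum_{i'}a_{i'}$ is the probability of being patrolled, and costs and transition probabilities are extended affinely in $e$), and the second constraint is required in expectation only. Let $\Gamma^{h,*}$ be the minimum of $\Gamma^{h,\phi}$ in the relaxed problem. **Multipliers and indices.** For $\gamma\in\mathbb R^{IJT}$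 let $V^\gamma_{i,j}$ solve the Bellman equations, with $V^\gamma_{i,j}(\cdot,T+1)=0$, $$V^{\gamma}_{i,j}(s,t)=\min_{a\in\mathscr A_{i,j}}\Bigl\{c_{i,j}(s,e(a),t)+\gamma_{i,j,t}\iota(s)-\sum_{i'\in\mathscr B_{i,j}}\gamma_{i',j,t}a_{i'}+\sum_{s'}P_{i,j,t}(s,e(a),s')V^\gamma_{i,j}(s',t+1)\Bigr\},$$ and put $\vartheta^\gamma_{i,j}(s,t)=c_{i,j}(s,1,t)-c_{i,j}(s,0,t)+\sum_{s'}\bigl(P_{i,j,t}(s,1,s')-P_{i,j,t}(s,0,s')\bigr)V^\gamma_{i,j}(s',t+1)$. Let $\gamma^*$ be the multiplier part of an optimal solution $(\gamma^*,V^*)$ of the dual linear program: maximise $\sum_{i,j,s}\pi^0_{i,j}(s)V_{i,j}(s,1)$ over $(\gamma,V)$ subject to $V_{i,j}(\cdot,T+1)=0$ and to $V_{i,j}(s,t)$ being at most the expression in braces (with $V_{i,j}$ in place of $V^\gamma_{i,j}$) for all $i,j,s,t$ and $a\in\mathscr A_{i,j}\cap\{0,1\}^I$. The index of a movement from $i'\in\mathscr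 B_{i,j}$ to $(i,k)$ when $S^k_{i,j}(t)=s$ is $\eta_{i,i',j}(s,t)=\vartheta^{\gamma^*}_{i,j}(s,t)-\gamma^*_{i',j,t}$. The problem is *strictly indexable* if for all $i,j,t$, all $i_1,i_2\in\mathscr B_{i,j}$ and all states $s_1,s_2$ of $(i_1,j),(i_2,j)$, $\vartheta^{\gamma^*}_{i_1,j}(s_1,t)=\vartheta^{\gamma^*}_{i_2,j}(s_2,t)$ only if $i_1=i_2$ and $s_1=s_2$. **The policy $\psi^*$.** Let $\phi^*_1,\dots,\phi^*_M$ ($M\ge1$) be randomised policies, $\phi^*_m$ taking at time $t$ in state $s$ of a process of $(i,j)$ the movement from $i'$ with probability $\alpha_{i,i',j}(s,t)$, $\alpha_{i,\cdot,j}(s,t)\in\mathscr A_{i,j}$, such that for $i'\in\mathscr B_{i,j}$: $\alpha_{i,i',j}(s,t)=1$ if $\gamma^*_{i',j,t}>\vartheta^{\gamma^*}_{i,j}(s,t)$ and $i'=\min\arg\max_{i''\in\mathscr B_{i,j}}\gamma^*_{i'',j,t}$; $\alpha_{i,i',j}(s,t)\in[0,1]$ if $\gamma^*_{i',j,t}=\vartheta^{\gamma^*}_{i,j}(s,t)$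 and $i'\in\arg\max_{i''\in\mathscr B_{i,j}}\gamma^*_{i'',j,t}$; and $\alpha_{i,i',j}(s,t)=0$ otherwise. Let $\pi^*$ be a probability vector on $[M]$ such that in the unscaled system ($h=1$), for all $i,j,t$, $$\sum_m\pi^*_m\Bigl(\sum_{i'\in\mathscr B_{i,j}}\mathbb E\bigl[\alpha^{\phi^*_m}_{i',i,j}(S^{\phi^*_m}_{i',j}(t),t)\bigr]-\mathbb E\bigl[\iota(S^{\phi^*_m}_{i,j}(t))\bigr]\Bigr)=0 .$$ In the system scaled by $h$, under $\psi^*$ the first $\lfloor\pi^*_1h\rfloor$ sub-processes of each pair $(i,j)$ follow $\phi^*_1$, the next $\lfloor\pi^*_2h\rfloor$ follow $\phi^*_2$, and so on; all the remaining ones follow $\phi^*_M$. **The MAI policy.** Given the system state at time $t$, do the following for each type $j$. *(Index policy.)* Rank the movements from areas $i'$ containing type-$j$ agents to sub-areas $(i,k)$ with $i'\in\mathscr B_{i,j}$ by ascending index; movements to the same sub-area with equal index are ranked by ascending $i'$, other ties are arbitrary. In this order take a movement if its destination is still vacant and its origin still has an unassigned agent. *(Movement adaption.)* Let $\varpi^k_i$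 be the origin of the agent moving to $(i,k)$, if any; $(i,k)$ is vacant otherwise. The distance of an area $i$ is $d_i=\infty$ if it contains no type-$j$ agent; otherwise $d_i=0$ if some sub-area of $\mathscr B_{i,j}\times[h]$ is vacant, and $d_i=\min d_{\varpi^{k'}_{i'}}+1$ over $(i',k')\in\mathscr B_{i,j}\times[h]$ with $\varpi^{k'}_{i'}\ne i$ if none is vacant. For each area $i$ (in arbitrary order) with unassigned agents, and for each of these agents: put $\bar\imath=i$ and repeat: choose $(i^*,k^*)\in\mathscr B_{\bar\imath,j}\times[h]$ with minimal $d_{\varpi^{k^*}_{i^*}}$ (ties: smallest $i^*$, arbitrary $k^*$), put $\varpi=\varpi^{k^*}_{i^*}$ and replace the movement from $\varpi$ to $(i^*,k^*)$ by one from $\bar\imath$; if $d_\varpi=0$, move the displaced agent from $\varpi$ to a vacant sub-area of $\mathscr B_{\varpi,j}\times[h]$ and stop, otherwise put $\bar\imath=\varpi$ and continue. The distances are recomputed after each treated agent. **Claim.** Suppose the patrol problem is strictly indexable. Then the MAI policy is well defined for every $h\ge1$, and, for every $\gamma^*$ and $\psi^*$ as above and every way of breaking the ties in the algorithm, the MAI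 policy is applicable for every $h\geq 1$ and $$\lim_{h\to\infty}\bigl|\Gamma^{h,\mathrm{MAI}}-\Gamma^{h,\psi^*}\bigr|=0 .$$ Hence MAI is asymptotically optimal: $\lim_{h\to\infty}|\Gamma^{h,\mathrm{MAI}}-\Gamma^{h,*}|=0$, and the difference between $\Gamma^{h,\mathrm{MAI}}$ and the minimum of $\Gamma^{h,\phi}$ over the applicable policies tends to $0$ as well. -/

import Mathlib

open Filter Topology

noncomputable section

/-- A multi-agent patrol problem with `I` areas, `J` agent types and `T` time slots.  Time slots
are numbered `0, …, T - 1`.  The process of the area-agent pair `(i, j)` has a finite state space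
`states i j` of pairs `(knowledge, indicator)`; the indicator is `true` iff an agent of type `j` is
in area `i`. -/
structure PatrolProblem (I J T : ℕ) where
  Know : Fin I → Fin J → Type
  states : ∀ i j, Finset (Know i j × Bool)
  /-- `nbr i j` is the neighbourhood of area `i` for agents of type `j`. -/
  nbr : Fin I → Fin J → Finset (Fin I)
  self_mem_nbr : ∀ i j, i ∈ nbr i j
  nbr_symm : ∀ i i' j, i ∈ nbr i' j → i' ∈ nbr i j
  /-- `cost i j s e t`: cost rate in state `s` at time `t`; `e` says whether the area is patrolled
  in the time slot. -/
  cost : ∀ i j, ↥(states i j) → Bool → ℕ → ℝ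
  cost_nonneg : ∀ i j s e t, 0 ≤ cost i j s e t
  /-- `P i j t s e s'`: probability of moving from `s` at time `t` to `s'` at time `t + 1`. -/
  P : ∀ i j, ℕ → ↥(states i j) → Bool → ↥(states i j) → ℝ
  P_nonneg : ∀ i j t s e s', 0 ≤ P i j t s e s'
  P_sum : ∀ i j t s e, ∑ s', P i j t s e s' = 1
  /-- An agent is in the area at the end of a slot iff the area was patrolled in that slot. -/
  P_indicator : ∀ i j t s e s', P i j t s e s' ≠ 0 → s'.1.2 = e
  /-- The joint law of the initial states of all area-agent pairs. -/
  init : (∀ i j, ↥(states i j)) → ℝ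
  init_nonneg : ∀ s, 0 ≤ init s
  init_sum : ∑ s, init s = 1

namespace PatrolProblem

variable {I J T : ℕ} (Q : PatrolProblem I J T) {h : ℕ}

/-- The state space of the pair `(i, j)`. -/
abbrev State (i : Fin I) (j : Fin J) : Type := ↥(Q.states i j)

/-- The indicator of the presence of an agent, as a real number. -/
def ind {i : Fin I} {j : Fin J} (s : Q.State i j) : ℝ := if s.1.2 = true then 1 else 0

/-- States of the system scaled by `h`: `s i j k` is the state of type `j` in sub-area `(i, k)`. -/
abbrev ScaledState (h : ℕ) : Type := ∀ (i : Fin I) (j : Fin J), Fin h → Q.State i j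

/-- The number of agents of type `j` located in (the sub-areas of) area `i`. -/
def agents (s : Q.ScaledState h) (i : Fin I) (j : Fin J) : ℕ :=
  (Finset.univ.filter fun k => (s i j k).1.2 = true).card

/-! ### Policies, the controlled process and its cost -/

/-- Action variables: `a i i' j k` belongs to the movement of an agent of type `j` from (a sub-area
of) area `i'` to the sub-area `(i, k)`.  It is `0` or `1` for a deterministic policy, and the
probability of the movement for a randomised policy. -/
abbrev Action (I J h : ℕ) : Type := Fin I → Fin I → Fin J → Fin h → ℝ

/-- Policies choose the action variables as a function of the whole system state and of time. -/
abbrev Policy (h : ℕ) : Type := Q.ScaledState h → ℕ → Action I J h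

/-- The probability of a non-zero action for a single process, for a probability vector `a` over
the mutually exclusive movements `i' ∈ nbr i j` (the remaining mass being the zero action). -/
def active (i : Fin I) (j : Fin J) (a : Fin I → ℝ) : ℝ := ∑ i' ∈ Q.nbr i j, a i'

/-- The set of randomised actions of a single process of the pair `(i, j)`. -/
def randActions (i : Fin I) (j : Fin J) : Set (Fin I → ℝ) :=
  {a | (∀ i', 0 ≤ a i' ∧ a i' ≤ 1) ∧ ∑ i' ∈ Q.nbr i j, a i' ≤ 1 ∧ ∀ i', i' ∉ Q.nbr i j → a i' = 0}

/-- The set of deterministic actions of a single process of the pair `(i, j)`. -/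
def pureActions (i : Fin I) (j : Fin J) : Set (Fin I → ℝ) :=
  {a | a ∈ Q.randActions i j ∧ ∀ i', a i' = 0 ∨ a i' = 1}

/-- Transition probabilities when the non-zero action has probability `e`. -/
def trans (i : Fin I) (j : Fin J) (t : ℕ) (s : Q.State i j) (e : ℝ) (s' : Q.State i j) : ℝ :=
  e * Q.P i j t s true s' + (1 - e) * Q.P i j t s false s'

/-- Expected cost rate when the non-zero action has probability `e`. -/
def costE (i : Fin I) (j : Fin J) (s : Q.State i j) (e : ℝ) (t : ℕ) : ℝ :=
  e * Q.cost i j s true t + (1 - e) * Q.cost i j s false t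

/-- The law of the system state at time `t` under the policy `φ`.  The initial states are `h`
independent copies of the initial state of the unscaled system; given the system state and the
actions, the sub-processes make independent transitions. -/
def law (φ : Q.Policy h) : ℕ → Q.ScaledState h → ℝ
  | 0, s => ∏ k, Q.init fun i j => s i j k
  | t + 1, s' => ∑ s, law φ t s * ∏ i, ∏ j, ∏ k,
      Q.trans i j t (s i j k) (Q.active i j fun i' => φ s t i i' j k) (s' i j k)

/-- The expectation of `f (S t)` under the policy `φ`. -/
def expect (φ : Q.Policy h) (t : ℕ) (f : Q.ScaledState h → ℝ) : ℝ := ∑ s, Q.law φ t s * f s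

/-- The expected cumulative cost of the scaled system, divided by `h`. -/
def expCost (φ : Q.Policy h) : ℝ :=
  (1 / (h : ℝ)) * ∑ t ∈ Finset.range T, ∑ i, ∑ j, ∑ k,
    Q.expect φ t fun s => Q.costE i j (s i j k) (Q.active i j fun i' => φ s t i i' j k) t

/-- Deterministic policies which are applicable to the patrol problem scaled by `h`: each sub-area
receives at most one agent of each type, and every agent moves to (or stays at) some sub-area of
the neighbourhood of its area. -/
def IsApplicable (φ : Q.Policy h) : Prop :=
  ∀ s, ∀ t < T,
    (∀ i i' j k, φ s t i i' j k = 0 ∨ φ s t i i' j k = 1) ∧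
    (∀ i i' j k, i' ∉ Q.nbr i j → φ s t i i' j k = 0) ∧
    (∀ i j k, ∑ i' ∈ Q.nbr i j, φ s t i i' j k ≤ 1) ∧
    (∀ i j, (1 / (h : ℝ)) * ∑ i' ∈ Q.nbr i j, ∑ k, φ s t i' i j k =
      (1 / (h : ℝ)) * ∑ k, Q.ind (s i j k))

/-- Randomised policies which are applicable to the relaxed problem: each process takes randomised
actions, and the conservation of agents is required in expectation only. -/
def IsRelaxedApplicable (φ : Q.Policy h) : Prop :=
  (∀ s, ∀ t < T, ∀ i j k, (fun i' => φ s t i i' j k) ∈ Q.randActions i j) ∧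
  (∀ t < T, ∀ i j,
    (1 / (h : ℝ)) * ∑ i' ∈ Q.nbr i j, ∑ k, Q.expect φ t (fun s => φ s t i' i j k) =
      (1 / (h : ℝ)) * ∑ k, Q.expect φ t (fun s => Q.ind (s i j k)))

/-- The minimum of the patrol problem scaled by `h`. -/
def optCost (h : ℕ) : ℝ := sInf {x | ∃ φ : Q.Policy h, Q.IsApplicable φ ∧ x = Q.expCost φ}

/-- The minimum of the relaxed problem scaled by `h`. -/
def relaxedOptCost (h : ℕ) : ℝ :=
  sInf {x | ∃ φ : Q.Policy h, Q.IsRelaxedApplicable φ ∧ x = Q.expCost φ}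

/-! ### Lagrange multipliers, value functions and indices -/

/-- Lagrange multipliers `γ i j t`, one for each conservation constraint. -/
abbrev Mult (I J : ℕ) : Type := Fin I → Fin J → ℕ → ℝ

/-- One-step Lagrangian cost of the sub-problem `(i, j)` under the action `a`. -/
def lagCost (γ : Mult I J) (i : Fin I) (j : Fin J) (s : Q.State i j) (a : Fin I → ℝ) (t : ℕ) : ℝ :=
  Q.costE i j s (Q.active i j a) t + γ i j t * Q.ind s - ∑ i' ∈ Q.nbr i j, γ i' j t * a i'

/-- Right-hand side of the Bellman equation of the sub-problem `(i, j)`, for the action `a` and the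
continuation value `W`. -/
def bellman (γ : Mult I J) (i : Fin I) (j : Fin J) (s : Q.State i j) (a : Fin I → ℝ) (t : ℕ)
    (W : Q.State i j → ℝ) : ℝ :=
  Q.lagCost γ i j s a t + ∑ s', Q.trans i j t s (Q.active i j a) s' * W s'

/-- The value function of the sub-problem `(i, j)` with `n` remaining time slots.  The right-hand
side of the Bellman equation is affine in the action, so its minimum over the randomised actions is
the minimum over the zero action and the unit vectors `i' ∈ nbr i j`. -/
def valueAux (γ : Mult I J) (i : Fin I) (j : Fin J) : ℕ → Q.State i j → ℝ
  | 0, _ => 0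
  | n + 1, s =>
      min (Q.bellman γ i j s 0 (T - (n + 1)) (valueAux γ i j n))
        ((Q.nbr i j).inf' ⟨i, Q.self_mem_nbr i j⟩ fun i' =>
          Q.bellman γ i j s (Pi.single i' 1) (T - (n + 1)) (valueAux γ i j n))

/-- The value function of the sub-problem `(i, j)` at time `t`; it vanishes from time `T` on. -/
def value (γ : Mult I J) (i : Fin I) (j : Fin J) (s : Q.State i j) (t : ℕ) : ℝ :=
  Q.valueAux γ i j (T - t) s

/-- The marginal cost of patrolling, for the pair `(i, j)` in state `s` at time `t`. -/
def marginal (γ : Mult I J) (i : Fin I) (j : Fin J) (s : Q.State i j) (t : ℕ) : ℝ :=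
  Q.cost i j s true t - Q.cost i j s false t +
    ∑ s', (Q.P i j t s true s' - Q.P i j t s false s') * Q.value γ i j s' (t + 1)

/-- The index of the movement from area `i'` to area `i` (used for `i' ∈ nbr i j` only). -/
def index (γ : Mult I J) (i i' : Fin I) (j : Fin J) (s : Q.State i j) (t : ℕ) : ℝ :=
  Q.marginal γ i j s t - γ i' j t

open Classical in
/-- The initial law of the pair `(i, j)`. -/
def initMarginal (i : Fin I) (j : Fin J) (s : Q.State i j) : ℝ :=
  ∑ x : ∀ i j, Q.State i j, if x i j = s then Q.init x else 0

/-- The constraints of the dual linear program. -/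
def DualFeasible (γ : Mult I J) (V : ∀ i j, Q.State i j → ℕ → ℝ) : Prop :=
  (∀ i j s, ∀ t < T, ∀ a ∈ Q.pureActions i j,
    V i j s t ≤ Q.bellman γ i j s a t fun s' => V i j s' (t + 1)) ∧
  ∀ i j s, V i j s T = 0

/-- The objective of the dual linear program. -/
def dualObjective (V : ∀ i j, Q.State i j → ℕ → ℝ) : ℝ :=
  ∑ i, ∑ j, ∑ s, Q.initMarginal i j s * V i j s 0

/-- `γ` is the vector of multipliers of an optimal solution `(γ, V)` of the dual linear program. -/
def IsDualOptimal (γ : Mult I J) : Prop :=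
  ∃ V, Q.DualFeasible γ V ∧
    ∀ γ' V', Q.DualFeasible γ' V' → Q.dualObjective V' ≤ Q.dualObjective V

/-- Strict indexability for the multipliers `γ`: within each neighbourhood, different pairs of an
area and a state have different marginal costs. -/
def StrictlyIndexable (γ : Mult I J) : Prop :=
  ∀ i j, ∀ t < T, ∀ i₁ ∈ Q.nbr i j, ∀ i₂ ∈ Q.nbr i j,
    ∀ (s₁ : Q.State i₁ j) (s₂ : Q.State i₂ j),
      Q.marginal γ i₁ j s₁ t = Q.marginal γ i₂ j s₂ t →
        (⟨i₁, s₁⟩ : (i' : Fin I) × Q.State i' j) = ⟨i₂, s₂⟩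

/-! ### Threshold policies and their mixture -/

/-- A randomised policy for which each process only uses its own state:
`α i j s t i'` is the probability of the movement from `i'` to `i` in state `s` at time `t`. -/
abbrev LocalPolicy : Type := ∀ (i : Fin I) (j : Fin J), Q.State i j → ℕ → Fin I → ℝ

/-- The policy of the scaled system in which the `k`-th sub-processes follow `α k`. -/
def lift (α : Fin h → Q.LocalPolicy) : Q.Policy h := fun s t i i' j k => α k i j (s i j k) t i'

/-- `i'` maximises `γ · j t` over the neighbourhood of `i`. -/
def IsArgmax (γ : Mult I J) (i : Fin I) (j : Fin J) (t : ℕ) (i' : Fin I) : Prop :=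
  i' ∈ Q.nbr i j ∧ ∀ i'' ∈ Q.nbr i j, γ i'' j t ≤ γ i' j t

/-- `i'` is the smallest maximiser of `γ · j t` over the neighbourhood of `i`. -/
def IsMinArgmax (γ : Mult I J) (i : Fin I) (j : Fin J) (t : ℕ) (i' : Fin I) : Prop :=
  Q.IsArgmax γ i j t i' ∧ ∀ i'', Q.IsArgmax γ i j t i'' → i' ≤ i''

/-- `α` takes randomised actions of the threshold form for the multipliers `γ`. -/
def IsThreshold (γ : Mult I J) (α : Q.LocalPolicy) : Prop :=
  ∀ i j s, ∀ t < T, α i j s t ∈ Q.randActions i j ∧ ∀ i' ∈ Q.nbr i j,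
    ((Q.marginal γ i j s t < γ i' j t ∧ Q.IsMinArgmax γ i j t i') → α i j s t i' = 1) ∧
    (¬ (Q.marginal γ i j s t < γ i' j t ∧ Q.IsMinArgmax γ i j t i') →
      ¬ (γ i' j t = Q.marginal γ i j s t ∧ Q.IsArgmax γ i j t i') → α i j s t i' = 0)

/-- The mixture of the policies `α m` with weights `w m` satisfies the conservation of agents in
expectation, in the unscaled system. -/
def IsBalancedMixture {M : ℕ} (α : Fin (M + 1) → Q.LocalPolicy) (w : Fin (M + 1) → ℝ) : Prop :=
  ∀ i j, ∀ t < T, ∑ m, w m *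
    ((∑ i' ∈ Q.nbr i j, Q.expect (Q.lift fun _ : Fin 1 => α m) t fun s => α m i' j (s i' j 0) t i) -
      Q.expect (Q.lift fun _ : Fin 1 => α m) t fun s => Q.ind (s i j 0)) = 0

/-- The policy followed by the `k`-th sub-processes in the mixed policy: the first `⌊w 0 * h⌋` of
them follow policy `0`, the next `⌊w 1 * h⌋` policy `1`, and so on; all the remaining ones follow
the last policy. -/
def mixTag {M : ℕ} (w : Fin (M + 1) → ℝ) (h : ℕ) (k : Fin h) : Fin (M + 1) :=
  (Finset.univ.filter fun m : Fin (M + 1) =>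
      m = Fin.last M ∨ (k : ℕ) < ∑ m' ∈ Finset.Iic m, ⌊w m' * (h : ℝ)⌋₊).min'
    ⟨Fin.last M, by simp⟩

/-- The mixed policy `ψ*` in the system scaled by `h`. -/
def mixedPolicy {M : ℕ} (α : Fin (M + 1) → Q.LocalPolicy) (w : Fin (M + 1) → ℝ) (h : ℕ) :
    Q.Policy h :=
  Q.lift fun k => α (mixTag w h k)

/-! ### The index policy

The movements chosen for agents of one type are described by the origins: `ϖ (i, k) = some i'` if
an agent moves from area `i'` to sub-area `(i, k)`, and `ϖ (i, k) = none` if `(i, k)` stays vacant.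
-/

/-- Origins of the agents (of a fixed type) that move to the sub-areas. -/
abbrev Origins (I h : ℕ) : Type := Fin I × Fin h → Option (Fin I)

/-- The number of agents which have been given a movement that starts in area `i`. -/
def moved (ϖ : Origins I h) (i : Fin I) : ℕ := (Finset.univ.filter fun x => ϖ x = some i).card

/-- `L` ranks the possible movements `(i, k, i')` of agents of type `j` from area `i'` to sub-area
`(i, k)` in the ascending order of their indices.  Movements to the same sub-area with the same
index are ranked in the order of `i'`; all other ties are broken arbitrarily. -/
def IsRanking (γ : Mult I J) (s : Q.ScaledState h) (t : ℕ) (j : Fin J)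
    (L : List (Fin I × Fin h × Fin I)) : Prop :=
  L.Nodup ∧
  (∀ i k i', (i, k, i') ∈ L ↔ 0 < Q.agents s i' j ∧ i' ∈ Q.nbr i j) ∧
  L.Pairwise fun x y =>
    Q.index γ x.1 x.2.2 j (s x.1 j x.2.1) t ≤ Q.index γ y.1 y.2.2 j (s y.1 j y.2.1) t ∧
    (x.1 = y.1 → x.2.1 = y.2.1 →
      Q.index γ x.1 x.2.2 j (s x.1 j x.2.1) t = Q.index γ y.1 y.2.2 j (s y.1 j y.2.1) t →
      x.2.2 < y.2.2)

/-- The index policy considers one movement: it is taken iff its destination is still vacant and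
there is still an agent at its origin. -/
def indexStep (s : Q.ScaledState h) (j : Fin J) (ϖ : Origins I h) (x : Fin I × Fin h × Fin I) :
    Origins I h :=
  if ϖ (x.1, x.2.1) = none ∧ moved ϖ x.2.2 < Q.agents s x.2.2 j then
    Function.update ϖ (x.1, x.2.1) (some x.2.2)
  else ϖ

/-- The movements of the index policy for agents of type `j`, given the ranking `L`. -/
def indexOrigins (s : Q.ScaledState h) (j : Fin J) (L : List (Fin I × Fin h × Fin I)) :
    Origins I h :=
  L.foldl (Q.indexStep s j) fun _ => none

/-! ### Movement adaption -/

/-- A vacant sub-area can be reached from area `i` by `n` replacements of movements. -/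
def Reaches (s : Q.ScaledState h) (j : Fin J) (ϖ : Origins I h) : ℕ → Fin I → Prop
  | 0, i => 0 < Q.agents s i j ∧ ∃ x, x.1 ∈ Q.nbr i j ∧ ϖ x = none
  | n + 1, i => 0 < Q.agents s i j ∧
      ∃ x r, x.1 ∈ Q.nbr i j ∧ ϖ x = some r ∧ r ≠ i ∧ Reaches s j ϖ n r

/-- The distance from area `i` to a vacant sub-area; it is characterised by the equation
`PatrolProblem.dist_eq` below. -/
def dist (s : Q.ScaledState h) (j : Fin J) (ϖ : Origins I h) (i : Fin I) : ℕ∞ :=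
  ⨅ n, ⨅ (_ : Q.Reaches s j ϖ n i), (n : ℕ∞)

open Classical in
theorem dist_eq (s : Q.ScaledState h) (j : Fin J) (ϖ : Origins I h) (i : Fin I) :
    Q.dist s j ϖ i =
      if 0 < Q.agents s i j ∧ ∃ x, x.1 ∈ Q.nbr i j ∧ ϖ x = none then 0
      else if 0 < Q.agents s i j then
        ⨅ x, ⨅ r, ⨅ (_ : x.1 ∈ Q.nbr i j ∧ ϖ x = some r ∧ r ≠ i), (Q.dist s j ϖ r + 1)
      else ⊤ := by
  split_ifs with h0 h1
  · exact le_antisymm (iInf₂_le_of_le 0 h0 (by simp)) bot_le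
  · apply le_antisymm
    · refine le_iInf fun x => le_iInf fun r => le_iInf fun hx => ?_
      by_cases hr : ∃ n, Q.Reaches s j ϖ n r
      · have hne : (⊤ : ℕ∞) ≠ Q.dist s j ϖ r := by
          obtain ⟨n, hn⟩ := hr
          have : Q.dist s j ϖ r ≤ n := iInf₂_le n hn
          exact fun e => absurd (e ▸ this) (by simp)
        obtain ⟨m, hm⟩ := ENat.ne_top_iff_exists.mp hne.symm
        have hmr : Q.Reaches s j ϖ m r := by
          by_contra hcon
          have : ((m + 1 : ℕ) : ℕ∞) ≤ Q.dist s j ϖ r := by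
            refine le_iInf₂ fun n hn => ?_
            have hmn : (m : ℕ∞) ≤ n := by rw [hm]; exact iInf₂_le n hn
            have h1 : m ≤ n := by exact_mod_cast hmn
            have h2 : m ≠ n := fun e => hcon (e ▸ hn)
            exact_mod_cast (by omega : m + 1 ≤ n)
          rw [← hm] at this
          exact absurd (by exact_mod_cast this : m + 1 ≤ m) (by omega)
        rw [← hm]
        refine iInf₂_le_of_le (m + 1) ⟨h1, x, r, hx.1, hx.2.1, hx.2.2, hmr⟩ ?_
        push_cast; exact le_rfl
      · have : Q.dist s j ϖ r = ⊤ := by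
          refine iInf₂_eq_top.mpr fun n hn => absurd ⟨n, hn⟩ hr
        rw [this]; simp
    · refine le_iInf₂ fun n hn => ?_
      cases n with
      | zero => exact absurd hn h0
      | succ n =>
        obtain ⟨_, x, r, hx, hxr, hri, hn⟩ := hn
        refine iInf_le_of_le x (iInf_le_of_le r (iInf_le_of_le ⟨hx, hxr, hri⟩ ?_))
        push_cast
        gcongr
        exact iInf₂_le n hn
  · refine iInf₂_eq_top.mpr fun n hn => ?_
    cases n with
    | zero => exact absurd hn.1 h1
    | succ n => exact absurd hn.1 h1

/-- The distance of the origin of the agent that moves to a sub-area (`⊤` for a vacant one). -/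
def originDist (d : Fin I → ℕ∞) : Option (Fin I) → ℕ∞
  | none => ⊤
  | some r => d r

/-- Among the sub-areas in the neighbourhood of `i`, the origin of the agent that moves to `x` has
the smallest distance; ties are broken by the smallest area, and then arbitrarily. -/
def IsBest (j : Fin J) (d : Fin I → ℕ∞) (ϖ : Origins I h) (i : Fin I) (x : Fin I × Fin h) : Prop :=
  x.1 ∈ Q.nbr i j ∧ ∀ y : Fin I × Fin h, y.1 ∈ Q.nbr i j →
    originDist d (ϖ x) ≤ originDist d (ϖ y) ∧
    (originDist d (ϖ x) = originDist d (ϖ y) → x.1 ≤ y.1)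

/-- The inner loop of the movement adaption: `AdaptPath j d ϖ i ϖ'` says that the movements `ϖ`, in
which some agent in area `i` waits for a movement, can be turned into `ϖ'` by giving that agent a
place `x` of another agent, which is then moved to a vacant place if the distance of its area is
zero, and else takes the role of the waiting agent.  The distances `d` are not changed meanwhile. -/
inductive AdaptPath (j : Fin J) (d : Fin I → ℕ∞) :
    Origins I h → Fin I → Origins I h → Prop
  | last (ϖ : Origins I h) (i r : Fin I) (x y : Fin I × Fin h) :
      Q.IsBest j d ϖ i x → ϖ x = some r → d r = 0 → y.1 ∈ Q.nbr r j → ϖ y = none →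
      AdaptPath j d ϖ i (Function.update (Function.update ϖ x (some i)) y (some r))
  | step (ϖ : Origins I h) (i r : Fin I) (x : Fin I × Fin h) (ϖ' : Origins I h) :
      Q.IsBest j d ϖ i x → ϖ x = some r → d r ≠ 0 →
      AdaptPath j d (Function.update ϖ x (some i)) r ϖ' →
      AdaptPath j d ϖ i ϖ'

/-- `n` waiting agents of area `i` are given movements, one after the other, with the distances
updated each time. -/
inductive AdaptArea (s : Q.ScaledState h) (j : Fin J) (i : Fin I) :
    ℕ → Origins I h → Origins I h → Prop
  | zero (ϖ : Origins I h) : AdaptArea s j i 0 ϖ ϖ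
  | succ (n : ℕ) (ϖ ϖ₁ ϖ₂ : Origins I h) :
      Q.AdaptPath j (Q.dist s j ϖ) ϖ i ϖ₁ → AdaptArea s j i n ϖ₁ ϖ₂ →
      AdaptArea s j i (n + 1) ϖ ϖ₂

/-- The areas of a list are adapted one after the other. -/
inductive AdaptAll (s : Q.ScaledState h) (j : Fin J) :
    List (Fin I) → Origins I h → Origins I h → Prop
  | nil (ϖ : Origins I h) : AdaptAll s j [] ϖ ϖ
  | cons (i : Fin I) (l : List (Fin I)) (ϖ ϖ₁ ϖ₂ : Origins I h) :
      Q.AdaptArea s j i (Q.agents s i j - moved ϖ i) ϖ ϖ₁ → AdaptAll s j l ϖ₁ ϖ₂ →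
      AdaptAll s j (i :: l) ϖ ϖ₂

/-- `ϖ` is a possible outcome of the movement-adapted index policy for agents of type `j`, in state
`s` at time `t`: the movements of the index policy (for some ranking `L`) are adapted for all areas
in which an agent is left without a movement (in some order `l`). -/
def IsMAIOrigins (γ : Mult I J) (s : Q.ScaledState h) (t : ℕ) (j : Fin J) (ϖ : Origins I h) :
    Prop :=
  ∃ (L : List (Fin I × Fin h × Fin I)) (l : List (Fin I)),
    Q.IsRanking γ s t j L ∧ l.Nodup ∧
    (∀ i, i ∈ l ↔ 0 < Q.agents s i j ∧ moved (Q.indexOrigins s j L) i ≠ Q.agents s i j) ∧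
    Q.AdaptAll s j l (Q.indexOrigins s j L) ϖ

/-- `φ` is a movement-adapted index (MAI) policy for the multipliers `γ`, with some way of breaking
the ties that the algorithm leaves open. -/
def IsMAI (γ : Mult I J) (φ : Q.Policy h) : Prop :=
  ∀ s, ∀ t < T, ∀ j, ∃ ϖ : Origins I h, Q.IsMAIOrigins γ s t j ϖ ∧
    ∀ i i' k, φ s t i i' j k = if ϖ (i, k) = some i' then 1 else 0

end PatrolProblem

end

/-! Everything is compared with the number `L = ∑ m, w m * localCost (α m)`, the cost of the mixture
in the unscaled system.

Optimality of `L` is Lagrangian duality. By telescoping value functions, `sum_cost_eq` writes the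
cost of any policy as the dual value of `γ`, plus the multipliers times the imbalances, plus the
accumulated Bellman gaps. For a policy of the relaxed problem the imbalances cancel on average and
the gaps are nonnegative, so the dual value is a lower bound. For a balanced mixture of threshold
policies both extra terms vanish, so `L` equals the dual value. The mixed policy costs `L` in the
limit because the rounding of its blocks is bounded independently of `h`.

That the MAI cost tends to `L` is a fluid-limit argument. The sub-areas are grouped into classes
(area, state). The mixture prescribes what fraction of each class is patrolled, and these fractions
have threshold form. The index policy is a greedy matching of sources (areas) to classes; under
strict indexability such a matching is stable under perturbation: if the counts are within `E` of
`h` times the fluid values, each class receives at least its fluid share up to a constant times `E`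
(`greedy_lower_bound`). Movement adaption never vacates a sub-area, so the lower bounds survive it;
as all agents then move, the total number of patrols is nearly the fluid one, and upper bounds
follow (`IsMAI.abs_patrolCount_sub_le`). In each slot independent transitions add noise of order
`√h` and multiply the old deviation by a constant; with finitely many slots the deviation stays of
order `√h` (`exists_expect_deviation_le`), hence the cost error is of order `1 / √h`.

That the adaption can always be completed is a counting argument (`IsValid.exists_reaches`): if no
vacancy could be reached from a waiting agent, the reachable areas would be filled by their own
agents and one agent would be left over. -/

noncomputable section

/-! ### Product weights on finite products -/

section ProductWeights

variable {ι : Type*} [Fintype ι] [DecidableEq ι]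

/-- A test function of one coordinate is absorbed into that coordinate's weight, which turns
expectations into total masses of product weights. -/
theorem prod_update_mul {β : ι → Type*} (p : ∀ i, β i → ℝ) (a : ι) (g : β a → ℝ)
    (x : ∀ i, β i) :
    ∏ i, Function.update p a (fun b => p a b * g b) i (x i) = (∏ i, p i (x i)) * g (x a) := by
  rw [Fintype.prod_eq_mul_prod_compl a, Fintype.prod_eq_mul_prod_compl a (fun i => p i (x i))]
  have : ∏ i ∈ ({a} : Finset ι)ᶜ, Function.update p a (fun b => p a b * g b) i (x i) =
      ∏ i ∈ ({a} : Finset ι)ᶜ, p i (x i) := by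
    refine Finset.prod_congr rfl fun i hi => ?_
    rw [Function.update_of_ne (by simpa using hi)]
  rw [this, Function.update_self]
  ring

theorem sum_prod_weights {β : ι → Type*} [∀ i, Fintype (β i)] (p : ∀ i, β i → ℝ) :
    ∑ x : ∀ i, β i, ∏ i, p i (x i) = ∏ i, ∑ b, p i b := by
  rw [Finset.prod_univ_sum, Fintype.piFinset_univ]

theorem sum_prod_weights_mul {β : ι → Type*} [∀ i, Fintype (β i)] (p : ∀ i, β i → ℝ) (a : ι)
    (g : β a → ℝ) :
    ∑ x : ∀ i, β i, (∏ i, p i (x i)) * g (x a) =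
      (∑ b, p a b * g b) * ∏ i ∈ ({a} : Finset ι)ᶜ, ∑ b, p i b := by
  simp_rw [← prod_update_mul p a g]
  rw [sum_prod_weights, Fintype.prod_eq_mul_prod_compl a, Function.update_self]
  congr 1
  refine Finset.prod_congr rfl fun i hi => ?_
  rw [Function.update_of_ne (by simpa using hi)]

theorem sum_prod_weights_marginal {β : ι → Type*} [∀ i, Fintype (β i)] (p : ∀ i, β i → ℝ)
    (hp : ∀ i, ∑ b, p i b = 1) (a : ι) (g : β a → ℝ) :
    ∑ x : ∀ i, β i, (∏ i, p i (x i)) * g (x a) = ∑ b, p a b * g b := by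
  rw [sum_prod_weights_mul]
  simp [hp]

variable {β : Type*} [Fintype β]

/-- Independence makes covariances vanish. Only `g` has to be centred, since `f` is absorbed into
the weight of `a`. -/
theorem sum_prod_weights_mul_mul (p : ι → β → ℝ) {a c : ι} (hac : a ≠ c) (f g : β → ℝ)
    (hg : ∑ b, p c b * g b = 0) :
    ∑ x : ι → β, (∏ i, p i (x i)) * (f (x a) * g (x c)) = 0 := by
  have h1 : ∀ x : ι → β, (∏ i, p i (x i)) * (f (x a) * g (x c)) =
      (∏ i, Function.update p a (fun b => p a b * f b) i (x i)) * g (x c) := by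
    intro x
    rw [prod_update_mul (β := fun _ => β) p a f x]
    ring
  simp_rw [h1]
  rw [sum_prod_weights_mul (β := fun _ => β), Function.update_of_ne hac.symm, hg, zero_mul]

/-- The mean deviation of a sum of independent indicators is at most the square root of their
number. -/
theorem sum_prod_weights_abs_le (p : ι → β → ℝ) (hp0 : ∀ i b, 0 ≤ p i b)
    (hp : ∀ i, ∑ b, p i b = 1) (f : β → ℝ) (hf : ∀ b, f b = 0 ∨ f b = 1) :
    ∑ x : ι → β, (∏ i, p i (x i)) * |∑ i, f (x i) - ∑ i, ∑ b, p i b * f b| ≤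
      √(Fintype.card ι : ℝ) := by
  set c : ι → β → ℝ := fun i b => f b - ∑ b', p i b' * f b' with hc
  have hc0 : ∀ i, ∑ b, p i b * c i b = 0 := by
    intro i
    simp only [hc, mul_sub, Finset.sum_sub_distrib]
    rw [← Finset.sum_mul, hp, one_mul, sub_self]
  -- The variance of an indicator with mean `μ` is `μ - μ ^ 2`.
  have hc2 : ∀ i, ∑ b, p i b * (c i b * c i b) ≤ 1 := by
    intro i
    set μ := ∑ b', p i b' * f b' with hμ
    have hff : ∑ b, p i b * (f b * f b) = μ := by
      refine Finset.sum_congr rfl fun b _ => ?_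
      rcases hf b with h | h <;> simp [h]
    have : ∑ b, p i b * (c i b * c i b) = μ - μ * μ := by
      have h1 : ∀ b, p i b * (c i b * c i b) =
          p i b * (f b * f b) - 2 * μ * (p i b * f b) + μ * μ * p i b := by
        intro b
        simp only [hc]
        ring
      simp_rw [h1]
      rw [Finset.sum_add_distrib, Finset.sum_sub_distrib, hff, ← Finset.mul_sum, ← Finset.mul_sum,
        hp, ← hμ]
      ring
    rw [this]
    nlinarith [sq_nonneg (μ - 1 / 2)]
  have hdev : ∀ x : ι → β, ∑ i, f (x i) - ∑ i, ∑ b, p i b * f b = ∑ i, c i (x i) := by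
    intro x
    simp only [hc, Finset.sum_sub_distrib]
  simp_rw [hdev]
  have hW0 : ∀ x : ι → β, 0 ≤ ∏ i, p i (x i) := fun x => Finset.prod_nonneg fun i _ => hp0 i _
  have hW1 : ∑ x : ι → β, ∏ i, p i (x i) = 1 := by
    rw [sum_prod_weights (β := fun _ => β)]
    simp [hp]
  -- The off-diagonal terms of the squared sum vanish, so the variances add up.
  have hvar : ∑ x : ι → β, (∏ i, p i (x i)) * (∑ i, c i (x i)) ^ 2 ≤ Fintype.card ι := by
    have h1 : ∀ x : ι → β, (∏ i, p i (x i)) * (∑ i, c i (x i)) ^ 2 =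
        ∑ a, ∑ d, (∏ i, p i (x i)) * (c a (x a) * c d (x d)) := by
      intro x
      rw [sq, Finset.sum_mul_sum, Finset.mul_sum]
      refine Finset.sum_congr rfl fun a _ => ?_
      rw [Finset.mul_sum]
    simp_rw [h1]
    rw [Finset.sum_comm]
    calc _ = ∑ a, ∑ b, p a b * (c a b * c a b) := by
          refine Finset.sum_congr rfl fun a _ => ?_
          rw [Finset.sum_comm, Finset.sum_eq_single a]
          · exact sum_prod_weights_marginal (β := fun _ => β) p hp a fun b => c a b * c a b
          · intro d _ hda
            exact sum_prod_weights_mul_mul p hda.symm (c a) (c d) (hc0 d)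
          · simp
      _ ≤ ∑ _a : ι, (1 : ℝ) := Finset.sum_le_sum fun a _ => hc2 a
      _ = _ := by simp
  refine Real.le_sqrt_of_sq_le (le_trans ?_ hvar)
  -- Cauchy–Schwarz, with the weight split into two square roots, bounds the squared mean of the
  -- modulus by the second moment.
  have hcs := Finset.sum_mul_sq_le_sq_mul_sq Finset.univ
    (fun x : ι → β => √(∏ i, p i (x i))) (fun x => √(∏ i, p i (x i)) * |∑ i, c i (x i)|)
  have e1 : ∀ x : ι → β, √(∏ i, p i (x i)) * (√(∏ i, p i (x i)) * |∑ i, c i (x i)|) =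
      (∏ i, p i (x i)) * |∑ i, c i (x i)| := by
    intro x
    rw [← mul_assoc, Real.mul_self_sqrt (hW0 x)]
  have e2 : ∀ x : ι → β, (√(∏ i, p i (x i)) * |∑ i, c i (x i)|) ^ 2 =
      (∏ i, p i (x i)) * (∑ i, c i (x i)) ^ 2 := by
    intro x
    rw [mul_pow, Real.sq_sqrt (hW0 x), sq_abs]
  simp_rw [e1, e2, Real.sq_sqrt (hW0 _)] at hcs
  rwa [hW1, one_mul] at hcs

end ProductWeights

namespace PatrolProblem

variable {I J T : ℕ} (Q : PatrolProblem I J T) {h : ℕ}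

/-! ### The law of the controlled process -/

theorem trans_sum (i : Fin I) (j : Fin J) (t : ℕ) (s : Q.State i j) (e : ℝ) :
    ∑ s', Q.trans i j t s e s' = 1 := by
  simp only [trans, Finset.sum_add_distrib, ← Finset.mul_sum, Q.P_sum]
  ring

theorem trans_nonneg (i : Fin I) (j : Fin J) (t : ℕ) (s : Q.State i j) {e : ℝ} (h0 : 0 ≤ e)
    (h1 : e ≤ 1) (s' : Q.State i j) : 0 ≤ Q.trans i j t s e s' :=
  add_nonneg (mul_nonneg h0 (Q.P_nonneg ..)) (mul_nonneg (by linarith) (Q.P_nonneg ..))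

/-- The probability of patrolling the sub-area `(i, k)` with an agent of type `j`. -/
def patrolProb (φ : Q.Policy h) (t : ℕ) (s : Q.ScaledState h) (i : Fin I) (j : Fin J) (k : Fin h) :
    ℝ :=
  Q.active i j fun i' => φ s t i i' j k

/-- The transition probabilities of the scaled system. -/
def kernel (φ : Q.Policy h) (t : ℕ) (s s' : Q.ScaledState h) : ℝ :=
  ∏ i, ∏ j, ∏ k, Q.trans i j t (s i j k) (Q.patrolProb φ t s i j k) (s' i j k)

theorem law_succ (φ : Q.Policy h) (t : ℕ) (s' : Q.ScaledState h) :
    Q.law φ (t + 1) s' = ∑ s, Q.law φ t s * Q.kernel φ t s s' := rfl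

/-- The other factors of the product over areas and types have mass one, for any real patrolling
probability; hence no admissibility of `φ` is required. All copies of `(i, j)` are kept together, as
their counts are studied jointly. -/
theorem kernel_marginal (φ : Q.Policy h) (t : ℕ) (s : Q.ScaledState h) (i : Fin I) (j : Fin J)
    (f : (Fin h → Q.State i j) → ℝ) :
    ∑ s', Q.kernel φ t s s' * f (s' i j) =
      ∑ y : Fin h → Q.State i j,
        (∏ k, Q.trans i j t (s i j k) (Q.patrolProb φ t s i j k) (y k)) * f y := by
  have hk : ∀ i j, ∑ y : Fin h → Q.State i j,
      ∏ k, Q.trans i j t (s i j k) (Q.patrolProb φ t s i j k) (y k) = 1 := by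
    intro i j
    rw [sum_prod_weights (β := fun _ => Q.State i j)
      (fun k => Q.trans i j t (s i j k) (Q.patrolProb φ t s i j k))]
    exact Finset.prod_eq_one fun k _ => Q.trans_sum ..
  have hj : ∀ i, ∑ y : ∀ j, Fin h → Q.State i j,
      ∏ j, ∏ k, Q.trans i j t (s i j k) (Q.patrolProb φ t s i j k) (y j k) = 1 := by
    intro i
    rw [sum_prod_weights (β := fun j => Fin h → Q.State i j)
      (fun j y => ∏ k, Q.trans i j t (s i j k) (Q.patrolProb φ t s i j k) (y k))]
    simp [hk]
  have h1 := sum_prod_weights_marginal (β := fun i => ∀ j, Fin h → Q.State i j)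
    (fun i y => ∏ j, ∏ k, Q.trans i j t (s i j k) (Q.patrolProb φ t s i j k) (y j k)) hj i
    (fun y => f (y j))
  have h2 := sum_prod_weights_marginal (β := fun j => Fin h → Q.State i j)
    (fun j y => ∏ k, Q.trans i j t (s i j k) (Q.patrolProb φ t s i j k) (y k)) (hk i) j f
  exact h1.trans h2

theorem kernel_marginal_single (φ : Q.Policy h) (t : ℕ) (s : Q.ScaledState h) (i : Fin I)
    (j : Fin J) (k : Fin h) (f : Q.State i j → ℝ) :
    ∑ s', Q.kernel φ t s s' * f (s' i j k) =
      ∑ b, Q.trans i j t (s i j k) (Q.patrolProb φ t s i j k) b * f b := by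
  rw [Q.kernel_marginal φ t s i j fun y => f (y k)]
  exact sum_prod_weights_marginal (β := fun _ => Q.State i j)
    (fun k => Q.trans i j t (s i j k) (Q.patrolProb φ t s i j k))
    (fun k => Q.trans_sum ..) k f

theorem expect_succ (φ : Q.Policy h) (t : ℕ) (f : Q.ScaledState h → ℝ) :
    Q.expect φ (t + 1) f = Q.expect φ t fun s => ∑ s', Q.kernel φ t s s' * f s' := by
  simp only [expect, law_succ, Finset.sum_mul, Finset.mul_sum]
  rw [Finset.sum_comm]
  refine Finset.sum_congr rfl fun s _ => Finset.sum_congr rfl fun s' _ => by ring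

/-- A state of the scaled system, as a family of copies of the unscaled system. -/
def copies (h : ℕ) : Q.ScaledState h ≃ (Fin h → ∀ i j, Q.State i j) where
  toFun s k i j := s i j k
  invFun x i j k := x k i j
  left_inv _ := rfl
  right_inv _ := rfl

/-- Initially the independence is over the copies `k` only: the pairs `(i, j)` of one copy may be
dependent. -/
theorem expect_zero (φ : Q.Policy h) (f : (Fin h → ∀ i j, Q.State i j) → ℝ) :
    (Q.expect φ 0 fun s => f fun k i j => s i j k) =
      ∑ x : Fin h → ∀ i j, Q.State i j, (∏ k, Q.init (x k)) * f x :=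
  (Q.copies h).sum_comp fun x => (∏ k, Q.init (x k)) * f x

theorem sum_initMarginal_mul (i : Fin I) (j : Fin J) (f : Q.State i j → ℝ) :
    ∑ b, Q.initMarginal i j b * f b = ∑ x, Q.init x * f (x i j) := by
  classical
  simp only [initMarginal, Finset.sum_mul]
  rw [Finset.sum_comm]
  refine Finset.sum_congr rfl fun x _ => ?_
  rw [Finset.sum_eq_single (x i j)]
  · simp
  · intro b _ hb
    simp [hb.symm]
  · simp

theorem initMarginal_nonneg (i : Fin I) (j : Fin J) (b : Q.State i j) :
    0 ≤ Q.initMarginal i j b := by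
  classical
  refine Finset.sum_nonneg fun x _ => ?_
  split_ifs
  exacts [Q.init_nonneg x, le_rfl]

theorem expect_zero_single (φ : Q.Policy h) (i : Fin I) (j : Fin J) (k : Fin h)
    (f : Q.State i j → ℝ) :
    (Q.expect φ 0 fun s => f (s i j k)) = ∑ b, Q.initMarginal i j b * f b := by
  rw [Q.expect_zero φ fun x => f (x k i j), sum_initMarginal_mul]
  exact sum_prod_weights_marginal (β := fun _ => ∀ i j, Q.State i j) (fun _ => Q.init)
    (fun _ => Q.init_sum) k fun x => f (x i j)

/-! ### Linearity, total mass and monotonicity of the expectation. -/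

theorem expect_add (φ : Q.Policy h) (t : ℕ) (f g : Q.ScaledState h → ℝ) :
    (Q.expect φ t fun s => f s + g s) = Q.expect φ t f + Q.expect φ t g := by
  simp [expect, mul_add, Finset.sum_add_distrib]

theorem expect_sub (φ : Q.Policy h) (t : ℕ) (f g : Q.ScaledState h → ℝ) :
    (Q.expect φ t fun s => f s - g s) = Q.expect φ t f - Q.expect φ t g := by
  simp [expect, mul_sub, Finset.sum_sub_distrib]

theorem expect_const_mul (φ : Q.Policy h) (t : ℕ) (c : ℝ) (f : Q.ScaledState h → ℝ) :
    (Q.expect φ t fun s => c * f s) = c * Q.expect φ t f := by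
  simp only [expect, Finset.mul_sum]
  exact Finset.sum_congr rfl fun s _ => by ring

theorem expect_sum {κ : Type*} (S : Finset κ) (φ : Q.Policy h) (t : ℕ)
    (f : κ → Q.ScaledState h → ℝ) :
    (Q.expect φ t fun s => ∑ a ∈ S, f a s) = ∑ a ∈ S, Q.expect φ t (f a) := by
  simp only [expect, Finset.mul_sum]
  exact Finset.sum_comm

theorem expect_one (φ : Q.Policy h) (t : ℕ) : (Q.expect φ t fun _ => 1) = 1 := by
  induction t with
  | zero =>
    rw [Q.expect_zero φ fun _ => 1]
    simp only [mul_one]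
    rw [sum_prod_weights (β := fun _ => ∀ i j, Q.State i j) fun _ => Q.init]
    simp [Q.init_sum]
  | succ t ih =>
    rw [expect_succ]
    convert ih using 2
    ext s
    simp only [mul_one, kernel]
    rw [sum_prod_weights (β := fun i => ∀ j, Fin h → Q.State i j)
      fun i y => ∏ j, ∏ k, Q.trans i j t (s i j k) (Q.patrolProb φ t s i j k) (y j k)]
    refine Finset.prod_eq_one fun i _ => ?_
    rw [sum_prod_weights (β := fun j => Fin h → Q.State i j)
      fun j y => ∏ k, Q.trans i j t (s i j k) (Q.patrolProb φ t s i j k) (y k)]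
    refine Finset.prod_eq_one fun j _ => ?_
    rw [sum_prod_weights (β := fun _ => Q.State i j)
      (fun k => Q.trans i j t (s i j k) (Q.patrolProb φ t s i j k))]
    exact Finset.prod_eq_one fun k _ => Q.trans_sum ..

/-- The patrolling probabilities are probabilities, before the end of the time horizon. -/
def IsRandomised (φ : Q.Policy h) : Prop :=
  ∀ s, ∀ t < T, ∀ i j k, (fun i' => φ s t i i' j k) ∈ Q.randActions i j

theorem active_mem {i : Fin I} {j : Fin J} {a : Fin I → ℝ} (ha : a ∈ Q.randActions i j) :
    0 ≤ Q.active i j a ∧ Q.active i j a ≤ 1 :=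
  ⟨Finset.sum_nonneg fun i' _ => (ha.1 i').1, ha.2.1⟩

variable {Q}

theorem IsRandomised.kernel_nonneg {φ : Q.Policy h} (hφ : Q.IsRandomised φ) {t : ℕ} (ht : t < T)
    (s s' : Q.ScaledState h) : 0 ≤ Q.kernel φ t s s' :=
  Finset.prod_nonneg fun i _ => Finset.prod_nonneg fun j _ => Finset.prod_nonneg fun k _ =>
    Q.trans_nonneg i j t _ (Q.active_mem (hφ s t ht i j k)).1 (Q.active_mem (hφ s t ht i j k)).2 _

theorem IsRandomised.law_nonneg {φ : Q.Policy h} (hφ : Q.IsRandomised φ) {t : ℕ} (ht : t ≤ T)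
    (s : Q.ScaledState h) : 0 ≤ Q.law φ t s := by
  induction t generalizing s with
  | zero => exact Finset.prod_nonneg fun k _ => Q.init_nonneg _
  | succ t ih =>
    exact Finset.sum_nonneg fun s' _ => mul_nonneg (ih (by omega) s') (hφ.kernel_nonneg ht _ _)

theorem IsRandomised.expect_mono {φ : Q.Policy h} (hφ : Q.IsRandomised φ) {t : ℕ} (ht : t ≤ T)
    {f g : Q.ScaledState h → ℝ} (hfg : ∀ s, f s ≤ g s) : Q.expect φ t f ≤ Q.expect φ t g :=
  Finset.sum_le_sum fun s _ => mul_le_mul_of_nonneg_left (hfg s) (hφ.law_nonneg ht s)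

end PatrolProblem

namespace PatrolProblem

variable {I J T : ℕ} (Q : PatrolProblem I J T) {h : ℕ}

/-! ### Processes under local policies -/

/-- The law at time `t` of the process of the pair `(i, j)` under a local policy. -/
def localLaw (α : Q.LocalPolicy) (i : Fin I) (j : Fin J) : ℕ → Q.State i j → ℝ
  | 0, b => Q.initMarginal i j b
  | t + 1, b' => ∑ b, localLaw α i j t b * Q.trans i j t b (Q.active i j (α i j b t)) b'

/-- Under a local policy each single process is a Markov chain of its own, because its marginal
transition only involves its own state. -/
theorem expect_lift (α : Fin h → Q.LocalPolicy) (t : ℕ) (i : Fin I) (j : Fin J) (k : Fin h)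
    (f : Q.State i j → ℝ) :
    (Q.expect (Q.lift α) t fun s => f (s i j k)) = ∑ b, Q.localLaw (α k) i j t b * f b := by
  induction t generalizing f with
  | zero => exact Q.expect_zero_single ..
  | succ t ih =>
    rw [expect_succ]
    simp_rw [Q.kernel_marginal_single]
    refine (ih fun b => ∑ b', Q.trans i j t b (Q.active i j (α k i j b t)) b' * f b').trans ?_
    simp only [localLaw, Finset.sum_mul, Finset.mul_sum]
    rw [Finset.sum_comm]
    exact Finset.sum_congr rfl fun b _ => Finset.sum_congr rfl fun b' _ => by ring

/-- The expected cumulative cost of the unscaled system under a local policy. -/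
def localCost (α : Q.LocalPolicy) : ℝ :=
  ∑ t ∈ Finset.range T, ∑ i, ∑ j, ∑ b,
    Q.localLaw α i j t b * Q.costE i j b (Q.active i j (α i j b t)) t

theorem expCost_lift (α : Fin h → Q.LocalPolicy) :
    Q.expCost (Q.lift α) = (1 / (h : ℝ)) * ∑ k, Q.localCost (α k) := by
  simp only [expCost, localCost]
  congr 1
  symm
  rw [Finset.sum_comm]
  refine Finset.sum_congr rfl fun t _ => ?_
  rw [Finset.sum_comm]
  refine Finset.sum_congr rfl fun i _ => ?_
  rw [Finset.sum_comm]
  refine Finset.sum_congr rfl fun j _ => Finset.sum_congr rfl fun k _ => ?_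
  exact (Q.expect_lift α t i j k fun b => Q.costE i j b (Q.active i j (α k i j b t)) t).symm

/-! ### Bellman equations -/

/-- The marginal cost of patrolling for the continuation value `W`. -/
def marginalOf (i : Fin I) (j : Fin J) (s : Q.State i j) (t : ℕ) (W : Q.State i j → ℝ) : ℝ :=
  Q.cost i j s true t - Q.cost i j s false t +
    ∑ s', (Q.P i j t s true s' - Q.P i j t s false s') * W s'

/-- The right-hand side is affine in the action, and the slope in the direction of each movement is
its index. This is where the indices come from. -/
theorem bellman_eq (γ : Mult I J) (i : Fin I) (j : Fin J) (s : Q.State i j) (a : Fin I → ℝ)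
    (t : ℕ) (W : Q.State i j → ℝ) :
    Q.bellman γ i j s a t W = Q.bellman γ i j s 0 t W +
      ∑ i' ∈ Q.nbr i j, a i' * (Q.marginalOf i j s t W - γ i' j t) := by
  have h0 : Q.active i j 0 = 0 := by simp [active]
  simp only [bellman, lagCost, h0, costE, trans, marginalOf, mul_sub, Finset.sum_sub_distrib,
    ← Finset.sum_mul]
  change _ = _ + (Q.active i j a * _ - _)
  set e := Q.active i j a
  have e1 : ∑ s', (e * Q.P i j t s true s' + (1 - e) * Q.P i j t s false s') * W s' =
      e * ∑ s', (Q.P i j t s true s' - Q.P i j t s false s') * W s' +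
        ∑ s', Q.P i j t s false s' * W s' := by
    rw [Finset.mul_sum, ← Finset.sum_add_distrib]
    exact Finset.sum_congr rfl fun s' _ => by ring
  rw [e1]
  have e2 : ∑ i' ∈ Q.nbr i j, γ i' j t * a i' = ∑ i' ∈ Q.nbr i j, a i' * γ i' j t :=
    Finset.sum_congr rfl fun i' _ => by ring
  rw [e2]
  simp only [Pi.zero_apply, mul_zero, Finset.sum_const_zero, zero_mul, zero_add, sub_zero, one_mul]
  ring

theorem value_step (γ : Mult I J) (i : Fin I) (j : Fin J) (s : Q.State i j) {t : ℕ} (ht : t < T) :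
    Q.value γ i j s t =
      min (Q.bellman γ i j s 0 t fun s' => Q.value γ i j s' (t + 1))
        ((Q.nbr i j).inf' ⟨i, Q.self_mem_nbr i j⟩ fun i' =>
          Q.bellman γ i j s (Pi.single i' 1) t fun s' => Q.value γ i j s' (t + 1)) := by
  obtain ⟨n, hn⟩ : ∃ n, T - t = n + 1 := ⟨T - t - 1, by omega⟩
  have hn' : T - (t + 1) = n := by omega
  have ht' : T - (n + 1) = t := by omega
  simp only [value, hn, hn', valueAux, ht']

theorem bellman_single (γ : Mult I J) {i : Fin I} {j : Fin J} (s : Q.State i j) {i' : Fin I}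
    (hi' : i' ∈ Q.nbr i j) (t : ℕ) (W : Q.State i j → ℝ) :
    Q.bellman γ i j s (Pi.single i' 1) t W =
      Q.bellman γ i j s 0 t W + (Q.marginalOf i j s t W - γ i' j t) := by
  rw [bellman_eq, Finset.sum_eq_single_of_mem i' hi']
  · simp
  · intro b _ hb
    simp [hb]

theorem value_le_bellman (γ : Mult I J) {i : Fin I} {j : Fin J} (s : Q.State i j) {t : ℕ}
    (ht : t < T) {a : Fin I → ℝ} (ha : a ∈ Q.randActions i j) :
    Q.value γ i j s t ≤ Q.bellman γ i j s a t fun s' => Q.value γ i j s' (t + 1) := by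
  have h0 : Q.value γ i j s t ≤ Q.bellman γ i j s 0 t fun s' => Q.value γ i j s' (t + 1) := by
    rw [Q.value_step γ i j s ht]
    exact min_le_left _ _
  have h1 : ∀ i' ∈ Q.nbr i j, Q.value γ i j s t ≤
      (Q.bellman γ i j s 0 t fun s' => Q.value γ i j s' (t + 1)) +
        (Q.marginalOf i j s t (fun s' => Q.value γ i j s' (t + 1)) - γ i' j t) := by
    intro i' hi'
    rw [← Q.bellman_single γ s hi', Q.value_step γ i j s ht]
    exact (min_le_right _ _).trans (Finset.inf'_le _ hi')
  rw [bellman_eq]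
  set B := Q.bellman γ i j s 0 t fun s' => Q.value γ i j s' (t + 1)
  -- All slopes are at least `-u`, where `u ≥ 0`, and the action has total mass at most one, so it
  -- lowers `B` by at most `u`.
  set u := B - Q.value γ i j s t
  have h2 : ∑ i' ∈ Q.nbr i j, a i' * (-u) ≤ ∑ i' ∈ Q.nbr i j,
      a i' * (Q.marginalOf i j s t (fun s' => Q.value γ i j s' (t + 1)) - γ i' j t) :=
    Finset.sum_le_sum fun i' hi' => mul_le_mul_of_nonneg_left (by linarith [h1 i' hi']) (ha.1 i').1
  rw [← Finset.sum_mul] at h2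
  nlinarith [ha.2.1]

theorem exists_isMinArgmax (γ : Mult I J) (i : Fin I) (j : Fin J) (t : ℕ) :
    ∃ i', Q.IsMinArgmax γ i j t i' := by
  classical
  obtain ⟨i₂, hi₂, hmax⟩ := Finset.exists_max_image (Q.nbr i j) (fun i' => γ i' j t)
    ⟨i, Q.self_mem_nbr i j⟩
  obtain ⟨i₃, hi₃, hmin⟩ := Finset.exists_min_image
    ((Q.nbr i j).filter fun i' => Q.IsArgmax γ i j t i') id
    ⟨i₂, Finset.mem_filter.mpr ⟨hi₂, hi₂, hmax⟩⟩
  rw [Finset.mem_filter] at hi₃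
  exact ⟨i₃, hi₃.2, fun i'' h'' => hmin i'' (Finset.mem_filter.mpr ⟨h''.1, h''⟩)⟩

/-- Complementary slackness: a threshold policy only uses movements with nonpositive slope, and uses
one of steepest descent with probability one when the descent is strict. -/
theorem IsThreshold.value_eq {γ : Mult I J} {α : Q.LocalPolicy} (hα : Q.IsThreshold γ α)
    {i : Fin I} {j : Fin J} (s : Q.State i j) {t : ℕ} (ht : t < T) :
    Q.value γ i j s t =
      Q.bellman γ i j s (α i j s t) t fun s' => Q.value γ i j s' (t + 1) := by
  obtain ⟨hr, hth⟩ := hα i j s t ht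
  refine le_antisymm (Q.value_le_bellman γ s ht hr) ?_
  have hm : Q.marginal γ i j s t =
    Q.marginalOf i j s t (fun s' => Q.value γ i j s' (t + 1)) := rfl
  rw [bellman_eq, ← hm, Q.value_step γ i j s ht]
  set B := Q.bellman γ i j s 0 t fun s' => Q.value γ i j s' (t + 1)
  have hterm : ∀ i' ∈ Q.nbr i j, α i j s t i' * (Q.marginal γ i j s t - γ i' j t) ≤ 0 := by
    intro i' hi'
    by_cases h1 : Q.marginal γ i j s t < γ i' j t ∧ Q.IsMinArgmax γ i j t i'
    · exact mul_nonpos_of_nonneg_of_nonpos (hr.1 i').1 (by linarith [h1.1])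
    by_cases h2 : γ i' j t = Q.marginal γ i j s t ∧ Q.IsArgmax γ i j t i'
    · simp [h2.1]
    · simp [(hth i' hi').2 h1 h2]
  refine le_min (by linarith [Finset.sum_nonpos hterm]) (Finset.le_inf' _ _ fun i₁ hi₁ => ?_)
  rw [Q.bellman_single γ s hi₁, ← hm]
  gcongr
  by_cases hneg : 0 ≤ Q.marginal γ i j s t - γ i₁ j t
  · exact (Finset.sum_nonpos hterm).trans hneg
  -- Some slope is negative, so the smallest maximiser of `γ` is chosen with probability one and has
  -- the least slope; the remaining terms can only help.
  obtain ⟨i₃, h3⟩ := Q.exists_isMinArgmax γ i j t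
  have hi₃ := h3.1.1
  have h31 := h3.1.2 i₁ hi₁
  have h4 := (hth i₃ hi₃).1 ⟨by linarith, h3⟩
  rw [← Finset.add_sum_erase _ _ hi₃, h4]
  linarith [Finset.sum_nonpos fun i' (hi' : i' ∈ (Q.nbr i j).erase i₃) =>
    hterm i' (Finset.mem_of_mem_erase hi')]

theorem value_end (γ : Mult I J) (i : Fin I) (j : Fin J) (s : Q.State i j) :
    Q.value γ i j s T = 0 := by
  simp [value, valueAux]

/-! ### Duality -/

/-- The value function telescopes along the process, and what is left in each slot is the Bellman
gap of the action taken. This is an identity for arbitrary policies. -/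
theorem sum_expect_lagCost (γ : Mult I J) (φ : Q.Policy h) (i : Fin I) (j : Fin J) (k : Fin h) :
    ∑ t ∈ Finset.range T,
        (Q.expect φ t fun s => Q.lagCost γ i j (s i j k) (fun i' => φ s t i i' j k) t) =
      ∑ b, Q.initMarginal i j b * Q.value γ i j b 0 +
      ∑ t ∈ Finset.range T, Q.expect φ t fun s =>
        (Q.bellman γ i j (s i j k) (fun i' => φ s t i i' j k) t
          fun s' => Q.value γ i j s' (t + 1)) - Q.value γ i j (s i j k) t := by
  have step : ∀ t, (Q.expect φ t fun s =>
        Q.lagCost γ i j (s i j k) (fun i' => φ s t i i' j k) t) =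
      ((Q.expect φ t fun s => Q.value γ i j (s i j k) t) -
        Q.expect φ (t + 1) fun s => Q.value γ i j (s i j k) (t + 1)) +
      Q.expect φ t fun s =>
        (Q.bellman γ i j (s i j k) (fun i' => φ s t i i' j k) t
          fun s' => Q.value γ i j s' (t + 1)) - Q.value γ i j (s i j k) t := by
    intro t
    rw [expect_succ]
    simp_rw [Q.kernel_marginal_single φ t _ i j k fun b => Q.value γ i j b (t + 1)]
    rw [expect_sub]
    simp only [bellman]
    rw [expect_add]
    simp only [patrolProb]
    ring
  simp_rw [step]
  rw [Finset.sum_add_distrib, Finset.sum_range_sub'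
    (fun t => Q.expect φ t fun s => Q.value γ i j (s i j k) t),
    Q.expect_zero_single φ i j k fun b => Q.value γ i j b 0]
  simp only [value_end]
  simp [expect]

/-- Symmetry of the neighbourhoods allows the prices to be collected by origin instead of by
destination. -/
theorem sum_nbr_mul (j : Fin J) (G : Fin I → ℝ) (F : Fin I → Fin I → ℝ) :
    ∑ i, ∑ i' ∈ Q.nbr i j, G i' * F i i' = ∑ i, G i * ∑ i' ∈ Q.nbr i j, F i' i := by
  simp_rw [Finset.mul_sum]
  refine Finset.sum_comm' fun i i' => ?_
  simpa using ⟨Q.nbr_symm _ _ _, Q.nbr_symm _ _ _⟩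

theorem expect_lagCost (γ : Mult I J) (φ : Q.Policy h) (t : ℕ) (i : Fin I) (j : Fin J)
    (k : Fin h) :
    (Q.expect φ t fun s => Q.lagCost γ i j (s i j k) (fun i' => φ s t i i' j k) t) =
      (Q.expect φ t fun s => Q.costE i j (s i j k) (Q.active i j fun i' => φ s t i i' j k) t) +
      γ i j t * (Q.expect φ t fun s => Q.ind (s i j k)) -
      ∑ i' ∈ Q.nbr i j, γ i' j t * Q.expect φ t fun s => φ s t i i' j k := by
  simp only [lagCost]
  rw [expect_sub, expect_add, expect_const_mul, expect_sum]
  simp_rw [expect_const_mul]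

/-- The expected number of type-`j` agents of area `i` that move, minus the expected number of
those agents. -/
def imbalance (φ : Q.Policy h) (t : ℕ) (i : Fin I) (j : Fin J) (k : Fin h) : ℝ :=
  (∑ i' ∈ Q.nbr i j, Q.expect φ t fun s => φ s t i' i j k) -
    Q.expect φ t fun s => Q.ind (s i j k)

/-- Both halves of duality are read off from this identity, by fixing the signs of the two
correction terms. -/
theorem sum_cost_eq (γ : Mult I J) (φ : Q.Policy h) (k : Fin h) :
    ∑ t ∈ Finset.range T, ∑ i, ∑ j,
        (Q.expect φ t fun s => Q.costE i j (s i j k) (Q.active i j fun i' => φ s t i i' j k) t) =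
      Q.dualObjective (Q.value γ) +
      ∑ t ∈ Finset.range T, ∑ i, ∑ j, γ i j t * Q.imbalance φ t i j k +
      ∑ t ∈ Finset.range T, ∑ i, ∑ j, Q.expect φ t fun s =>
        (Q.bellman γ i j (s i j k) (fun i' => φ s t i i' j k) t
          fun s' => Q.value γ i j s' (t + 1)) - Q.value γ i j (s i j k) t := by
  have h1 : ∑ t ∈ Finset.range T, ∑ i, ∑ j,
      (Q.expect φ t fun s => Q.lagCost γ i j (s i j k) (fun i' => φ s t i i' j k) t) =
      Q.dualObjective (Q.value γ) +
      ∑ t ∈ Finset.range T, ∑ i, ∑ j, Q.expect φ t fun s =>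
        (Q.bellman γ i j (s i j k) (fun i' => φ s t i i' j k) t
          fun s' => Q.value γ i j s' (t + 1)) - Q.value γ i j (s i j k) t := by
    rw [Finset.sum_comm]
    simp_rw [Finset.sum_comm (s := Finset.range T)]
    simp_rw [sum_expect_lagCost, Finset.sum_add_distrib]
    rfl
  have h2 : ∀ t, ∑ i, ∑ j,
      (Q.expect φ t fun s => Q.lagCost γ i j (s i j k) (fun i' => φ s t i i' j k) t) =
      ∑ i, ∑ j, (Q.expect φ t fun s =>
        Q.costE i j (s i j k) (Q.active i j fun i' => φ s t i i' j k) t) -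
      ∑ i, ∑ j, γ i j t * Q.imbalance φ t i j k := by
    intro t
    have h3 : ∑ i, ∑ j, ∑ i' ∈ Q.nbr i j, γ i' j t * Q.expect φ t (fun s => φ s t i i' j k) =
        ∑ i, ∑ j, γ i j t * ∑ i' ∈ Q.nbr i j, Q.expect φ t fun s => φ s t i' i j k := by
      rw [Finset.sum_comm]
      simp_rw [Q.sum_nbr_mul _ (fun i' => γ i' _ t) fun i i' =>
        Q.expect φ t fun s => φ s t i i' _ k]
      exact Finset.sum_comm
    simp_rw [expect_lagCost, imbalance, mul_sub, Finset.sum_sub_distrib, Finset.sum_add_distrib]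
    rw [h3]
    ring
  rw [add_right_comm, ← h1]
  simp_rw [h2, Finset.sum_sub_distrib]
  ring

/-- Weak duality. -/
theorem IsRelaxedApplicable.le_expCost (γ : Mult I J) (hh : 0 < h) {φ : Q.Policy h}
    (hφ : Q.IsRelaxedApplicable φ) : Q.dualObjective (Q.value γ) ≤ Q.expCost φ := by
  have hh' : (0 : ℝ) < h := by exact_mod_cast hh
  have hcost : Q.expCost φ = (1 / (h : ℝ)) * ∑ k, ∑ t ∈ Finset.range T, ∑ i, ∑ j,
      (Q.expect φ t fun s => Q.costE i j (s i j k) (Q.active i j fun i' => φ s t i i' j k) t) := by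
    rw [expCost]
    congr 1
    symm
    rw [Finset.sum_comm]
    refine Finset.sum_congr rfl fun t _ => ?_
    rw [Finset.sum_comm]
    refine Finset.sum_congr rfl fun i _ => ?_
    exact Finset.sum_comm
  -- The relaxed constraint only controls the sum over the copies, so the imbalances cancel after
  -- summation over `k`.
  have hbal : ∑ k, ∑ t ∈ Finset.range T, ∑ i, ∑ j, γ i j t * Q.imbalance φ t i j k = 0 := by
    rw [Finset.sum_comm]
    refine Finset.sum_eq_zero fun t ht => ?_
    rw [Finset.sum_comm]
    refine Finset.sum_eq_zero fun i _ => ?_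
    rw [Finset.sum_comm]
    refine Finset.sum_eq_zero fun j _ => ?_
    have h1 := hφ.2 t (Finset.mem_range.mp ht) i j
    have h2 := mul_left_cancel₀ (by positivity) h1
    rw [← Finset.mul_sum]
    simp only [imbalance, Finset.sum_sub_distrib]
    rw [Finset.sum_comm, h2, sub_self, mul_zero]
  have hgap : ∀ k, 0 ≤ ∑ t ∈ Finset.range T, ∑ i, ∑ j, Q.expect φ t fun s =>
        (Q.bellman γ i j (s i j k) (fun i' => φ s t i i' j k) t
          fun s' => Q.value γ i j s' (t + 1)) - Q.value γ i j (s i j k) t := by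
    intro k
    refine Finset.sum_nonneg fun t ht => Finset.sum_nonneg fun i _ => Finset.sum_nonneg fun j _ => ?_
    rw [Finset.mem_range] at ht
    exact Finset.sum_nonneg fun s _ => mul_nonneg (IsRandomised.law_nonneg hφ.1 ht.le s)
      (sub_nonneg.mpr (Q.value_le_bellman γ _ ht (hφ.1 s t ht i j k)))
  rw [hcost]
  simp_rw [Q.sum_cost_eq γ φ, Finset.sum_add_distrib]
  rw [hbal, Finset.sum_const, Finset.card_univ, Fintype.card_fin, nsmul_eq_mul, mul_add, mul_add,
    mul_zero, add_zero, ← mul_assoc, one_div_mul_cancel hh'.ne', one_mul]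
  have := Finset.sum_nonneg fun k (_ : k ∈ Finset.univ) => hgap k
  have := mul_nonneg (one_div_nonneg.mpr hh'.le) this
  linarith

/-- Strong duality for balanced mixtures of threshold policies. -/
theorem IsBalancedMixture.sum_localCost {γ : Mult I J} {M : ℕ} {α : Fin (M + 1) → Q.LocalPolicy}
    (hα : ∀ m, Q.IsThreshold γ (α m)) {w : Fin (M + 1) → ℝ} (hw : ∑ m, w m = 1)
    (hbal : Q.IsBalancedMixture α w) :
    ∑ m, w m * Q.localCost (α m) = Q.dualObjective (Q.value γ) := by
  -- The Bellman gaps of a threshold policy vanish. The imbalance of a single `α m` need not vanish,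
  -- only its `w`-average.
  have hm : ∀ m, Q.localCost (α m) = Q.dualObjective (Q.value γ) +
      ∑ t ∈ Finset.range T, ∑ i, ∑ j,
        γ i j t * Q.imbalance (Q.lift fun _ : Fin 1 => α m) t i j 0 := by
    intro m
    have h1 := Q.sum_cost_eq γ (Q.lift fun _ : Fin 1 => α m) 0
    have h2 := Q.expCost_lift fun _ : Fin 1 => α m
    simp only [expCost, Nat.cast_one, div_one, one_mul, Finset.univ_unique, Fin.default_eq_zero,
      Finset.sum_singleton] at h2
    rw [← h2]
    refine h1.trans (add_eq_left.mpr ?_)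
    refine Finset.sum_eq_zero fun t ht => Finset.sum_eq_zero fun i _ =>
      Finset.sum_eq_zero fun j _ => Finset.sum_eq_zero fun s _ => mul_eq_zero_of_right _ ?_
    exact sub_eq_zero.mpr ((hα m).value_eq Q (s i j 0) (Finset.mem_range.mp ht)).symm
  simp_rw [hm, mul_add, Finset.sum_add_distrib, ← Finset.sum_mul, hw, one_mul]
  refine add_eq_left.mpr ?_
  simp_rw [Finset.mul_sum]
  rw [Finset.sum_comm]
  refine Finset.sum_eq_zero fun t ht => ?_
  rw [Finset.sum_comm]
  refine Finset.sum_eq_zero fun i _ => ?_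
  rw [Finset.sum_comm]
  refine Finset.sum_eq_zero fun j _ => ?_
  simp_rw [mul_left_comm, ← Finset.mul_sum]
  exact mul_eq_zero_of_right _ (hbal i j t (Finset.mem_range.mp ht))

end PatrolProblem

namespace PatrolProblem

variable {I J T : ℕ} (Q : PatrolProblem I J T) {h : ℕ}

/-! ### The index policy -/

/-- The additive form avoids truncated subtraction. -/
theorem moved_update (ϖ : Origins I h) (x : Fin I × Fin h) (o : Option (Fin I)) (b : Fin I) :
    moved (Function.update ϖ x o) b + (if ϖ x = some b then 1 else 0) =
      moved ϖ b + (if o = some b then 1 else 0) := by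
  simp only [moved, Finset.card_filter]
  rw [Fintype.sum_eq_add_sum_compl x, Fintype.sum_eq_add_sum_compl x (fun y => if ϖ y = some b then
    1 else 0), Function.update_self]
  have : ∑ y ∈ ({x} : Finset (Fin I × Fin h))ᶜ,
      (if Function.update ϖ x o y = some b then 1 else 0) =
      ∑ y ∈ ({x} : Finset (Fin I × Fin h))ᶜ, (if ϖ y = some b then 1 else 0) := by
    refine Finset.sum_congr rfl fun y hy => ?_
    rw [Function.update_of_ne (by simpa using hy)]
  rw [this]
  ring

variable {Q}

/-- The movement from `i'` to `(i, k)` is not blocked by an earlier one in the final assignment. -/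
structure IsStable (A : Fin I → ℕ) (R : Fin I × Fin h × Fin I → Fin I × Fin h × Fin I → Prop)
    (L : List (Fin I × Fin h × Fin I)) (ϖ : Origins I h) : Prop where
  mem : ∀ x r, ϖ x = some r → (x.1, x.2, r) ∈ L
  moved_le : ∀ a, moved ϖ a ≤ A a
  stable : ∀ y ∈ L, ϖ (y.1, y.2.1) = some y.2.2 ∨
    (∃ r, ϖ (y.1, y.2.1) = some r ∧ R (y.1, y.2.1, r) y) ∨
    (moved ϖ y.2.2 = A y.2.2 ∧ ∀ x, ϖ x = some y.2.2 → R (x.1, x.2, y.2.2) y)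

/-- Induction on the last movement considered. Accepted movements are never undone, so a reason for
an earlier rejection persists: a destination stays taken, and an exhausted origin stays exhausted by
the same movements. -/
theorem isStable_indexOrigins (s : Q.ScaledState h) (j : Fin J)
    (R : Fin I × Fin h × Fin I → Fin I × Fin h × Fin I → Prop)
    (L : List (Fin I × Fin h × Fin I)) (hL : L.Pairwise R) :
    IsStable (fun a => Q.agents s a j) R L (Q.indexOrigins s j L) := by
  induction L using List.reverseRecOn with
  | nil =>
    exact ⟨by simp [indexOrigins], by simp [indexOrigins, moved], by simp⟩
  | append_singleton L a ih =>
    rw [List.pairwise_append] at hL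
    obtain ⟨hL1, -, hLa⟩ := hL
    replace hLa : ∀ x ∈ L, R x a := fun x hx => hLa x hx a (by simp)
    have ih := ih hL1
    have hstep : Q.indexOrigins s j (L ++ [a]) = Q.indexStep s j (Q.indexOrigins s j L) a := by
      simp [indexOrigins]
    rw [hstep]
    set ϖ := Q.indexOrigins s j L
    unfold indexStep
    split_ifs with hc
    · have hmono : ∀ x r, ϖ x = some r →
          Function.update ϖ (a.1, a.2.1) (some a.2.2) x = some r := by
        intro x r hx
        rw [Function.update_of_ne]
        · exact hx
        · rintro rfl
          simp [hc.1] at hx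
      have hmoved : ∀ b, moved (Function.update ϖ (a.1, a.2.1) (some a.2.2)) b =
          moved ϖ b + if a.2.2 = b then 1 else 0 := by
        intro b
        have := moved_update ϖ (a.1, a.2.1) (some a.2.2) b
        simpa [hc.1] using this
      refine ⟨?_, ?_, ?_⟩
      · intro x r hx
        by_cases hxa : x = (a.1, a.2.1)
        · subst hxa
          simp only [Function.update_self, Option.some.injEq] at hx
          subst hx
          simp
        · rw [Function.update_of_ne hxa] at hx
          exact List.mem_append_left _ (ih.mem x r hx)
      · intro b
        rw [hmoved]
        split_ifs with hab
        · subst hab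
          exact hc.2
        · simpa using ih.moved_le b
      · intro y hy
        rw [List.mem_append, List.mem_singleton] at hy
        rcases hy with hy | rfl
        · rcases ih.stable y hy with h1 | ⟨r, h1, h2⟩ | ⟨h1, h2⟩
          · exact Or.inl (hmono _ _ h1)
          · exact Or.inr (Or.inl ⟨r, hmono _ _ h1, h2⟩)
          -- The new movement was accepted, hence does not start in the exhausted area.
          · have hne : a.2.2 ≠ y.2.2 := by
              intro e
              have := hc.2
              rw [e, h1] at this
              exact lt_irrefl _ this
            refine Or.inr (Or.inr ⟨by simp [hmoved, hne, h1], fun x hx => h2 x ?_⟩)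
            by_cases hxa : x = (a.1, a.2.1)
            · subst hxa
              simp [hne] at hx
            · rwa [Function.update_of_ne hxa] at hx
        · exact Or.inl (by simp)
    · refine ⟨fun x r hx => List.mem_append_left _ (ih.mem x r hx), ih.moved_le, ?_⟩
      intro y hy
      rw [List.mem_append, List.mem_singleton] at hy
      rcases hy with hy | rfl
      · exact ih.stable y hy
      · rw [not_and_or, not_lt] at hc
        rcases hc with hc | hc
        · obtain ⟨r, hr⟩ := Option.ne_none_iff_exists'.mp hc
          exact Or.inr (Or.inl ⟨r, hr, hLa _ (ih.mem _ _ hr)⟩)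
        · exact Or.inr (Or.inr ⟨le_antisymm (ih.moved_le _) hc,
            fun x hx => hLa _ (ih.mem _ _ hx)⟩)

variable (Q)

/-- Sorting lexicographically by index and then by origin respects the tie rule; strictness for
equal indices comes from the absence of duplicates. -/
theorem exists_isRanking (γ : Mult I J) (s : Q.ScaledState h) (t : ℕ) (j : Fin J) :
    ∃ L, Q.IsRanking γ s t j L := by
  classical
  let key : Fin I × Fin h × Fin I → ℝ ×ₗ Fin I := fun x =>
    toLex (Q.index γ x.1 x.2.2 j (s x.1 j x.2.1) t, x.2.2)
  let r : Fin I × Fin h × Fin I → Fin I × Fin h × Fin I → Prop := fun x y => key x ≤ key y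
  have : Std.Total r := ⟨fun x y => le_total (key x) (key y)⟩
  have : IsTrans _ r := ⟨fun x y z h1 h2 => le_trans (α := ℝ ×ₗ Fin I) h1 h2⟩
  let S : Finset (Fin I × Fin h × Fin I) :=
    Finset.univ.filter fun x => 0 < Q.agents s x.2.2 j ∧ x.2.2 ∈ Q.nbr x.1 j
  have hnd : (S.toList.insertionSort r).Nodup :=
    (List.perm_insertionSort r _).nodup_iff.mpr S.nodup_toList
  refine ⟨S.toList.insertionSort r, hnd, ?_, ?_⟩
  · intro i k i'
    rw [(List.perm_insertionSort r _).mem_iff]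
    simp [S]
  · have hs := List.pairwise_insertionSort r S.toList
    refine (hs.and hnd).imp ?_
    rintro ⟨i₁, k₁, r₁⟩ ⟨i₂, k₂, r₂⟩ ⟨h1, h2⟩
    have h3 := Prod.Lex.le_iff.mp h1
    simp only [key, ofLex_toLex] at h3
    refine ⟨by rcases h3 with h3 | h3; exacts [h3.le, h3.1.le], ?_⟩
    rintro rfl rfl h4
    rcases h3 with h3 | h3
    · exact absurd h4 h3.ne
    · refine lt_of_le_of_ne h3.2 ?_
      rintro rfl
      exact h2 rfl

variable {Q}

/-- Each agent in an area moves within the neighbourhood, and no more agents move than there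
are. -/
structure IsValid (s : Q.ScaledState h) (j : Fin J) (ϖ : Origins I h) : Prop where
  nbr : ∀ x r, ϖ x = some r → r ∈ Q.nbr x.1 j
  moved_le : ∀ a, moved ϖ a ≤ Q.agents s a j

theorem IsRanking.isStable {γ : Mult I J} {s : Q.ScaledState h} {t : ℕ} {j : Fin J}
    {L : List (Fin I × Fin h × Fin I)} (hL : Q.IsRanking γ s t j L) :
    IsStable (fun a => Q.agents s a j) (fun x y =>
      Q.index γ x.1 x.2.2 j (s x.1 j x.2.1) t ≤ Q.index γ y.1 y.2.2 j (s y.1 j y.2.1) t ∧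
      (x.1 = y.1 → x.2.1 = y.2.1 →
        Q.index γ x.1 x.2.2 j (s x.1 j x.2.1) t = Q.index γ y.1 y.2.2 j (s y.1 j y.2.1) t →
        x.2.2 < y.2.2)) L (Q.indexOrigins s j L) :=
  isStable_indexOrigins s j _ L hL.2.2

theorem IsRanking.isValid {γ : Mult I J} {s : Q.ScaledState h} {t : ℕ} {j : Fin J}
    {L : List (Fin I × Fin h × Fin I)} (hL : Q.IsRanking γ s t j L) :
    IsValid s j (Q.indexOrigins s j L) :=
  ⟨fun x r hx => ((hL.2.1 _ _ _).mp (hL.isStable.mem x r hx)).2, hL.isStable.moved_le⟩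

/-- No agent could be moved directly to a vacant sub-area. -/
def IsMaximal (s : Q.ScaledState h) (j : Fin J) (ϖ : Origins I h) : Prop :=
  ∀ x r, r ∈ Q.nbr x.1 j → ϖ x = none → moved ϖ r = Q.agents s r j

/-- At a vacant destination the only possible reason for a rejection is an exhausted origin. This
excludes distance zero for an area with waiting agents when the adaption starts. -/
theorem IsRanking.isMaximal {γ : Mult I J} {s : Q.ScaledState h} {t : ℕ} {j : Fin J}
    {L : List (Fin I × Fin h × Fin I)} (hL : Q.IsRanking γ s t j L) :
    IsMaximal s j (Q.indexOrigins s j L) := by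
  intro x r hr hx
  by_cases h0 : Q.agents s r j = 0
  · have := hL.isStable.moved_le r
    simp only [h0] at this ⊢
    omega
  · rcases hL.isStable.stable (x.1, x.2, r) ((hL.2.1 _ _ _).mpr ⟨by omega, hr⟩) with
      h1 | ⟨r', h1, -⟩ | ⟨h1, -⟩
    · simp [hx] at h1
    · simp [hx] at h1
    · exact h1

/-! ### Movement adaption: invariants -/

/-- Every displaced agent is given a place again, so the net effect is one more moving agent from
the area of the waiting one. -/
theorem AdaptPath.moved_eq {j : Fin J} {d : Fin I → ℕ∞} {ϖ ϖ' : Origins I h} {i : Fin I}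
    (hp : Q.AdaptPath j d ϖ i ϖ') (b : Fin I) :
    moved ϖ' b = moved ϖ b + if i = b then 1 else 0 := by
  induction hp with
  | last ϖ i r x y _ hx _ _ hy =>
    have hyx : y ≠ x := by
      rintro rfl
      simp [hx] at hy
    have h1 := moved_update ϖ x (some i) b
    have h2 := moved_update (Function.update ϖ x (some i)) y (some r) b
    rw [Function.update_of_ne hyx, hy] at h2
    rw [hx] at h1
    simp only [Option.some.injEq, reduceCtorEq, if_false] at h1 h2
    omega
  | step ϖ i r x ϖ' _ hx _ _ ih =>
    have h1 := moved_update ϖ x (some i) b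
    rw [hx] at h1
    simp only [Option.some.injEq] at h1
    omega

theorem AdaptPath.nbr {j : Fin J} {d : Fin I → ℕ∞} {ϖ ϖ' : Origins I h} {i : Fin I}
    (hp : Q.AdaptPath j d ϖ i ϖ') (hϖ : ∀ x r, ϖ x = some r → r ∈ Q.nbr x.1 j) :
    ∀ x r, ϖ' x = some r → r ∈ Q.nbr x.1 j := by
  have key : ∀ (ϖ : Origins I h) (x : Fin I × Fin h) (i : Fin I), x.1 ∈ Q.nbr i j →
      (∀ x r, ϖ x = some r → r ∈ Q.nbr x.1 j) →
      ∀ y r, Function.update ϖ x (some i) y = some r → r ∈ Q.nbr y.1 j := by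
    intro ϖ x i hx hϖ y r hy
    by_cases hyx : y = x
    · subst hyx
      simp only [Function.update_self, Option.some.injEq] at hy
      subst hy
      exact Q.nbr_symm _ _ _ hx
    · rw [Function.update_of_ne hyx] at hy
      exact hϖ y r hy
  induction hp with
  | last ϖ i r x y hx _ _ hy _ => exact key _ _ _ hy (key _ _ _ hx.1 hϖ)
  | step ϖ i r x ϖ' hx _ _ _ ih => exact ih (key _ _ _ hx.1 hϖ)

/-- Occupied places only change their origin. Hence the adaption loses no patrol of the index
policy. -/
theorem AdaptPath.occupied {j : Fin J} {d : Fin I → ℕ∞} {ϖ ϖ' : Origins I h} {i : Fin I}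
    (hp : Q.AdaptPath j d ϖ i ϖ') {z : Fin I × Fin h} (hz : ϖ z ≠ none) : ϖ' z ≠ none := by
  have key : ∀ (ϖ : Origins I h) (x : Fin I × Fin h) (i : Fin I), ϖ z ≠ none →
      Function.update ϖ x (some i) z ≠ none := by
    intro ϖ x i hz
    by_cases hzx : z = x
    · subst hzx
      simp
    · rwa [Function.update_of_ne hzx]
  induction hp with
  | last ϖ i r x y _ _ _ _ _ => exact key _ _ _ (key _ _ _ hz)
  | step ϖ i r x ϖ' _ _ _ _ ih => exact ih (key _ _ _ hz)

/-- The relation between the movements before and after the treatment of `n` agents of area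
`i`. -/
structure IsExtension (j : Fin J) (c : Fin I → ℕ) (ϖ ϖ' : Origins I h) : Prop where
  moved_eq : ∀ b, moved ϖ' b = moved ϖ b + c b
  nbr : (∀ x r, ϖ x = some r → r ∈ Q.nbr x.1 j) → ∀ x r, ϖ' x = some r → r ∈ Q.nbr x.1 j
  occupied : ∀ z, ϖ z ≠ none → ϖ' z ≠ none

theorem AdaptArea.isExtension {s : Q.ScaledState h} {j : Fin J} {i : Fin I} {n : ℕ}
    {ϖ ϖ' : Origins I h} (hp : Q.AdaptArea s j i n ϖ ϖ') :
    IsExtension (Q := Q) j (fun b => if i = b then n else 0) ϖ ϖ' := by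
  induction hp with
  | zero ϖ => exact ⟨by simp, fun h => h, fun _ h => h⟩
  | succ n ϖ ϖ₁ ϖ₂ h1 _ ih =>
    refine ⟨fun b => ?_, fun h => ih.nbr (h1.nbr h), fun z hz => ih.occupied z (h1.occupied hz)⟩
    rw [ih.moved_eq, h1.moved_eq]
    split_ifs <;> omega

/-- Treating one area leaves the number of moved agents of the others unchanged. As no area occurs
twice, the numbers of waiting agents can be read off from the initial movements. -/
theorem AdaptAll.isExtension {s : Q.ScaledState h} {j : Fin J} {l : List (Fin I)}
    {ϖ ϖ' : Origins I h} (hp : Q.AdaptAll s j l ϖ ϖ') (hl : l.Nodup) :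
    IsExtension (Q := Q) j (fun b => if b ∈ l then Q.agents s b j - moved ϖ b else 0) ϖ ϖ' := by
  induction hp with
  | nil ϖ => exact ⟨by simp, fun h => h, fun _ h => h⟩
  | cons i l ϖ ϖ₁ ϖ₂ h1 _ ih =>
    rw [List.nodup_cons] at hl
    have ih := ih hl.2
    have h1 := h1.isExtension
    refine ⟨fun b => ?_, fun h => ih.nbr (h1.nbr h),
      fun z hz => ih.occupied z (h1.occupied z hz)⟩
    rw [ih.moved_eq, h1.moved_eq]
    by_cases hib : i = b
    · subst hib
      simp [hl.1]
    · simp [hib, Ne.symm hib]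

/-- All agents move, within the neighbourhoods, and at least the sub-areas of the index policy are
patrolled. -/
theorem IsMAIOrigins.spec {γ : Mult I J} {s : Q.ScaledState h} {t : ℕ} {j : Fin J}
    {ϖ : Origins I h} (hϖ : Q.IsMAIOrigins γ s t j ϖ) :
    (∀ x r, ϖ x = some r → r ∈ Q.nbr x.1 j) ∧ (∀ a, moved ϖ a = Q.agents s a j) ∧
    ∃ L, Q.IsRanking γ s t j L ∧ ∀ z, Q.indexOrigins s j L z ≠ none → ϖ z ≠ none := by
  obtain ⟨L, l, hL, hl, hmem, hA⟩ := hϖ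
  have hE := hA.isExtension hl
  refine ⟨hE.nbr hL.isValid.nbr, fun a => ?_, L, hL, hE.occupied⟩
  have h1 := hL.isValid.moved_le a
  have h2 := hmem a
  rw [hE.moved_eq]
  split_ifs with hal
  · omega
  · rw [h2] at hal
    push Not at hal
    by_cases h0 : 0 < Q.agents s a j
    · simpa using hal h0
    · omega

end PatrolProblem

namespace PatrolProblem

variable {I J T : ℕ} {Q : PatrolProblem I J T} {h : ℕ}

/-! ### Movement adaption: the distances -/

theorem agents_le (s : Q.ScaledState h) (i : Fin I) (j : Fin J) : Q.agents s i j ≤ h := by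
  unfold agents
  exact (Finset.card_filter_le _ _).trans (by simp)

theorem dist_le_of_reaches {s : Q.ScaledState h} {j : Fin J} {ϖ : Origins I h} {i : Fin I} {n : ℕ}
    (hn : Q.Reaches s j ϖ n i) : Q.dist s j ϖ i ≤ n :=
  iInf₂_le n hn

theorem reaches_of_dist_eq {s : Q.ScaledState h} {j : Fin J} {ϖ : Origins I h} {i : Fin I} {n : ℕ}
    (hn : Q.dist s j ϖ i = n) : Q.Reaches s j ϖ n i := by
  by_contra hcon
  have : ((n + 1 : ℕ) : ℕ∞) ≤ Q.dist s j ϖ i := by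
    refine le_iInf₂ fun m hm => ?_
    have h1 : n ≤ m := by exact_mod_cast hn.symm.le.trans (dist_le_of_reaches hm)
    have h2 : n ≠ m := fun e => hcon (e ▸ hm)
    exact_mod_cast (by omega : n + 1 ≤ m)
  rw [hn] at this
  exact absurd (by exact_mod_cast this : n + 1 ≤ n) (by omega)

theorem Reaches.agents_pos {s : Q.ScaledState h} {j : Fin J} {ϖ : Origins I h} {i : Fin I} {n : ℕ}
    (hn : Q.Reaches s j ϖ n i) : 0 < Q.agents s i j := by
  cases n with
  | zero => exact hn.1
  | succ n => exact hn.1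

theorem exists_dist_eq {s : Q.ScaledState h} {j : Fin J} {ϖ : Origins I h} {i : Fin I} {n : ℕ}
    (hn : Q.dist s j ϖ i ≤ n) : ∃ m : ℕ, m ≤ n ∧ Q.dist s j ϖ i = m := by
  obtain ⟨m, hm⟩ := ENat.ne_top_iff_exists.mp (ne_top_of_le_ne_top (ENat.natCast_ne_top n) hn)
  rw [← hm] at hn
  exact ⟨m, by exact_mod_cast hn, hm.symm⟩

theorem exists_of_dist_eq_succ {s : Q.ScaledState h} {j : Fin J} {ϖ : Origins I h} {i : Fin I}
    {n : ℕ} (hn : Q.dist s j ϖ i = (n + 1 : ℕ)) :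
    ∃ x r, x.1 ∈ Q.nbr i j ∧ ϖ x = some r ∧ Q.dist s j ϖ r ≤ n := by
  obtain ⟨-, x, r, hx, hxr, -, hr⟩ := reaches_of_dist_eq hn
  exact ⟨x, r, hx, hxr, dist_le_of_reaches hr⟩

/-- A closer origin would give a shorter path from `i`. The origin `i` itself, which `Reaches`
excludes, does no harm: its distance is `n + 1`. -/
theorem le_dist_of_dist_eq_succ {s : Q.ScaledState h} {j : Fin J} {ϖ : Origins I h} {i r : Fin I}
    {n : ℕ} (hn : Q.dist s j ϖ i = (n + 1 : ℕ)) {x : Fin I × Fin h} (hx : x.1 ∈ Q.nbr i j)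
    (hr : ϖ x = some r) : (n : ℕ∞) ≤ Q.dist s j ϖ r := by
  by_contra hcon
  rw [not_le] at hcon
  obtain ⟨m, -, hm⟩ := exists_dist_eq hcon.le
  rw [hm] at hcon
  have hmn : m < n := by exact_mod_cast hcon
  by_cases hri : r = i
  · subst hri
    rw [hm] at hn
    have : m = n + 1 := by exact_mod_cast hn
    omega
  · have h1 := dist_le_of_reaches
      (show Q.Reaches s j ϖ (m + 1) i from ⟨(reaches_of_dist_eq hn).agents_pos, x, r, hx, hr, hri,
        reaches_of_dist_eq hm⟩)
    rw [hn] at h1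
    have : n + 1 ≤ m + 1 := by exact_mod_cast h1
    omega

theorem exists_isBest (j : Fin J) (d : Fin I → ℕ∞) (ϖ : Origins I h) {i : Fin I}
    {x₀ : Fin I × Fin h} (hx₀ : x₀.1 ∈ Q.nbr i j) : ∃ x, Q.IsBest j d ϖ i x := by
  classical
  obtain ⟨x, hx, hmin⟩ := Finset.exists_min_image
    (Finset.univ.filter fun x : Fin I × Fin h => x.1 ∈ Q.nbr i j)
    (fun x => (toLex (originDist d (ϖ x), x.1) : ℕ∞ ×ₗ Fin I)) ⟨x₀, by simpa using hx₀⟩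
  refine ⟨x, by simpa using hx, fun y hy => ?_⟩
  have h1 := Prod.Lex.le_iff.mp (hmin y (by simpa using hy))
  simp only [ofLex_toLex] at h1
  rcases h1 with h1 | h1
  · exact ⟨h1.le, fun e => absurd e h1.ne⟩
  · exact ⟨h1.1.le, fun _ => h1.2⟩

/-- The replacements of the inner loop, with the distances of the initial movements `ϖ₀`,
terminate: the distance decreases by one in each step. -/
theorem exists_adaptPath_of_dist (s : Q.ScaledState h) (j : Fin J) (ϖ₀ : Origins I h) (n : ℕ) :
    ∀ (ϖ : Origins I h) (i : Fin I), Q.dist s j ϖ₀ i = (n + 1 : ℕ) →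
      -- Places changed so far had, and have, origins of distance at least `n + 1`. They cannot be
      -- the best place for an agent at distance `n + 1`, so the outdated distances still guide the
      -- remaining steps.
      (∀ x, ϖ x = ϖ₀ x ∨ ∃ r₀ r, ϖ₀ x = some r₀ ∧ ϖ x = some r ∧
        ((n + 1 : ℕ) : ℕ∞) ≤ Q.dist s j ϖ₀ r₀ ∧ ((n + 1 : ℕ) : ℕ∞) ≤ Q.dist s j ϖ₀ r) →
      ∃ ϖ', Q.AdaptPath j (Q.dist s j ϖ₀) ϖ i ϖ' := by
  induction n with
  | zero =>
    intro ϖ i hi hϖ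
    obtain ⟨x', r', hx', hxr', hr'⟩ := exists_of_dist_eq_succ hi
    obtain ⟨x, hx⟩ := exists_isBest j (Q.dist s j ϖ₀) ϖ hx'
    obtain ⟨r, hxr, -, hr⟩ := best_origin hi hϖ hx
    have hv := reaches_of_dist_eq hr
    obtain ⟨-, y, hy, hyv⟩ := hv
    refine ⟨_, AdaptPath.last ϖ i r x y hx hxr (by simpa using hr) hy ?_⟩
    -- The place `y` was vacant in `ϖ₀`; changed places were occupied there, so `y` is still vacant.
    rcases hϖ y with h1 | ⟨r₀, _, h1, _⟩
    · rw [h1, hyv]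
    · simp [hyv] at h1
  | succ n ih =>
    intro ϖ i hi hϖ
    obtain ⟨x', r', hx', hxr', hr'⟩ := exists_of_dist_eq_succ hi
    obtain ⟨x, hx⟩ := exists_isBest j (Q.dist s j ϖ₀) ϖ hx'
    obtain ⟨r, hxr, hxr₀, hr⟩ := best_origin hi hϖ hx
    obtain ⟨ϖ', hϖ'⟩ := ih (Function.update ϖ x (some i)) r hr fun z => by
      by_cases hzx : z = x
      -- The place just changed loses an origin of distance `n + 1` and gains one of distance `n +
      -- 2`, which preserves the invariant at the next level.
      · subst hzx
        refine Or.inr ⟨r, i, hxr₀, by simp, hr.ge, ?_⟩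
        rw [hi]
        exact_mod_cast Nat.le_succ _
      · rw [Function.update_of_ne hzx]
        rcases hϖ z with h1 | ⟨r₀, r, h1, h2, h3, h4⟩
        · exact Or.inl h1
        · have : ((n + 1 : ℕ) : ℕ∞) ≤ ((n + 1 + 1 : ℕ) : ℕ∞) := by exact_mod_cast Nat.le_succ _
          exact Or.inr ⟨r₀, r, h1, h2, this.trans h3, this.trans h4⟩
    refine ⟨ϖ', AdaptPath.step ϖ i r x ϖ' hx hxr ?_ hϖ'⟩
    rw [hr]
    exact_mod_cast Nat.succ_ne_zero n
where
  -- The shortest path of `ϖ₀` offers a place whose origin has distance at most `n`; it must be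
  -- unchanged, and so must the minimiser. No origin available in `ϖ₀` is closer than `n`.
  best_origin {n : ℕ} {ϖ : Origins I h} {i : Fin I} (hi : Q.dist s j ϖ₀ i = (n + 1 : ℕ))
      (hϖ : ∀ x, ϖ x = ϖ₀ x ∨ ∃ r₀ r, ϖ₀ x = some r₀ ∧ ϖ x = some r ∧
        ((n + 1 : ℕ) : ℕ∞) ≤ Q.dist s j ϖ₀ r₀ ∧ ((n + 1 : ℕ) : ℕ∞) ≤ Q.dist s j ϖ₀ r)
      {x : Fin I × Fin h} (hx : Q.IsBest j (Q.dist s j ϖ₀) ϖ i x) :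
      ∃ r, ϖ x = some r ∧ ϖ₀ x = some r ∧ Q.dist s j ϖ₀ r = n := by
    have hlt : ¬ ((n + 1 : ℕ) : ℕ∞) ≤ (n : ℕ∞) := by
      intro h1
      have : n + 1 ≤ n := by exact_mod_cast h1
      omega
    obtain ⟨x', r', hx', hxr', hr'⟩ := exists_of_dist_eq_succ hi
    have h1 := (hx.2 x' hx').1
    have h2 : ϖ x' = some r' := by
      rcases hϖ x' with h1 | ⟨r₀, r, h1, -, h3, -⟩
      · rw [h1, hxr']
      · rw [hxr', Option.some.injEq] at h1
        subst h1
        exact absurd (h3.trans hr') hlt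
    rw [h2] at h1
    replace h1 : originDist (Q.dist s j ϖ₀) (ϖ x) ≤ n := h1.trans hr'
    cases hxo : ϖ x with
    | none =>
      rw [hxo] at h1
      exact absurd h1 (by simp [originDist])
    | some r =>
      rw [hxo] at h1
      rcases hϖ x with h3 | ⟨r₀, r₁, -, h3, -, h4⟩
      · rw [hxo] at h3
        exact ⟨r, rfl, h3.symm, le_antisymm h1 (le_dist_of_dist_eq_succ hi hx.1 h3.symm)⟩
      · rw [hxo, Option.some.injEq] at h3
        subst h3
        exact absurd (h4.trans h1) hlt

theorem moved_pos {ϖ : Origins I h} {x : Fin I × Fin h} {r : Fin I} (hx : ϖ x = some r) :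
    0 < moved ϖ r :=
  Finset.card_pos.mpr ⟨x, by simpa using hx⟩

/-- A vacant sub-area can be reached from every area with an unassigned agent: otherwise, the
areas that can be reached would contain more agents than sub-areas. -/
theorem IsValid.exists_reaches {s : Q.ScaledState h} {j : Fin J} {ϖ : Origins I h}
    (hϖ : IsValid s j ϖ) {i : Fin I} (hi : moved ϖ i < Q.agents s i j) :
    ∃ n, Q.Reaches s j ϖ n i := by
  classical
  by_contra hcon
  -- An arrow leads from `a` to the origins of agents placed near `a`. If a vacancy is out of reach
  -- of `i`, it is out of reach of every descendant of `i`.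
  let step : Fin I → Fin I → Prop := fun a b => ∃ x, x.1 ∈ Q.nbr a j ∧ ϖ x = some b
  have hpos : ∀ b, Relation.ReflTransGen step i b → 0 < Q.agents s b j := by
    intro b hb
    induction hb with
    | refl => omega
    | tail _ h2 _ =>
      obtain ⟨x, -, hx⟩ := h2
      exact (moved_pos hx).trans_le (hϖ.moved_le _)
  have hocc : ∀ b, Relation.ReflTransGen step i b → ∀ n, ¬ Q.Reaches s j ϖ n b := by
    intro b hb
    induction hb with
    | refl => exact fun n hn => hcon ⟨n, hn⟩
    | @tail a c h1 h2 ih =>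
      intro n hn
      obtain ⟨x, hx, hxc⟩ := h2
      by_cases hca : c = a
      · subst hca
        exact ih n hn
      · exact ih (n + 1) ⟨hpos a h1, x, c, hx, hxc, hca, hn⟩
  let R : Finset (Fin I) := Finset.univ.filter fun b => Relation.ReflTransGen step i b
  have hR : ∀ b, b ∈ R ↔ Relation.ReflTransGen step i b := fun b => by simp [R]
  have hiR : i ∈ R := (hR i).mpr Relation.ReflTransGen.refl
  -- Each area is its own neighbour: every sub-area of an area of `R` is therefore occupied, by an
  -- agent whose origin is again in `R`.
  have h1 : (R ×ˢ (Finset.univ : Finset (Fin h))).card ≤ ∑ r ∈ R, moved ϖ r := by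
    unfold moved
    refine le_trans (Finset.card_le_card ?_) Finset.card_biUnion_le
    intro x hx
    rw [Finset.mem_product, hR] at hx
    rw [Finset.mem_biUnion]
    cases hxo : ϖ x with
    | none => exact absurd ⟨hpos _ hx.1, x, Q.self_mem_nbr _ _, hxo⟩ (hocc _ hx.1 0)
    | some r =>
      exact ⟨r, (hR r).mpr (hx.1.tail ⟨x, Q.self_mem_nbr _ _, hxo⟩), by simpa using hxo⟩
  -- An area holds at most `h` agents, and the agent still waiting in `i` makes the inequality
  -- strict.
  have h2 : ∑ r ∈ R, moved ϖ r < ∑ r ∈ R, h :=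
    Finset.sum_lt_sum (fun r _ => (hϖ.moved_le r).trans (agents_le s r j))
      ⟨i, hiR, hi.trans_le (agents_le s i j)⟩
  rw [Finset.card_product, Finset.card_univ, Fintype.card_fin] at h1
  simp only [Finset.sum_const, smul_eq_mul] at h2
  omega

theorem IsMaximal.exists_adaptPath {s : Q.ScaledState h} {j : Fin J} {ϖ : Origins I h}
    (hm : IsMaximal s j ϖ) (hϖ : IsValid s j ϖ) {i : Fin I} (hi : moved ϖ i < Q.agents s i j) :
    ∃ ϖ', Q.AdaptPath j (Q.dist s j ϖ) ϖ i ϖ' := by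
  obtain ⟨n, hn⟩ := hϖ.exists_reaches hi
  obtain ⟨m, -, hm'⟩ := exists_dist_eq (dist_le_of_reaches hn)
  cases m with
  | zero =>
    obtain ⟨-, x, hx, hxv⟩ := reaches_of_dist_eq hm'
    exact absurd (hm x i (Q.nbr_symm _ _ _ hx) hxv) hi.ne
  | succ m => exact exists_adaptPath_of_dist s j ϖ m ϖ i hm' fun x => Or.inl rfl

/-! ### Existence of a complete run of the adaption. -/

theorem IsExtension.isValid {s : Q.ScaledState h} {j : Fin J} {c : Fin I → ℕ} {ϖ ϖ' : Origins I h}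
    (hE : IsExtension (Q := Q) j c ϖ ϖ') (hϖ : IsValid s j ϖ)
    (hc : ∀ b, moved ϖ b + c b ≤ Q.agents s b j) : IsValid s j ϖ' :=
  ⟨hE.nbr hϖ.nbr, fun b => (hE.moved_eq b).trans_le (hc b)⟩

/-- A place vacant afterwards was vacant before, so the areas around it had no waiting agents, and
`hc` leaves no room for further movements from them. -/
theorem IsExtension.isMaximal {s : Q.ScaledState h} {j : Fin J} {c : Fin I → ℕ}
    {ϖ ϖ' : Origins I h} (hE : IsExtension (Q := Q) j c ϖ ϖ') (hϖ : IsMaximal s j ϖ)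
    (hc : ∀ b, moved ϖ b + c b ≤ Q.agents s b j) : IsMaximal s j ϖ' := by
  intro x r hr hx
  have h1 := hϖ x r hr (by by_contra h0; exact hE.occupied x h0 hx)
  have h2 := hc r
  rw [hE.moved_eq]
  omega

theorem AdaptPath.isExtension {j : Fin J} {d : Fin I → ℕ∞} {ϖ ϖ' : Origins I h} {i : Fin I}
    (hp : Q.AdaptPath j d ϖ i ϖ') :
    IsExtension (Q := Q) j (fun b => if i = b then 1 else 0) ϖ ϖ' :=
  ⟨hp.moved_eq, hp.nbr, fun _ => hp.occupied⟩

theorem exists_adaptArea (s : Q.ScaledState h) (j : Fin J) (i : Fin I) (n : ℕ) :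
    ∀ ϖ : Origins I h, IsValid s j ϖ → IsMaximal s j ϖ → moved ϖ i + n ≤ Q.agents s i j →
      ∃ ϖ', Q.AdaptArea s j i n ϖ ϖ' := by
  induction n with
  | zero => exact fun ϖ _ _ _ => ⟨ϖ, .zero ϖ⟩
  | succ n ih =>
    intro ϖ hv hm hn
    obtain ⟨ϖ₁, h1⟩ := hm.exists_adaptPath hv (i := i) (by omega)
    have hE := h1.isExtension
    have hc : ∀ b, moved ϖ b + (if i = b then 1 else 0) ≤ Q.agents s b j := by
      intro b
      have := hv.moved_le b
      split_ifs with hib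
      · subst hib
        omega
      · omega
    obtain ⟨ϖ₂, h2⟩ := ih ϖ₁ (hE.isValid hv hc) (hE.isMaximal hm hc) (by
      rw [hE.moved_eq]
      simp only [if_true]
      omega)
    exact ⟨ϖ₂, .succ n ϖ ϖ₁ ϖ₂ h1 h2⟩

theorem exists_adaptAll (s : Q.ScaledState h) (j : Fin J) (l : List (Fin I)) :
    ∀ ϖ : Origins I h, IsValid s j ϖ → IsMaximal s j ϖ → ∃ ϖ', Q.AdaptAll s j l ϖ ϖ' := by
  induction l with
  | nil => exact fun ϖ _ _ => ⟨ϖ, .nil ϖ⟩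
  | cons i l ih =>
    intro ϖ hv hm
    obtain ⟨ϖ₁, h1⟩ := exists_adaptArea s j i (Q.agents s i j - moved ϖ i) ϖ hv hm (by
      have := hv.moved_le i
      omega)
    have hE := h1.isExtension
    have hc : ∀ b, moved ϖ b + (if i = b then Q.agents s i j - moved ϖ i else 0) ≤
        Q.agents s b j := by
      intro b
      have := hv.moved_le b
      split_ifs with hib
      · subst hib
        omega
      · omega
    obtain ⟨ϖ₂, h2⟩ := ih ϖ₁ (hE.isValid hv hc) (hE.isMaximal hm hc)
    exact ⟨ϖ₂, .cons i l ϖ ϖ₁ ϖ₂ h1 h2⟩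

theorem exists_isMAIOrigins (γ : Mult I J) (s : Q.ScaledState h) (t : ℕ) (j : Fin J) :
    ∃ ϖ, Q.IsMAIOrigins γ s t j ϖ := by
  classical
  obtain ⟨L, hL⟩ := Q.exists_isRanking γ s t j
  let S : Finset (Fin I) := Finset.univ.filter fun i =>
    0 < Q.agents s i j ∧ moved (Q.indexOrigins s j L) i ≠ Q.agents s i j
  obtain ⟨ϖ, hϖ⟩ := exists_adaptAll s j S.toList _ hL.isValid hL.isMaximal
  exact ⟨ϖ, L, S.toList, hL, S.nodup_toList, by simp [S], hϖ⟩

theorem exists_isMAI (Q : PatrolProblem I J T) (γ : Mult I J) (h : ℕ) :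
    ∃ φ : Q.Policy h, Q.IsMAI γ φ := by
  choose ϖ hϖ using fun (s : Q.ScaledState h) (t : ℕ) (j : Fin J) => exists_isMAIOrigins γ s t j
  exact ⟨fun s t i i' j k => if ϖ s t j (i, k) = some i' then 1 else 0,
    fun s t _ j => ⟨ϖ s t j, hϖ s t j, fun _ _ _ => rfl⟩⟩

/-! ### Applicability -/

theorem moved_eq_sum (ϖ : Origins I h) (r : Fin I) :
    (moved ϖ r : ℝ) = ∑ i, ∑ k, if ϖ (i, k) = some r then (1 : ℝ) else 0 := by
  simp only [moved, Finset.card_filter]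
  push_cast
  exact Fintype.sum_prod_type _

theorem agents_eq_sum (s : Q.ScaledState h) (i : Fin I) (j : Fin J) :
    (Q.agents s i j : ℝ) = ∑ k, Q.ind (s i j k) := by
  simp only [agents, Finset.card_filter, ind]
  push_cast
  rfl

theorem sum_origin (o : Option (Fin I)) (S : Finset (Fin I)) (ho : ∀ r, o = some r → r ∈ S) :
    ∑ i' ∈ S, (if o = some i' then (1 : ℝ) else 0) = if o ≠ none then 1 else 0 := by
  cases o with
  | none => simp
  | some r => simp [ho r rfl]

theorem IsMAI.isApplicable {γ : Mult I J} {φ : Q.Policy h} (hφ : Q.IsMAI γ φ) :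
    Q.IsApplicable φ := by
  intro s t ht
  refine ⟨fun i i' j k => ?_, fun i i' j k hi' => ?_, fun i j k => ?_, fun i j => ?_⟩
  all_goals
    obtain ⟨ϖ, hϖ, hφϖ⟩ := hφ s t ht j
    obtain ⟨hnbr, hmoved, -⟩ := hϖ.spec
    simp only [hφϖ]
  · split_ifs <;> simp
  · rw [if_neg]
    exact fun e => hi' (hnbr _ _ e)
  · rw [sum_origin _ _ (hnbr (i, k))]
    split_ifs <;> norm_num
  -- Conservation is the fact that every agent moves; destinations outside the neighbourhood
  -- contribute nothing.
  · rw [← agents_eq_sum, ← hmoved, moved_eq_sum]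
    congr 1
    refine Finset.sum_subset (Finset.subset_univ _) fun i' _ hi' =>
      Finset.sum_eq_zero fun k _ => if_neg fun e => hi' (Q.nbr_symm _ _ _ (hnbr _ _ e))

theorem IsApplicable.isRelaxedApplicable {φ : Q.Policy h} (hφ : Q.IsApplicable φ) :
    Q.IsRelaxedApplicable φ := by
  refine ⟨fun s t ht i j k => ⟨fun i' => ?_, (hφ s t ht).2.2.1 i j k,
    fun i' hi' => (hφ s t ht).2.1 i i' j k hi'⟩, fun t ht i j => ?_⟩
  · rcases (hφ s t ht).1 i i' j k with h1 | h1 <;> simp [h1]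
  · simp_rw [← Q.expect_sum, ← Q.expect_const_mul]
    exact Finset.sum_congr rfl fun s _ => congrArg _ ((hφ s t ht).2.2.2 i j)

end PatrolProblem

/-! ### Perturbation of greedy assignments -/

section Greedy

open Classical in
/-- Solution of a recursive system of inequalities. -/
theorem le_pow_mul_of_le_add_sum {P κ : Type*} [Fintype P] [LinearOrder κ] (key : P → κ)
    (S : P → Prop) (f : P → ℝ) {E : ℝ} (hE : 0 ≤ E)
    (hf : ∀ p, S p → f p ≤ E + ∑ q, if S q ∧ key q < key p then f q else 0) (p : P)
    (hp : S p) :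
    f p ≤ ((Fintype.card P : ℝ) + 1) ^ (Fintype.card P + 1) * E := by
  set c : ℝ := (Fintype.card P : ℝ) with hc
  have hc0 : 0 ≤ c := by positivity
  -- Induction on the number of elements with a smaller key. Each level multiplies the bound by at
  -- most `c + 1`.
  have main : ∀ k : ℕ, ∀ p, S p → (Finset.univ.filter fun q => key q < key p).card < k →
      f p ≤ (c + 1) ^ k * E := by
    intro k
    induction k with
    | zero => exact fun p _ h => absurd h (Nat.not_lt_zero _)
    | succ k ih =>
      intro p hp hk
      have hpow : (1 : ℝ) ≤ (c + 1) ^ k := one_le_pow₀ (by linarith)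
      have h1 : ∑ q, (if S q ∧ key q < key p then f q else 0) ≤ ∑ _q : P, (c + 1) ^ k * E := by
        refine Finset.sum_le_sum fun q _ => ?_
        split_ifs with hq
        · refine ih q hq.1 (lt_of_lt_of_le (Finset.card_lt_card ?_) (Nat.le_of_lt_succ hk))
          rw [Finset.ssubset_iff_of_subset]
          · exact ⟨q, by simpa using hq.2, by simp⟩
          · intro r hr
            simp only [Finset.mem_filter, Finset.mem_univ, true_and] at hr ⊢
            exact hr.trans hq.2
        · positivity
      rw [Finset.sum_const, Finset.card_univ, nsmul_eq_mul, ← hc] at h1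
      have h2 := mul_le_mul_of_nonneg_right hpow hE
      calc f p ≤ E + c * ((c + 1) ^ k * E) := (hf p hp).trans (by linarith)
        _ ≤ (c + 1) ^ (k + 1) * E := by rw [pow_succ]; linarith
  refine main _ p hp (Nat.lt_succ_of_le ?_)
  exact (Finset.card_filter_le _ _).trans (by simp)

/-- The constant in `greedy_lower_bound`. -/
def greedyConst (P A : Type*) [Fintype P] [Fintype A] : ℝ :=
  ((Fintype.card A : ℝ) + 1) * ((Fintype.card P : ℝ) + 1) *
    (1 + ((Fintype.card P : ℝ) + 1) ^ (Fintype.card P + 1) * ((Fintype.card P : ℝ) + 2))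

/-- Stability of greedy assignments.  Sources `m : A` with capacities `cap m` are assigned to
classes `p : P` of targets, in the ascending order of `ϑ p - γ m`; `n p m` is the number of targets
in the class `p`, of `N p` ones, that are assigned to `m`.  If `N` and `cap` are close to the
values belonging to an assignment `y` of threshold form, then `n` is close to `y`. -/
theorem greedy_lower_bound {P A : Type*} [Fintype P] [Fintype A] [LinearOrder A]
    (B : P → A → Prop) (ϑ : P → ℝ) (γ : A → ℝ) (top : P → A)
    -- The source `top p` is the one tried first for the class `p`: it has the largest `γ`, and the
    -- smallest label among ties.
    (htop_le : ∀ p m, B p m → γ m ≤ γ (top p))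
    (htop_min : ∀ p m, B p m → γ m = γ (top p) → top p ≤ m)
    (hstrict : ∀ p q m, B p m → B q m → ϑ p = ϑ q → p = q)
    (N z : P → ℝ) (cap : A → ℝ) (n y : P → A → ℝ) {E : ℝ} (hE : 0 ≤ E)
    (hN : ∀ p, |N p - z p| ≤ E) (hcap : ∀ m, ∑ p, y p m - E ≤ cap m)
    (hn0 : ∀ p m, 0 ≤ n p m) (hnB : ∀ p m, n p m ≠ 0 → B p m) (hnN : ∀ p, ∑ m, n p m ≤ N p)
    (hy0 : ∀ p m, 0 ≤ y p m) (hyz : ∀ p, ∑ m, y p m ≤ z p)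
    (hy1 : ∀ p, ϑ p < γ (top p) → y p (top p) = z p)
    (hy2 : ∀ p m, y p m ≠ 0 → B p m ∧ γ m = γ (top p) ∧ ϑ p ≤ γ m)
    (hs1 : ∀ p, ϑ p < γ (top p) → n p (top p) = N p ∨
      (∑ q, n q (top p) = cap (top p) ∧ ∀ q, n q (top p) ≠ 0 → ϑ q ≤ ϑ p))
    (hs2 : ∀ p, ∑ m, n p m = N p ∨ ∀ m, B p m →
      (∑ q, n q m = cap m ∧ ∀ q, n q m ≠ 0 → ϑ q ≤ ϑ p)) (p : P) :
    ∑ m, y p m - greedyConst P A * E ≤ ∑ m, n p m := by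
  classical
  set c : ℝ := (Fintype.card P : ℝ) with hc
  have hc0 : 0 ≤ c := by positivity
  have hN' : ∀ p, N p ≤ z p + E ∧ z p - E ≤ N p := fun p => by
    have := abs_le.mp (hN p)
    constructor <;> linarith
  have hnN1 : ∀ p m, n p m ≤ N p := fun p m =>
    (Finset.single_le_sum (fun m _ => hn0 p m) (Finset.mem_univ m)).trans (hnN p)
  -- Whatever a class takes from a source other than its first one is covered by its deficit at the
  -- first one.
  have hother : ∀ q m, top q ≠ m → n q m ≤ N q - n q (top q) := by
    intro q m hqm
    have h1 : ∑ m' ∈ {top q, m}, n q m' ≤ N q :=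
      (Finset.sum_le_sum_of_subset_of_nonneg (Finset.subset_univ _)
        fun m _ _ => hn0 q m).trans (hnN q)
    rw [Finset.sum_pair hqm] at h1
    linarith
  -- the deficit of the classes that should be filled from their first source
  have hbad : ∀ p, ϑ p < γ (top p) → N p - n p (top p) ≤ (c + 1) ^ (Fintype.card P + 1) *
      ((c + 2) * E) := by
    refine le_pow_mul_of_le_add_sum (κ := ℝ ×ₗ A) (fun p => toLex (ϑ p - γ (top p), top p))
      (fun p => ϑ p < γ (top p)) (fun p => N p - n p (top p)) (by positivity) fun p hp => ?_
    have hnonneg : ∀ q, 0 ≤ if ϑ q < γ (top q) ∧ (toLex (ϑ q - γ (top q), top q) : ℝ ×ₗ A) <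
        toLex (ϑ p - γ (top p), top p) then N q - n q (top q) else 0 := by
      intro q
      split_ifs
      · linarith [hnN1 q (top q)]
      · exact le_rfl
    rcases hs1 p hp with h1 | ⟨h1, h2⟩
    · rw [h1, sub_self]
      have := Finset.sum_nonneg fun q (_ : q ∈ Finset.univ) => hnonneg q
      positivity
    set m := top p with hm
    have hkey : ∀ q, (if top q = m ∧ ϑ q ≤ ϑ p then N q - n q m else 0) + n q m ≤
        y q m + E + if ϑ q < γ (top q) ∧ (toLex (ϑ q - γ (top q), top q) : ℝ ×ₗ A) <
          toLex (ϑ p - γ m, m) then N q - n q (top q) else 0 := by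
      intro q
      have h3 := hnonneg q
      by_cases hq : top q = m ∧ ϑ q ≤ ϑ p
      · rw [if_pos hq]
        have h4 := hy1 q (by rw [hq.1]; linarith [hq.2])
        rw [hq.1] at h4
        linarith [(hN' q).1]
      rw [if_neg hq, zero_add]
      by_cases hz : n q m = 0
      · rw [hz]
        linarith [hy0 q m]
      have hqp := h2 q hz
      have hne : top q ≠ m := fun e => hq ⟨e, hqp⟩
      have hB := hnB q m hz
      have hle := htop_le q m hB
      rw [if_pos]
      · linarith [hother q m hne, hy0 q m]
      · refine ⟨by linarith, Prod.Lex.lt_iff.mpr ?_⟩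
        simp only [ofLex_toLex]
        -- If the first components of the keys agree, the labels decide: `m` ties with `top q` in
        -- `γ`, so minimality gives `top q < m`.
        rcases hle.lt_or_eq with h5 | h5
        · exact Or.inl (by linarith)
        · rcases hqp.lt_or_eq with h6 | h6
          · exact Or.inl (by linarith)
          · exact Or.inr ⟨by rw [h5, h6], lt_of_le_of_ne (htop_min q m hB h5) hne⟩
    have hsum := Finset.sum_le_sum fun q (_ : q ∈ Finset.univ) => hkey q
    rw [Finset.sum_add_distrib, Finset.sum_add_distrib, Finset.sum_add_distrib, h1,
      Finset.sum_const, Finset.card_univ, nsmul_eq_mul, ← hc] at hsum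
    have hfirst : N p - n p m ≤ ∑ q, if top q = m ∧ ϑ q ≤ ϑ p then N q - n q m else 0 := by
      have := Finset.single_le_sum (f := fun q => if top q = m ∧ ϑ q ≤ ϑ p then N q - n q m else 0)
        (fun q _ => by
          split_ifs
          exacts [by linarith [hnN1 q m], le_rfl]) (Finset.mem_univ p)
      rwa [if_pos ⟨rfl, le_rfl⟩] at this
    linarith [hcap m]
  set β := (c + 1) ^ (Fintype.card P + 1) * ((c + 2) * E) with hβ
  have hβ0 : 0 ≤ β := by positivity
  set D := 1 + (c + 1) ^ (Fintype.card P + 1) * (c + 2) with hD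
  have hD1 : 1 ≤ D := by
    have : 0 ≤ (c + 1) ^ (Fintype.card P + 1) * (c + 2) := by positivity
    linarith
  have hβD : E + β = D * E := by rw [hβ, hD]; ring
  set a : ℝ := (Fintype.card A : ℝ) with ha
  have ha0 : 0 ≤ a := by positivity
  have hconst : greedyConst P A = (a + 1) * (c + 1) * D := rfl
  have hDE : 0 ≤ D * E := by positivity
  have hcase : a * (c * (D * E) + E) ≤ greedyConst P A * E ∧ E + β ≤ greedyConst P A * E := by
    have h1 : E ≤ D * E := le_mul_of_one_le_left hE hD1
    have h2 : a * E ≤ a * (D * E) := mul_le_mul_of_nonneg_left h1 ha0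
    have h3 : 0 ≤ a * c * (D * E) := by positivity
    have h4 : 0 ≤ c * (D * E) := by positivity
    have h5 : 0 ≤ a * (D * E) := by positivity
    have h6 : greedyConst P A * E =
        a * c * (D * E) + a * (D * E) + c * (D * E) + D * E := by rw [hconst]; ring
    rw [h6, hβD]
    constructor <;> linarith
  rcases lt_trichotomy (ϑ p) (γ (top p)) with hp | hp | hp
  · have h1 := Finset.single_le_sum (fun m _ => hn0 p m) (Finset.mem_univ (top p))
    linarith [hbad p hp, (hN' p).2, hyz p, hcase.2]
  · rcases hs2 p with h1 | h1
    · linarith [(hN' p).2, hyz p, hcase.2]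
    have hm : ∀ m, y p m ≤ n p m + (c * (D * E) + E) := by
      intro m
      by_cases hym : y p m = 0
      · rw [hym]
        have := hn0 p m
        positivity
      obtain ⟨hB, hγ, -⟩ := hy2 p m hym
      obtain ⟨h2, h3⟩ := h1 m hB
      -- The extra summand exchanges `n p m` for `y p m`, so that summation over `q` isolates the
      -- shortfall of `p` at `m`.
      have h4 : ∀ q, n q m + (if q = p then y q m - n q m else 0) ≤ y q m + (E + β) := by
        intro q
        by_cases hqp : q = p
        · subst hqp
          rw [if_pos rfl]
          linarith
        rw [if_neg hqp, add_zero]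
        by_cases hz : n q m = 0
        · rw [hz]
          linarith [hy0 q m]
        have hBq := hnB q m hz
        -- Strict indexability enters here: no other class at the source `m` sits exactly on the
        -- threshold, so each competitor `q` lies strictly below its own threshold and is controlled
        -- by `hbad`.
        have hlt : ϑ q < ϑ p :=
          lt_of_le_of_ne (h3 q hz) fun e => hqp (hstrict q p m hBq hB e)
        have hneg : ϑ q < γ (top q) := by linarith [htop_le q m hBq]
        by_cases hqm : top q = m
        · have h5 := hy1 q hneg
          rw [hqm] at h5
          linarith [hnN1 q m, (hN' q).1]
        · linarith [hother q m hqm, hbad q hneg, hy0 q m]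
      have h5 := Finset.sum_le_sum fun q (_ : q ∈ Finset.univ) => h4 q
      rw [Finset.sum_add_distrib, Finset.sum_add_distrib, Finset.sum_ite_eq' Finset.univ p,
        if_pos (Finset.mem_univ p), Finset.sum_const, Finset.card_univ, nsmul_eq_mul, ← hc, h2,
        hβD] at h5
      linarith [hcap m]
    have h2 := Finset.sum_le_sum fun m (_ : m ∈ Finset.univ) => hm m
    rw [Finset.sum_add_distrib, Finset.sum_const, Finset.card_univ, nsmul_eq_mul, ← ha] at h2
    linarith [hcase.1]
  -- Above the threshold the target assignment is empty.
  · have h1 : ∑ m, y p m = 0 := by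
      refine Finset.sum_eq_zero fun m _ => ?_
      by_contra hym
      obtain ⟨-, h1, h2⟩ := hy2 p m hym
      linarith
    have h2 := Finset.sum_nonneg fun m (_ : m ∈ Finset.univ) => hn0 p m
    linarith [hcase.2]

end Greedy

namespace PatrolProblem

variable {I J T : ℕ} (Q : PatrolProblem I J T) {h : ℕ}

/-! ### The fluid limit -/

variable {M : ℕ}

/-- The mean fraction of the sub-processes of `(i, j)` which are in state `b`. -/
def fluidState (α : Fin (M + 1) → Q.LocalPolicy) (w : Fin (M + 1) → ℝ) (i : Fin I) (j : Fin J)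
    (t : ℕ) (b : Q.State i j) : ℝ :=
  ∑ m, w m * Q.localLaw (α m) i j t b

/-- The mean fraction of the sub-processes of `(i, j)` which are in state `b` and receive an agent
from `i'`. -/
def fluidMove (α : Fin (M + 1) → Q.LocalPolicy) (w : Fin (M + 1) → ℝ) (i : Fin I) (j : Fin J)
    (t : ℕ) (b : Q.State i j) (i' : Fin I) : ℝ :=
  ∑ m, w m * (Q.localLaw (α m) i j t b * α m i j b t i')

/-- The mean fraction of the sub-processes of `(i, j)` which are in state `b` and are patrolled. -/
def fluidPatrol (α : Fin (M + 1) → Q.LocalPolicy) (w : Fin (M + 1) → ℝ) (i : Fin I) (j : Fin J)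
    (t : ℕ) (b : Q.State i j) : ℝ :=
  ∑ m, w m * (Q.localLaw (α m) i j t b * Q.active i j (α m i j b t))

theorem fluidState_zero (α : Fin (M + 1) → Q.LocalPolicy) {w : Fin (M + 1) → ℝ}
    (hw : ∑ m, w m = 1) (i : Fin I) (j : Fin J) (b : Q.State i j) :
    Q.fluidState α w i j 0 b = Q.initMarginal i j b := by
  simp only [fluidState, localLaw]
  rw [← Finset.sum_mul, hw, one_mul]

/-- The evolution of the mixture depends on the policies only through the fractions in each state
and the patrolled fractions. The scaled counts satisfy the same recursion in conditional mean, see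
`sum_trans_eq`. -/
theorem fluidState_succ (α : Fin (M + 1) → Q.LocalPolicy) (w : Fin (M + 1) → ℝ) (i : Fin I)
    (j : Fin J) (t : ℕ) (b' : Q.State i j) :
    Q.fluidState α w i j (t + 1) b' = ∑ b, (Q.fluidPatrol α w i j t b * Q.P i j t b true b' +
      (Q.fluidState α w i j t b - Q.fluidPatrol α w i j t b) * Q.P i j t b false b') := by
  simp only [fluidState, fluidPatrol, localLaw, Finset.mul_sum]
  rw [Finset.sum_comm]
  refine Finset.sum_congr rfl fun b _ => ?_
  rw [← Finset.sum_sub_distrib, Finset.sum_mul, Finset.sum_mul, ← Finset.sum_add_distrib]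
  refine Finset.sum_congr rfl fun m _ => ?_
  simp only [trans]
  ring

theorem sum_localCost_eq (α : Fin (M + 1) → Q.LocalPolicy) (w : Fin (M + 1) → ℝ) :
    ∑ m, w m * Q.localCost (α m) = ∑ t ∈ Finset.range T, ∑ i, ∑ j, ∑ b,
      (Q.fluidPatrol α w i j t b * Q.cost i j b true t +
        (Q.fluidState α w i j t b - Q.fluidPatrol α w i j t b) * Q.cost i j b false t) := by
  simp only [localCost, Finset.mul_sum]
  rw [Finset.sum_comm]
  refine Finset.sum_congr rfl fun t _ => ?_
  rw [Finset.sum_comm]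
  refine Finset.sum_congr rfl fun i _ => ?_
  rw [Finset.sum_comm]
  refine Finset.sum_congr rfl fun j _ => ?_
  rw [Finset.sum_comm]
  refine Finset.sum_congr rfl fun b _ => ?_
  simp only [fluidState, fluidPatrol]
  rw [← Finset.sum_sub_distrib, Finset.sum_mul, Finset.sum_mul, ← Finset.sum_add_distrib]
  refine Finset.sum_congr rfl fun m _ => ?_
  simp only [costE]
  ring

variable {Q}

theorem active_eq_sum {i : Fin I} {j : Fin J} {a : Fin I → ℝ} (ha : a ∈ Q.randActions i j) :
    Q.active i j a = ∑ i', a i' :=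
  Finset.sum_subset (Finset.subset_univ _) fun i' _ hi' => ha.2.2 i' hi'

section Mixture

variable {γ : Mult I J} {α : Fin (M + 1) → Q.LocalPolicy} {w : Fin (M + 1) → ℝ}

theorem IsThreshold.localLaw_nonneg {α : Q.LocalPolicy} (hα : Q.IsThreshold γ α) (i : Fin I)
    (j : Fin J) {t : ℕ} (ht : t ≤ T) (b : Q.State i j) : 0 ≤ Q.localLaw α i j t b := by
  induction t generalizing b with
  | zero => exact Q.initMarginal_nonneg i j b
  | succ t ih =>
    refine Finset.sum_nonneg fun b' _ => mul_nonneg (ih (by omega) b') ?_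
    have := Q.active_mem (hα i j b' t ht).1
    exact Q.trans_nonneg i j t b' this.1 this.2 b

theorem sum_fluidMove (hα : ∀ m, Q.IsThreshold γ (α m)) (i : Fin I) (j : Fin J) {t : ℕ}
    (ht : t < T) (b : Q.State i j) :
    ∑ i', Q.fluidMove α w i j t b i' = Q.fluidPatrol α w i j t b := by
  simp only [fluidMove, fluidPatrol]
  rw [Finset.sum_comm]
  refine Finset.sum_congr rfl fun m _ => ?_
  rw [active_eq_sum (hα m i j b t ht).1, Finset.mul_sum, Finset.mul_sum]

theorem fluidMove_nonneg (hα : ∀ m, Q.IsThreshold γ (α m)) (hw : ∀ m, 0 ≤ w m) (i : Fin I)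
    (j : Fin J) {t : ℕ} (ht : t < T) (b : Q.State i j) (i' : Fin I) :
    0 ≤ Q.fluidMove α w i j t b i' :=
  Finset.sum_nonneg fun m _ => mul_nonneg (hw m)
    (mul_nonneg ((hα m).localLaw_nonneg i j ht.le b) ((hα m i j b t ht).1.1 i').1)

theorem fluidPatrol_le (hα : ∀ m, Q.IsThreshold γ (α m)) (hw : ∀ m, 0 ≤ w m) (i : Fin I)
    (j : Fin J) {t : ℕ} (ht : t < T) (b : Q.State i j) :
    Q.fluidPatrol α w i j t b ≤ Q.fluidState α w i j t b :=
  Finset.sum_le_sum fun m _ => mul_le_mul_of_nonneg_left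
    (mul_le_of_le_one_right ((hα m).localLaw_nonneg i j ht.le b)
      (Q.active_mem (hα m i j b t ht).1).2) (hw m)

theorem fluidMove_eq (hα : ∀ m, Q.IsThreshold γ (α m)) {i : Fin I} {j : Fin J} {t : ℕ}
    (ht : t < T) {b : Q.State i j} {i' : Fin I} (hi' : Q.IsMinArgmax γ i j t i')
    (hlt : Q.marginal γ i j b t < γ i' j t) :
    Q.fluidMove α w i j t b i' = Q.fluidState α w i j t b := by
  simp only [fluidMove, fluidState]
  refine Finset.sum_congr rfl fun m _ => ?_
  rw [((hα m i j b t ht).2 i' hi'.1.1).1 ⟨hlt, hi'⟩, mul_one]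

theorem isArgmax_of_fluidMove_ne_zero (hα : ∀ m, Q.IsThreshold γ (α m)) {i : Fin I} {j : Fin J}
    {t : ℕ} (ht : t < T) {b : Q.State i j} {i' : Fin I} (hne : Q.fluidMove α w i j t b i' ≠ 0) :
    Q.IsArgmax γ i j t i' ∧ Q.marginal γ i j b t ≤ γ i' j t := by
  obtain ⟨m, -, hm⟩ := Finset.exists_ne_zero_of_sum_ne_zero hne
  have hαm : α m i j b t i' ≠ 0 := fun e => hm (by rw [e]; ring)
  obtain ⟨hr, hth⟩ := hα m i j b t ht
  have hi' : i' ∈ Q.nbr i j := by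
    by_contra h0
    exact hαm (hr.2.2 i' h0)
  by_cases h1 : Q.marginal γ i j b t < γ i' j t ∧ Q.IsMinArgmax γ i j t i'
  · exact ⟨h1.2.1, h1.1.le⟩
  · by_cases h2 : γ i' j t = Q.marginal γ i j b t ∧ Q.IsArgmax γ i j t i'
    · exact ⟨h2.2, h2.1.ge⟩
    · exact absurd ((hth i' hi').2 h1 h2) hαm

/-- Balance means that the fluid movements use exactly the fluid number of agents of each area,
which is the capacity condition of the greedy estimate. -/
theorem IsBalancedMixture.sum_fluidMove (hα : ∀ m, Q.IsThreshold γ (α m))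
    (hbal : Q.IsBalancedMixture α w) (i' : Fin I) (j : Fin J) {t : ℕ} (ht : t < T) :
    ∑ i, ∑ b, Q.fluidMove α w i j t b i' = ∑ b, Q.ind b * Q.fluidState α w i' j t b := by
  have h1 := hbal i' j t ht
  have e1 : ∀ m i, (Q.expect (Q.lift fun _ : Fin 1 => α m) t fun s => α m i j (s i j 0) t i') =
      ∑ b, Q.localLaw (α m) i j t b * α m i j b t i' := fun m i =>
    Q.expect_lift (fun _ : Fin 1 => α m) t i j 0 fun b => α m i j b t i'
  have e2 : ∀ m, (Q.expect (Q.lift fun _ : Fin 1 => α m) t fun s => Q.ind (s i' j 0)) =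
      ∑ b, Q.localLaw (α m) i' j t b * Q.ind b := fun m =>
    Q.expect_lift (fun _ : Fin 1 => α m) t i' j 0 fun b => Q.ind b
  simp_rw [e1, e2, mul_sub, Finset.sum_sub_distrib] at h1
  have e3 : ∑ m, w m * ∑ b, Q.localLaw (α m) i' j t b * Q.ind b =
      ∑ b, Q.ind b * Q.fluidState α w i' j t b := by
    simp only [fluidState, Finset.mul_sum]
    rw [Finset.sum_comm]
    exact Finset.sum_congr rfl fun b _ => Finset.sum_congr rfl fun m _ => by ring
  have e4 : ∀ m, ∑ i ∈ Q.nbr i' j, ∑ b, Q.localLaw (α m) i j t b * α m i j b t i' =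
      ∑ i, ∑ b, Q.localLaw (α m) i j t b * α m i j b t i' := by
    intro m
    refine Finset.sum_subset (Finset.subset_univ _) fun i _ hi =>
      Finset.sum_eq_zero fun b _ => mul_eq_zero_of_right _ ?_
    exact (hα m i j b t ht).1.2.2 i' fun hc => hi (Q.nbr_symm _ _ _ hc)
  simp_rw [e4] at h1
  rw [← e3, ← sub_eq_zero.mp h1]
  simp only [fluidMove, Finset.mul_sum]
  symm
  rw [Finset.sum_comm]
  exact Finset.sum_congr rfl fun i _ => Finset.sum_comm

end Mixture

/-! ### The numbers of sub-areas in the MAI policy -/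

open Classical in
/-- The number of sub-areas of `(i, j)` in state `b`. -/
def count (s : Q.ScaledState h) (i : Fin I) (j : Fin J) (b : Q.State i j) : ℝ :=
  ∑ k, if s i j k = b then 1 else 0

open Classical in
/-- The expected number of sub-areas of `(i, j)` in state `b` which are patrolled. -/
def patrolCount (φ : Q.Policy h) (t : ℕ) (s : Q.ScaledState h) (i : Fin I) (j : Fin J)
    (b : Q.State i j) : ℝ :=
  ∑ k, if s i j k = b then Q.patrolProb φ t s i j k else 0

theorem sum_count_mul (s : Q.ScaledState h) (i : Fin I) (j : Fin J) (f : Q.State i j → ℝ) :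
    ∑ b, count s i j b * f b = ∑ k, f (s i j k) := by
  classical
  simp only [count, Finset.sum_mul]
  rw [Finset.sum_comm]
  exact Finset.sum_congr rfl fun k _ => by simp

theorem sum_patrolCount_mul (φ : Q.Policy h) (t : ℕ) (s : Q.ScaledState h) (i : Fin I) (j : Fin J)
    (f : Q.State i j → ℝ) :
    ∑ b, patrolCount φ t s i j b * f b = ∑ k, Q.patrolProb φ t s i j k * f (s i j k) := by
  classical
  simp only [patrolCount, Finset.sum_mul]
  rw [Finset.sum_comm]
  exact Finset.sum_congr rfl fun k _ => by simp

/-- The deviation of the state of the scaled system from the fluid limit. -/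
def deviation (α : Fin (M + 1) → Q.LocalPolicy) (w : Fin (M + 1) → ℝ) (t : ℕ)
    (s : Q.ScaledState h) : ℝ :=
  ∑ i, ∑ j, ∑ b, |count s i j b - h * Q.fluidState α w i j t b|

theorem sum_le_deviation (α : Fin (M + 1) → Q.LocalPolicy) (w : Fin (M + 1) → ℝ) (t : ℕ)
    (s : Q.ScaledState h) (j : Fin J) :
    ∑ i, ∑ b, |count s i j b - h * Q.fluidState α w i j t b| ≤ deviation α w t s := by
  unfold deviation
  refine Finset.sum_le_sum fun i _ => ?_
  exact Finset.single_le_sum (f := fun j => ∑ b, |count s i j b - h * Q.fluidState α w i j t b|)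
    (fun j _ => Finset.sum_nonneg fun b _ => abs_nonneg _) (Finset.mem_univ j)

theorem sum_state_le_deviation (α : Fin (M + 1) → Q.LocalPolicy) (w : Fin (M + 1) → ℝ) (t : ℕ)
    (s : Q.ScaledState h) (i : Fin I) (j : Fin J) :
    ∑ b, |count s i j b - h * Q.fluidState α w i j t b| ≤ deviation α w t s :=
  (Finset.single_le_sum (f := fun i => ∑ b, |count s i j b - h * Q.fluidState α w i j t b|)
    (fun _ _ => Finset.sum_nonneg fun _ _ => abs_nonneg _) (Finset.mem_univ i)).trans
    (sum_le_deviation α w t s j)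

theorem abs_count_sub_le (α : Fin (M + 1) → Q.LocalPolicy) (w : Fin (M + 1) → ℝ) (t : ℕ)
    (s : Q.ScaledState h) (i : Fin I) (j : Fin J) (b : Q.State i j) :
    |count s i j b - h * Q.fluidState α w i j t b| ≤ deviation α w t s :=
  (Finset.single_le_sum (f := fun b => |count s i j b - h * Q.fluidState α w i j t b|)
    (fun _ _ => abs_nonneg _) (Finset.mem_univ b)).trans (sum_state_le_deviation α w t s i j)

theorem deviation_nonneg (α : Fin (M + 1) → Q.LocalPolicy) (w : Fin (M + 1) → ℝ) (t : ℕ)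
    (s : Q.ScaledState h) : 0 ≤ deviation α w t s :=
  Finset.sum_nonneg fun _ _ => Finset.sum_nonneg fun _ _ => Finset.sum_nonneg fun _ _ =>
    abs_nonneg _

theorem ind_mem {i : Fin I} {j : Fin J} (b : Q.State i j) : 0 ≤ Q.ind b ∧ Q.ind b ≤ 1 := by
  unfold ind
  split_ifs <;> norm_num

theorem abs_sum_ind_mul_le {i : Fin I} {j : Fin J} (f : Q.State i j → ℝ) :
    |∑ b, Q.ind b * f b| ≤ ∑ b, |f b| := by
  refine (Finset.abs_sum_le_sum_abs _ _).trans (Finset.sum_le_sum fun b _ => ?_)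
  rw [abs_mul, abs_of_nonneg (ind_mem b).1]
  exact mul_le_of_le_one_left (abs_nonneg _) (ind_mem b).2

theorem agents_eq_sum_count (s : Q.ScaledState h) (i : Fin I) (j : Fin J) :
    (Q.agents s i j : ℝ) = ∑ b, Q.ind b * count s i j b := by
  rw [agents_eq_sum, ← sum_count_mul]
  exact Finset.sum_congr rfl fun b _ => mul_comm _ _

theorem abs_agents_sub_le (α : Fin (M + 1) → Q.LocalPolicy) (w : Fin (M + 1) → ℝ) (t : ℕ)
    (s : Q.ScaledState h) (i : Fin I) (j : Fin J) :
    |(Q.agents s i j : ℝ) - h * ∑ b, Q.ind b * Q.fluidState α w i j t b| ≤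
      ∑ b, |count s i j b - h * Q.fluidState α w i j t b| := by
  rw [agents_eq_sum_count, Finset.mul_sum, ← Finset.sum_sub_distrib]
  refine le_trans (le_of_eq ?_) (abs_sum_ind_mul_le _)
  congr 1
  exact Finset.sum_congr rfl fun b _ => by ring

/-- Movements with a common destination differ in their index only through `γ`, those with a common
origin only through the marginal cost. Each kind of blocking thus compares a single quantity. -/
theorem IsRanking.stable {γ : Mult I J} {s : Q.ScaledState h} {t : ℕ} {j : Fin J}
    {L : List (Fin I × Fin h × Fin I)} (hL : Q.IsRanking γ s t j L) {i m : Fin I} {k : Fin h}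
    (hm : m ∈ Q.nbr i j) (hne : Q.indexOrigins s j L (i, k) ≠ some m) :
    (∃ r, Q.indexOrigins s j L (i, k) = some r ∧ γ m j t ≤ γ r j t ∧
      (γ r j t = γ m j t → r < m)) ∨
    (moved (Q.indexOrigins s j L) m = Q.agents s m j ∧
      ∀ x, Q.indexOrigins s j L x = some m →
        Q.marginal γ x.1 j (s x.1 j x.2) t ≤ Q.marginal γ i j (s i j k) t) := by
  by_cases h0 : Q.agents s m j = 0
  · have hle := hL.isValid.moved_le m
    refine Or.inr ⟨by omega, fun x hx => ?_⟩
    have := moved_pos hx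
    omega
  · rcases hL.isStable.stable (i, k, m) ((hL.2.1 _ _ _).mpr ⟨by omega, hm⟩) with
      h1 | ⟨r, h1, h2, h3⟩ | ⟨h1, h2⟩
    · exact absurd h1 hne
    · simp only [index, forall_const, sub_le_sub_iff_left, sub_right_inj] at h2 h3
      exact Or.inl ⟨r, h1, h2, h3⟩
    · refine Or.inr ⟨h1, fun x hx => ?_⟩
      have := (h2 x hx).1
      simpa [index] using this

/-- The pairs of an area and a state of its type-`j` process. -/
abbrev StateClass (Q : PatrolProblem I J T) (j : Fin J) : Type := (i : Fin I) × Q.State i j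

open Classical in
/-- The number of sub-areas of the class `p` that receive an agent from `m`. -/
def moveCount (s : Q.ScaledState h) (j : Fin J) (ϖ : Origins I h) (p : Q.StateClass j)
    (m : Fin I) : ℝ :=
  ∑ k, if s p.1 j k = p.2 ∧ ϖ (p.1, k) = some m then 1 else 0

theorem sum_moveCount_class (s : Q.ScaledState h) (j : Fin J) (ϖ : Origins I h) (m : Fin I) :
    ∑ p, moveCount s j ϖ p m = moved ϖ m := by
  classical
  rw [moved_eq_sum, Fintype.sum_sigma]
  refine Finset.sum_congr rfl fun i _ => ?_
  simp only [moveCount]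
  rw [Finset.sum_comm]
  refine Finset.sum_congr rfl fun k _ => ?_
  rw [Finset.sum_eq_single (s i j k)]
  · simp
  · intro b _ hb
    simp [hb.symm]
  · simp

theorem moveCount_ne_zero {s : Q.ScaledState h} {j : Fin J} {ϖ : Origins I h} {p : Q.StateClass j}
    {m : Fin I} (hne : moveCount s j ϖ p m ≠ 0) :
    ∃ k, s p.1 j k = p.2 ∧ ϖ (p.1, k) = some m := by
  classical
  obtain ⟨k, -, hk⟩ := Finset.exists_ne_zero_of_sum_ne_zero hne
  by_contra hcon
  exact hk (if_neg fun hc => hcon ⟨k, hc⟩)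

open Classical in
theorem sum_moveCount (s : Q.ScaledState h) (j : Fin J) (ϖ : Origins I h) (p : Q.StateClass j) :
    ∑ m, moveCount s j ϖ p m =
      ∑ k, if s p.1 j k = p.2 ∧ ϖ (p.1, k) ≠ none then (1 : ℝ) else 0 := by
  simp only [moveCount]
  rw [Finset.sum_comm]
  refine Finset.sum_congr rfl fun k _ => ?_
  by_cases hk : s p.1 j k = p.2
  · simp only [hk, true_and]
    exact sum_origin _ Finset.univ fun r _ => Finset.mem_univ r
  · simp [hk]

/-- The index policy patrols almost as many sub-areas as the fluid limit. -/
theorem IsRanking.le_sum_moveCount {γ : Mult I J} (hstrict : Q.StrictlyIndexable γ)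
    {α : Fin (M + 1) → Q.LocalPolicy} (hα : ∀ m, Q.IsThreshold γ (α m)) {w : Fin (M + 1) → ℝ}
    (hw : ∀ m, 0 ≤ w m) (hbal : Q.IsBalancedMixture α w) {s : Q.ScaledState h} {t : ℕ}
    (ht : t < T) {j : Fin J} {L : List (Fin I × Fin h × Fin I)} (hL : Q.IsRanking γ s t j L)
    (p : Q.StateClass j) :
    h * Q.fluidPatrol α w p.1 j t p.2 -
        greedyConst (Q.StateClass j) (Fin I) * deviation α w t s ≤
      ∑ m, moveCount s j (Q.indexOrigins s j L) p m := by
  classical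
  choose top htop using fun i => Q.exists_isMinArgmax γ i j t
  have hh : (0 : ℝ) ≤ h := Nat.cast_nonneg h
  set ϖ := Q.indexOrigins s j L with hϖ
  -- Marginal costs depend on the class only, so one blocked sub-area yields the exhaustion
  -- statement for its whole class.
  have hexh : ∀ (p : Q.StateClass j) (m : Fin I), (∃ k, s p.1 j k = p.2 ∧
      moved ϖ m = Q.agents s m j ∧ ∀ x, ϖ x = some m →
        Q.marginal γ x.1 j (s x.1 j x.2) t ≤ Q.marginal γ p.1 j (s p.1 j k) t) →
      (∑ q, moveCount s j ϖ q m = Q.agents s m j ∧ ∀ q, moveCount s j ϖ q m ≠ 0 →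
        Q.marginal γ q.1 j q.2 t ≤ Q.marginal γ p.1 j p.2 t) := by
    rintro p m ⟨k, hk, h1, h2⟩
    refine ⟨by rw [sum_moveCount_class, h1], fun q hq => ?_⟩
    obtain ⟨k', hk', hq'⟩ := moveCount_ne_zero hq
    have := h2 _ hq'
    rwa [hk, hk'] at this
  have hsub : ∑ i', h * Q.fluidMove α w p.1 j t p.2 i' = h * Q.fluidPatrol α w p.1 j t p.2 := by
    rw [← Finset.mul_sum, sum_fluidMove hα _ _ ht]
  rw [← hsub]
  -- Sources are the areas and targets the sub-areas grouped by area and state; the deviation serves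
  -- as the error `E`.
  refine greedy_lower_bound (P := Q.StateClass j) (A := Fin I) (fun p m => m ∈ Q.nbr p.1 j)
    (fun p => Q.marginal γ p.1 j p.2 t) (fun m => γ m j t) (fun p => top p.1)
    (fun p m hm => (htop p.1).1.2 m hm) ?_ ?_
    (fun p => count s p.1 j p.2) (fun p => h * Q.fluidState α w p.1 j t p.2)
    (fun m => Q.agents s m j) (fun p m => moveCount s j ϖ p m)
    (fun p m => h * Q.fluidMove α w p.1 j t p.2 m) (deviation_nonneg α w t s)
    (fun p => abs_count_sub_le α w t s p.1 j p.2) ?_ ?_ ?_ ?_ ?_ ?_ ?_ ?_ ?_ ?_ p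
  · intro p m hm hγ
    exact (htop p.1).2 m ⟨hm, fun i'' hi'' => ((htop p.1).1.2 i'' hi'').trans hγ.ge⟩
  · intro p q m hp hq he
    -- Two classes served by `m` lie in the neighbourhood of `m`, by symmetry, which is where strict
    -- indexability compares them.
    exact hstrict m j t ht p.1 (Q.nbr_symm _ _ _ hp) q.1 (Q.nbr_symm _ _ _ hq) p.2 q.2 he
  · intro m
    have h1 : ∑ p : Q.StateClass j, h * Q.fluidMove α w p.1 j t p.2 m =
        h * ∑ b, Q.ind b * Q.fluidState α w m j t b := by
      rw [← Finset.mul_sum, Fintype.sum_sigma, ← hbal.sum_fluidMove hα m j ht]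
    have h2 := (abs_le.mp (abs_agents_sub_le α w t s m j)).1
    have h3 := sum_state_le_deviation α w t s m j
    rw [h1]
    linarith
  · intro p m
    refine Finset.sum_nonneg fun k _ => ?_
    split_ifs <;> norm_num
  · intro p m hne
    obtain ⟨k, -, hk⟩ := moveCount_ne_zero hne
    exact hL.isValid.nbr _ _ hk
  · intro p
    rw [sum_moveCount]
    refine Finset.sum_le_sum fun k _ => ?_
    split_ifs with h1 h2 h2
    · exact le_rfl
    · exact absurd h1.1 h2
    · exact zero_le_one
    · exact le_rfl
  · exact fun p m => mul_nonneg hh (fluidMove_nonneg hα hw _ _ ht _ _)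
  · intro p
    rw [← Finset.mul_sum, sum_fluidMove hα _ _ ht]
    exact mul_le_mul_of_nonneg_left (fluidPatrol_le hα hw _ _ ht _) hh
  · intro p hp
    rw [fluidMove_eq hα ht (htop p.1) hp]
  · intro p m hne
    obtain ⟨h1, h2⟩ := isArgmax_of_fluidMove_ne_zero hα ht (right_ne_zero_of_mul hne)
    exact ⟨h1.1, le_antisymm ((htop p.1).1.2 m h1.1) (h1.2 _ (htop p.1).1.1), h2⟩
  · intro p hp
    by_cases hall : ∀ k, s p.1 j k = p.2 → ϖ (p.1, k) = some (top p.1)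
    · refine Or.inl (Finset.sum_congr rfl fun k _ => ?_)
      by_cases hk : s p.1 j k = p.2
      · rw [if_pos hk, if_pos ⟨hk, hall k hk⟩]
      · rw [if_neg hk, if_neg fun hc => hk hc.1]
    · push Not at hall
      obtain ⟨k, hk, hne⟩ := hall
      rcases hL.stable (htop p.1).1.1 hne with ⟨r, h1, h2, h3⟩ | h1
      · have hr := hL.isValid.nbr _ _ h1
        have h4 := (htop p.1).1.2 r hr
        have h5 := (htop p.1).2 r ⟨hr, fun i'' hi'' => ((htop p.1).1.2 i'' hi'').trans h2⟩
        -- The competing origin would tie with `top` in `γ` and have a smaller label, against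
        -- minimality. Hence the tie rule of the ranking matches that of the threshold policies.
        exact absurd (h3 (le_antisymm h4 h2)) (not_lt.mpr h5)
      · exact Or.inr (hexh p _ ⟨k, hk, h1⟩)
  · intro p
    by_cases hall : ∀ k, s p.1 j k = p.2 → ϖ (p.1, k) ≠ none
    · left
      rw [sum_moveCount]
      refine Finset.sum_congr rfl fun k _ => ?_
      by_cases hk : s p.1 j k = p.2
      · rw [if_pos hk, if_pos ⟨hk, hall k hk⟩]
      · rw [if_neg hk, if_neg fun hc => hk hc.1]
    · push Not at hall
      obtain ⟨k, hk, hnone⟩ := hall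
      refine Or.inr fun m hm => hexh p m ⟨k, hk, ?_⟩
      rcases hL.stable (k := k) hm (by rw [← hϖ, hnone]; simp) with ⟨r, h1, -⟩ | h1
      · rw [← hϖ, hnone] at h1
        simp at h1
      · exact h1

/-- A single term can be large only if the others compensate it, and they are bounded below. -/
theorem abs_le_of_neg_le_of_sum_le {P : Type*} [Fintype P] (f : P → ℝ) {E K : ℝ} (hE : 0 ≤ E)
    (hK : 0 ≤ K) (h1 : ∀ p, -K ≤ f p) (h2 : ∑ p, f p ≤ E) (p : P) :
    |f p| ≤ E + Fintype.card P * K := by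
  have hc : (1 : ℝ) ≤ Fintype.card P := by
    exact_mod_cast Fintype.card_pos_iff.mpr ⟨p⟩
  have hp : f p + K ≤ ∑ q, (f q + K) :=
    Finset.single_le_sum (f := fun q => f q + K) (fun q _ => by linarith [h1 q])
      (Finset.mem_univ p)
  rw [Finset.sum_add_distrib, Finset.sum_const, Finset.card_univ, nsmul_eq_mul] at hp
  rw [abs_le]
  constructor
  · nlinarith [h1 p]
  · linarith

/-- The constant in `IsMAI.abs_patrolCount_sub_le`. -/
def patrolConst (Q : PatrolProblem I J T) : ℝ :=
  ∑ j : Fin J, (1 + Fintype.card (Q.StateClass j) * greedyConst (Q.StateClass j) (Fin I))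

theorem greedyConst_nonneg (P A : Type*) [Fintype P] [Fintype A] : 0 ≤ greedyConst P A := by
  unfold greedyConst
  positivity

theorem patrolConst_nonneg (Q : PatrolProblem I J T) : 0 ≤ patrolConst Q := by
  refine Finset.sum_nonneg fun j _ => ?_
  have := greedyConst_nonneg (Q.StateClass j) (Fin I)
  positivity

/-- The places found by the adaption need not be known. It keeps the lower bounds of the index
policy class by class, and the total number of patrols is the number of agents, which is close to
its fluid value. -/
theorem IsMAI.abs_patrolCount_sub_le {γ : Mult I J} (hstrict : Q.StrictlyIndexable γ)
    {α : Fin (M + 1) → Q.LocalPolicy} (hα : ∀ m, Q.IsThreshold γ (α m)) {w : Fin (M + 1) → ℝ}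
    (hw : ∀ m, 0 ≤ w m) (hbal : Q.IsBalancedMixture α w) {φ : Q.Policy h} (hφ : Q.IsMAI γ φ)
    (s : Q.ScaledState h) {t : ℕ} (ht : t < T) (i : Fin I) (j : Fin J) (b : Q.State i j) :
    |patrolCount φ t s i j b - h * Q.fluidPatrol α w i j t b| ≤
      patrolConst Q * deviation α w t s := by
  classical
  obtain ⟨ϖ, hϖ, hφϖ⟩ := hφ s t ht j
  obtain ⟨hnbr, hmoved, L, hL, hocc⟩ := hϖ.spec
  have hprob : ∀ i k, Q.patrolProb φ t s i j k = if ϖ (i, k) ≠ none then 1 else 0 := by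
    intro i k
    simp only [patrolProb, active, hφϖ]
    exact sum_origin _ _ (hnbr (i, k))
  have hcount : ∀ p : Q.StateClass j, patrolCount φ t s p.1 j p.2 =
      ∑ m, moveCount s j ϖ p m := by
    intro p
    rw [sum_moveCount]
    refine Finset.sum_congr rfl fun k _ => ?_
    rw [hprob]
    split_ifs <;> simp_all
  have hdev := deviation_nonneg α w t s
  have hg := greedyConst_nonneg (Q.StateClass j) (Fin I)
  have key := abs_le_of_neg_le_of_sum_le
    (fun p : Q.StateClass j => patrolCount φ t s p.1 j p.2 - h * Q.fluidPatrol α w p.1 j t p.2)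
    hdev (mul_nonneg hg hdev) ?_ ?_ ⟨i, b⟩
  · refine key.trans ?_
    have : 1 + Fintype.card (Q.StateClass j) * greedyConst (Q.StateClass j) (Fin I) ≤
        patrolConst Q :=
      Finset.single_le_sum (f := fun j : Fin J =>
        1 + Fintype.card (Q.StateClass j) * greedyConst (Q.StateClass j) (Fin I))
        (fun j _ => by
          have := greedyConst_nonneg (Q.StateClass j) (Fin I)
          positivity) (Finset.mem_univ j)
    have := mul_le_mul_of_nonneg_right this hdev
    linarith
  · intro p
    have h1 := hL.le_sum_moveCount hstrict hα hw hbal ht p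
    have h2 : ∑ m, moveCount s j (Q.indexOrigins s j L) p m ≤ ∑ m, moveCount s j ϖ p m := by
      rw [sum_moveCount, sum_moveCount]
      refine Finset.sum_le_sum fun k _ => ?_
      split_ifs with h1 h2 h2
      · exact le_rfl
      · exact absurd ⟨h1.1, hocc _ h1.2⟩ h2
      · exact zero_le_one
      · exact le_rfl
    rw [hcount]
    linarith
  · have h1 : ∑ p : Q.StateClass j, patrolCount φ t s p.1 j p.2 =
        ∑ m, (Q.agents s m j : ℝ) := by
      simp_rw [hcount]
      rw [Finset.sum_comm]
      exact Finset.sum_congr rfl fun m _ => by rw [sum_moveCount_class, hmoved]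
    have h2 : ∑ p : Q.StateClass j, h * Q.fluidPatrol α w p.1 j t p.2 =
        ∑ m, h * ∑ b, Q.ind b * Q.fluidState α w m j t b := by
      simp_rw [← sum_fluidMove hα _ _ ht, ← hbal.sum_fluidMove hα _ j ht, Finset.mul_sum]
      rw [Finset.sum_comm]
      exact Finset.sum_congr rfl fun m _ => Fintype.sum_sigma _
    rw [Finset.sum_sub_distrib, h1, h2, ← Finset.sum_sub_distrib]
    refine le_trans (Finset.sum_le_sum fun m _ => ?_) (sum_le_deviation α w t s j)
    exact (le_abs_self _).trans (abs_agents_sub_le α w t s m j)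

end PatrolProblem

namespace PatrolProblem

variable {I J T : ℕ} {Q : PatrolProblem I J T} {h M : ℕ}

/-! ### Convergence to the fluid limit -/

theorem P_le_one (Q : PatrolProblem I J T) (i : Fin I) (j : Fin J) (t : ℕ) (s : Q.State i j)
    (e : Bool) (s' : Q.State i j) : Q.P i j t s e s' ≤ 1 := by
  rw [← Q.P_sum i j t s e]
  exact Finset.single_le_sum (fun b _ => Q.P_nonneg i j t s e b) (Finset.mem_univ s')

theorem expect_zero_abs_count_sub_le {α : Fin (M + 1) → Q.LocalPolicy} {w : Fin (M + 1) → ℝ}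
    (hw : ∑ m, w m = 1) (φ : Q.Policy h) (i : Fin I) (j : Fin J) (b : Q.State i j) :
    (Q.expect φ 0 fun s => |count s i j b - h * Q.fluidState α w i j 0 b|) ≤ √(h : ℝ) := by
  classical
  have h1 := sum_prod_weights_abs_le (fun _ : Fin h => Q.init) (fun _ => Q.init_nonneg)
    (fun _ => Q.init_sum) (fun x => if x i j = b then 1 else 0)
    (fun x => by split_ifs <;> simp)
  have h2 : ∑ x, Q.init x * (if x i j = b then 1 else 0) = Q.initMarginal i j b := by
    simp only [initMarginal, mul_ite, mul_one, mul_zero]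
  rw [h2, Finset.sum_const, Finset.card_univ, Fintype.card_fin, nsmul_eq_mul] at h1
  rw [Q.fluidState_zero α hw]
  exact (Q.expect_zero φ fun x => |(∑ k, if x k i j = b then (1 : ℝ) else 0) -
    h * Q.initMarginal i j b|).trans_le h1

/-- The expected number of sub-areas of `(i, j)` in state `b'` after a transition. -/
theorem sum_trans_eq (φ : Q.Policy h) (t : ℕ) (s : Q.ScaledState h) (i : Fin I) (j : Fin J)
    (b' : Q.State i j) :
    ∑ k, Q.trans i j t (s i j k) (Q.patrolProb φ t s i j k) b' =
      ∑ b, (patrolCount φ t s i j b * Q.P i j t b true b' +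
        (count s i j b - patrolCount φ t s i j b) * Q.P i j t b false b') := by
  simp_rw [sub_mul]
  rw [Finset.sum_add_distrib, Finset.sum_sub_distrib,
    sum_patrolCount_mul φ t s i j fun b => Q.P i j t b true b',
    sum_patrolCount_mul φ t s i j fun b => Q.P i j t b false b',
    sum_count_mul s i j fun b => Q.P i j t b false b', ← Finset.sum_sub_distrib,
    ← Finset.sum_add_distrib]
  refine Finset.sum_congr rfl fun k _ => ?_
  simp only [trans]
  ring

/-- Given the present state, the new count is a sum of `h` independent indicators. Its fluctuation
about the conditional mean gives `√h`, and the triangle inequality the rest. -/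
theorem kernel_abs_count_sub_le {φ : Q.Policy h} (hφ : Q.IsRandomised φ) {t : ℕ} (ht : t < T)
    (s : Q.ScaledState h) (i : Fin I) (j : Fin J) (b' : Q.State i j) (z : ℝ) :
    ∑ s', Q.kernel φ t s s' * |count s' i j b' - z| ≤ √(h : ℝ) +
      |∑ k, Q.trans i j t (s i j k) (Q.patrolProb φ t s i j k) b' - z| := by
  classical
  have hm := Q.kernel_marginal φ t s i j
    fun y => |(∑ k, if y k = b' then (1 : ℝ) else 0) - z|
  have hp0 : ∀ k b, 0 ≤ Q.trans i j t (s i j k) (Q.patrolProb φ t s i j k) b := fun k b =>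
    Q.trans_nonneg i j t _ (Q.active_mem (hφ s t ht i j k)).1
      (Q.active_mem (hφ s t ht i j k)).2 b
  have h1 := sum_prod_weights_abs_le
    (fun k => Q.trans i j t (s i j k) (Q.patrolProb φ t s i j k)) hp0
    (fun k => Q.trans_sum ..) (fun b => if b = b' then 1 else 0)
    (fun b => by split_ifs <;> simp)
  have h2 : ∀ k, ∑ b, Q.trans i j t (s i j k) (Q.patrolProb φ t s i j k) b *
      (if b = b' then 1 else 0) = Q.trans i j t (s i j k) (Q.patrolProb φ t s i j k) b' := by
    intro k
    simp
  simp_rw [h2] at h1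
  rw [Fintype.card_fin] at h1
  set μ := ∑ k, Q.trans i j t (s i j k) (Q.patrolProb φ t s i j k) b'
  have hW : ∑ y : Fin h → Q.State i j,
      ∏ k, Q.trans i j t (s i j k) (Q.patrolProb φ t s i j k) (y k) = 1 := by
    rw [sum_prod_weights (β := fun _ => Q.State i j)
      (fun k => Q.trans i j t (s i j k) (Q.patrolProb φ t s i j k))]
    exact Finset.prod_eq_one fun k _ => Q.trans_sum ..
  refine hm.trans_le ?_
  calc _ ≤ ∑ y : Fin h → Q.State i j,
        ((∏ k, Q.trans i j t (s i j k) (Q.patrolProb φ t s i j k) (y k)) *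
          |(∑ k, if y k = b' then (1 : ℝ) else 0) - μ| +
        (∏ k, Q.trans i j t (s i j k) (Q.patrolProb φ t s i j k) (y k)) * |μ - z|) := by
        refine Finset.sum_le_sum fun y _ => ?_
        rw [← mul_add]
        exact mul_le_mul_of_nonneg_left (abs_sub_le _ _ _)
          (Finset.prod_nonneg fun k _ => hp0 k _)
    _ ≤ _ := by
        rw [Finset.sum_add_distrib, ← Finset.sum_mul, hW, one_mul]
        linarith

theorem IsMAI.isRandomised {γ : Mult I J} {φ : Q.Policy h} (hφ : Q.IsMAI γ φ) :
    Q.IsRandomised φ :=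
  hφ.isApplicable.isRelaxedApplicable.1

/-- Used twice: with transition probabilities to propagate the deviation, and with costs to compare
the objectives. Per state, the patrol error enters twice and the count error once, whence `2 *
patrolConst Q + 1`. -/
theorem IsMAI.abs_sum_sub_le {γ : Mult I J} (hstrict : Q.StrictlyIndexable γ)
    {α : Fin (M + 1) → Q.LocalPolicy} (hα : ∀ m, Q.IsThreshold γ (α m)) {w : Fin (M + 1) → ℝ}
    (hw : ∀ m, 0 ≤ w m) (hbal : Q.IsBalancedMixture α w)
    {φ : Q.Policy h} (hφ : Q.IsMAI γ φ) {t : ℕ} (ht : t < T)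
    (s : Q.ScaledState h) (i : Fin I) (j : Fin J) (f g : Q.State i j → ℝ) {B : ℝ}
    (hf : ∀ b, 0 ≤ f b ∧ f b ≤ B) (hg : ∀ b, 0 ≤ g b ∧ g b ≤ B) (hB : 0 ≤ B) :
    |∑ b, (patrolCount φ t s i j b * f b + (count s i j b - patrolCount φ t s i j b) * g b) -
      h * ∑ b, (Q.fluidPatrol α w i j t b * f b +
        (Q.fluidState α w i j t b - Q.fluidPatrol α w i j t b) * g b)| ≤
      (B * (Fintype.card (Q.State i j) * (2 * patrolConst Q + 1))) * deviation α w t s := by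
  rw [Finset.mul_sum, ← Finset.sum_sub_distrib]
  refine (Finset.abs_sum_le_sum_abs _ _).trans ?_
  have h1 : ∀ b, |patrolCount φ t s i j b * f b +
      (count s i j b - patrolCount φ t s i j b) * g b -
      h * (Q.fluidPatrol α w i j t b * f b +
        (Q.fluidState α w i j t b - Q.fluidPatrol α w i j t b) * g b)| ≤
      B * ((2 * patrolConst Q + 1) * deviation α w t s) := by
    intro b
    have hx := hφ.abs_patrolCount_sub_le hstrict hα hw hbal s ht i j b
    have hz := abs_count_sub_le α w t s i j b
    set X := patrolCount φ t s i j b - h * Q.fluidPatrol α w i j t b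
    set Z := count s i j b - h * Q.fluidState α w i j t b
    have e : patrolCount φ t s i j b * f b +
        (count s i j b - patrolCount φ t s i j b) * g b -
        h * (Q.fluidPatrol α w i j t b * f b +
        (Q.fluidState α w i j t b - Q.fluidPatrol α w i j t b) * g b) =
        X * f b + (Z - X) * g b := by
      ring
    rw [e]
    have h2 : |X * f b| ≤ |X| * B := by
      rw [abs_mul, abs_of_nonneg (hf b).1]
      exact mul_le_mul_of_nonneg_left (hf b).2 (abs_nonneg _)
    have h3 : |(Z - X) * g b| ≤ (|Z| + |X|) * B := by
      rw [abs_mul, abs_of_nonneg (hg b).1]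
      exact mul_le_mul (abs_sub _ _) (hg b).2 (hg b).1 (by positivity)
    have h4 := mul_le_mul_of_nonneg_right hx hB
    have h5 := mul_le_mul_of_nonneg_right hz hB
    have h6 := abs_add_le (X * f b) ((Z - X) * g b)
    linarith
  refine (Finset.sum_le_sum fun b _ => h1 b).trans (le_of_eq ?_)
  rw [Finset.sum_const, Finset.card_univ, nsmul_eq_mul]
  ring

/-- A discrete Gronwall argument: each slot multiplies the deviation by a constant independent of
`h` and adds sampling noise of order `√h`. -/
theorem exists_expect_deviation_le {γ : Mult I J} (hstrict : Q.StrictlyIndexable γ)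
    {α : Fin (M + 1) → Q.LocalPolicy} (hα : ∀ m, Q.IsThreshold γ (α m)) {w : Fin (M + 1) → ℝ}
    (hw : ∀ m, 0 ≤ w m) (hw1 : ∑ m, w m = 1) (hbal : Q.IsBalancedMixture α w)
    {t : ℕ} (ht : t ≤ T) :
    ∃ C, 0 ≤ C ∧ ∀ (h : ℕ) (φ : Q.Policy h), Q.IsMAI γ φ →
      Q.expect φ t (deviation α w t) ≤ C * √(h : ℝ) := by
  induction t with
  | zero =>
    refine ⟨∑ i, ∑ j, ∑ _b : Q.State i j, 1, by positivity, fun h φ _ => ?_⟩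
    unfold deviation
    simp_rw [expect_sum, Finset.sum_mul, one_mul]
    exact Finset.sum_le_sum fun i _ => Finset.sum_le_sum fun j _ => Finset.sum_le_sum fun b _ =>
      expect_zero_abs_count_sub_le hw1 φ i j b
  | succ t ih =>
    obtain ⟨C, hC, ih⟩ := ih (by omega)
    have hc := patrolConst_nonneg Q
    refine ⟨∑ i, ∑ j, ∑ _b : Q.State i j,
      (1 + (Fintype.card (Q.State i j) * (2 * patrolConst Q + 1)) * C), by positivity,
      fun h φ hφ => ?_⟩
    have hr := hφ.isRandomised
    have h1 : Q.expect φ (t + 1) (deviation α w (t + 1)) = ∑ i, ∑ j, ∑ b : Q.State i j,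
        Q.expect φ (t + 1) fun s => |count s i j b - h * Q.fluidState α w i j (t + 1) b| := by
      unfold deviation
      simp_rw [expect_sum]
    rw [h1]
    simp_rw [Finset.sum_mul]
    refine Finset.sum_le_sum fun i _ => Finset.sum_le_sum fun j _ => Finset.sum_le_sum fun b _ => ?_
    rw [expect_succ]
    have h2 : ∀ s, ∑ s', Q.kernel φ t s s' *
        |count s' i j b - h * Q.fluidState α w i j (t + 1) b| ≤ √(h : ℝ) * 1 +
        (Fintype.card (Q.State i j) * (2 * patrolConst Q + 1)) * deviation α w t s := by
      intro s
      refine (kernel_abs_count_sub_le hr ht s i j b _).trans ?_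
      rw [sum_trans_eq, fluidState_succ]
      have := hφ.abs_sum_sub_le hstrict hα hw hbal ht s i j (fun b' => Q.P i j t b' true b)
        (fun b' => Q.P i j t b' false b) (B := 1)
        (fun b' => ⟨Q.P_nonneg .., P_le_one ..⟩) (fun b' => ⟨Q.P_nonneg .., P_le_one ..⟩)
        zero_le_one
      rw [one_mul] at this
      linarith
    refine (hr.expect_mono (by omega) h2).trans ?_
    rw [expect_add, expect_const_mul, expect_const_mul, expect_one]
    have := mul_le_mul_of_nonneg_left (ih h φ hφ)
      (show 0 ≤ Fintype.card (Q.State i j) * (2 * patrolConst Q + 1) by positivity)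
    linarith

/-- The total cost is linear in the counts, so its error is of order `√h` before the division by
`h`. -/
theorem exists_abs_expCost_sub_le {γ : Mult I J} (hstrict : Q.StrictlyIndexable γ)
    {α : Fin (M + 1) → Q.LocalPolicy} (hα : ∀ m, Q.IsThreshold γ (α m)) {w : Fin (M + 1) → ℝ}
    (hw : ∀ m, 0 ≤ w m) (hw1 : ∑ m, w m = 1) (hbal : Q.IsBalancedMixture α w) :
    ∃ K, ∀ (h : ℕ), 0 < h → ∀ φ : Q.Policy h, Q.IsMAI γ φ →
      |Q.expCost φ - ∑ m, w m * Q.localCost (α m)| ≤ K / √(h : ℝ) := by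
  have hc := patrolConst_nonneg Q
  -- The dummy constant `0` from time `T` on makes the choice of `C` total.
  have hdev : ∀ t, ∃ C, 0 ≤ C ∧ (t < T → ∀ (h : ℕ) (φ : Q.Policy h), Q.IsMAI γ φ →
      Q.expect φ t (deviation α w t) ≤ C * √(h : ℝ)) := by
    intro t
    by_cases ht : t < T
    · obtain ⟨C, h0, hC⟩ := exists_expect_deviation_le hstrict hα hw hw1 hbal ht.le
      exact ⟨C, h0, fun _ => hC⟩
    · exact ⟨0, le_rfl, fun h0 => absurd h0 ht⟩
  choose C hC0 hC using hdev
  let B : ∀ (i : Fin I) (j : Fin J), ℕ → ℝ := fun i j t =>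
    ∑ b, (Q.cost i j b true t + Q.cost i j b false t)
  have hB : ∀ i j t b, Q.cost i j b true t ≤ B i j t ∧ Q.cost i j b false t ≤ B i j t := by
    intro i j t b
    have h1 := Finset.single_le_sum (f := fun b => Q.cost i j b true t + Q.cost i j b false t)
      (fun b _ => add_nonneg (Q.cost_nonneg i j b true t) (Q.cost_nonneg i j b false t))
      (Finset.mem_univ b)
    have h2 := Q.cost_nonneg i j b true t
    have h3 := Q.cost_nonneg i j b false t
    constructor <;> linarith
  have hB0 : ∀ i j t, 0 ≤ B i j t := fun i j t =>
    Finset.sum_nonneg fun b _ => add_nonneg (Q.cost_nonneg ..) (Q.cost_nonneg ..)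
  let D : ∀ (i : Fin I) (j : Fin J), ℕ → ℝ := fun i j t =>
    B i j t * (Fintype.card (Q.State i j) * (2 * patrolConst Q + 1))
  refine ⟨∑ t ∈ Finset.range T, ∑ i, ∑ j, D i j t * C t, fun h hh φ hφ => ?_⟩
  have hh' : (0 : ℝ) < h := by exact_mod_cast hh
  have hr := hφ.isRandomised
  let F : ∀ (i : Fin I) (j : Fin J), ℕ → ℝ := fun i j t =>
    ∑ b, (Q.fluidPatrol α w i j t b * Q.cost i j b true t +
        (Q.fluidState α w i j t b - Q.fluidPatrol α w i j t b) * Q.cost i j b false t)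
  let G : ∀ (i : Fin I) (j : Fin J), ℕ → Q.ScaledState h → ℝ := fun i j t s =>
    ∑ b, (patrolCount φ t s i j b * Q.cost i j b true t +
        (count s i j b - patrolCount φ t s i j b) * Q.cost i j b false t)
  have hcost : Q.expCost φ = (1 / (h : ℝ)) * ∑ t ∈ Finset.range T, ∑ i, ∑ j,
      Q.expect φ t (G i j t) := by
    unfold expCost
    congr 1
    refine Finset.sum_congr rfl fun t _ => Finset.sum_congr rfl fun i _ =>
      Finset.sum_congr rfl fun j _ => ?_
    rw [← expect_sum]
    congr 1
    funext s
    simp only [G, sub_mul]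
    rw [Finset.sum_add_distrib, Finset.sum_sub_distrib,
      sum_patrolCount_mul φ t s i j fun b => Q.cost i j b true t,
      sum_patrolCount_mul φ t s i j fun b => Q.cost i j b false t,
      sum_count_mul s i j fun b => Q.cost i j b false t, ← Finset.sum_sub_distrib,
      ← Finset.sum_add_distrib]
    refine Finset.sum_congr rfl fun k _ => ?_
    simp only [costE, patrolProb]
    ring
  have hterm : ∀ t ∈ Finset.range T, ∀ i j,
      |Q.expect φ t (G i j t) - h * F i j t| ≤ D i j t * C t * √(h : ℝ) := by
    intro t ht i j
    rw [Finset.mem_range] at ht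
    have h1 : Q.expect φ t (G i j t) - h * F i j t =
        Q.expect φ t fun s => G i j t s - h * F i j t * 1 := by
      rw [expect_sub, expect_const_mul, expect_one, mul_one]
    have h2 : |Q.expect φ t (G i j t) - h * F i j t| ≤
        Q.expect φ t fun s => |G i j t s - h * F i j t| := by
      rw [h1]
      refine (Finset.abs_sum_le_sum_abs _ _).trans (le_of_eq ?_)
      refine Finset.sum_congr rfl fun s _ => ?_
      rw [abs_mul, abs_of_nonneg (hr.law_nonneg ht.le s), mul_one]
    have h3 := hr.expect_mono ht.le (f := fun s => |G i j t s - h * F i j t|)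
      (g := fun s => D i j t * deviation α w t s) fun s =>
        hφ.abs_sum_sub_le hstrict hα hw hbal ht s i j (fun b => Q.cost i j b true t)
          (fun b => Q.cost i j b false t) (fun b => ⟨Q.cost_nonneg .., (hB i j t b).1⟩)
          (fun b => ⟨Q.cost_nonneg .., (hB i j t b).2⟩) (hB0 i j t)
    rw [expect_const_mul] at h3
    have h4 : 0 ≤ D i j t := mul_nonneg (hB0 i j t) (by positivity)
    have h5 := mul_le_mul_of_nonneg_left (hC t ht h φ hφ) h4
    linarith
  have hdiff : Q.expCost φ - ∑ m, w m * Q.localCost (α m) = (1 / (h : ℝ)) *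
      ∑ t ∈ Finset.range T, ∑ i, ∑ j, (Q.expect φ t (G i j t) - h * F i j t) := by
    rw [hcost, sum_localCost_eq]
    simp_rw [Finset.sum_sub_distrib, ← Finset.mul_sum]
    rw [mul_sub, ← mul_assoc, one_div_mul_cancel hh'.ne', one_mul]
  have hsum : |∑ t ∈ Finset.range T, ∑ i, ∑ j, (Q.expect φ t (G i j t) - h * F i j t)| ≤
      (∑ t ∈ Finset.range T, ∑ i, ∑ j, D i j t * C t) * √(h : ℝ) := by
    simp_rw [Finset.sum_mul]
    refine (Finset.abs_sum_le_sum_abs _ _).trans (Finset.sum_le_sum fun t ht => ?_)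
    refine (Finset.abs_sum_le_sum_abs _ _).trans (Finset.sum_le_sum fun i _ => ?_)
    exact (Finset.abs_sum_le_sum_abs _ _).trans (Finset.sum_le_sum fun j _ => hterm t ht i j)
  rw [hdiff, abs_mul, abs_of_nonneg (by positivity)]
  refine (mul_le_mul_of_nonneg_left hsum (by positivity)).trans (le_of_eq ?_)
  have hs : √(h : ℝ) ≠ 0 := (Real.sqrt_pos.mpr hh').ne'
  have hsq : √(h : ℝ) * √(h : ℝ) = h := Real.mul_self_sqrt hh'.le
  rw [one_div, inv_mul_eq_div, div_eq_div_iff hh'.ne' hs, mul_assoc, hsq]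

/-! ### The cost of the mixed policy -/

/-- Every `k` in the block of length `⌊w m * h⌋₊` after the earlier blocks has tag `m`; the blocks
fit into `h` because the floors add up to at most `h`. The surplus tagged with the last policy needs
no separate treatment. -/
theorem floor_le_card_mixTag {w : Fin (M + 1) → ℝ} (hw : ∀ m, 0 ≤ w m) (hw1 : ∑ m, w m = 1)
    (h : ℕ) (m : Fin (M + 1)) :
    ⌊w m * (h : ℝ)⌋₊ ≤ (Finset.univ.filter fun k => mixTag w h k = m).card := by
  set f : Fin (M + 1) → ℕ := fun m => ⌊w m * (h : ℝ)⌋₊ with hf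
  set a := ∑ m' ∈ Finset.Iio m, f m' with ha
  have hIic : ∑ m' ∈ Finset.Iic m, f m' = a + f m := by
    rw [← Finset.Iio_insert, Finset.sum_insert (by simp), add_comm]
  have hle : a + f m ≤ h := by
    rw [← hIic]
    have h1 : ∑ m', (f m' : ℝ) ≤ h := by
      calc ∑ m', (f m' : ℝ) ≤ ∑ m', w m' * (h : ℝ) := Finset.sum_le_sum fun m' _ =>
            Nat.floor_le (mul_nonneg (hw m') (Nat.cast_nonneg h))
        _ = h := by rw [← Finset.sum_mul, hw1, one_mul]
    have h2 : ∑ m' ∈ Finset.Iic m, f m' ≤ ∑ m', f m' :=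
      Finset.sum_le_sum_of_subset (Finset.subset_univ _)
    exact h2.trans (by exact_mod_cast h1)
  have hsub : Finset.Ico a (a + f m) ⊆
      (Finset.univ.filter fun k => mixTag w h k = m).map Fin.valEmbedding := by
    intro n hn
    rw [Finset.mem_Ico] at hn
    rw [Finset.mem_map]
    refine ⟨⟨n, by omega⟩, ?_, rfl⟩
    rw [Finset.mem_filter]
    refine ⟨Finset.mem_univ _, ?_⟩
    unfold mixTag
    refine le_antisymm (Finset.min'_le _ _ ?_) (Finset.le_min' _ _ _ fun m' hm' => ?_)
    · rw [Finset.mem_filter]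
      refine ⟨Finset.mem_univ _, Or.inr ?_⟩
      change n < ∑ m' ∈ Finset.Iic m, f m'
      omega
    · by_contra hlt
      rw [not_le] at hlt
      rw [Finset.mem_filter] at hm'
      rcases hm'.2 with h1 | h1
      · subst h1
        exact absurd (Fin.le_last m) (not_le.mpr hlt)
      · have h2 : ∑ m'' ∈ Finset.Iic m', f m'' ≤ a :=
          Finset.sum_le_sum_of_subset fun x hx => by
            rw [Finset.mem_Iic] at hx
            exact Finset.mem_Iio.mpr (hx.trans_lt hlt)
        change n < ∑ m'' ∈ Finset.Iic m', f m'' at h1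
        omega
  have := Finset.card_le_card hsub
  rwa [Nat.card_Ico, Finset.card_map, Nat.add_sub_cancel_left] at this

theorem abs_sum_mixTag_sub_le {w : Fin (M + 1) → ℝ} (hw : ∀ m, 0 ≤ w m) (hw1 : ∑ m, w m = 1)
    (h : ℕ) (g : Fin (M + 1) → ℝ) :
    |∑ k, g (mixTag w h k) - h * ∑ m, w m * g m| ≤ (M + 1) * ∑ m, |g m| := by
  set n : Fin (M + 1) → ℝ := fun m =>
    ((Finset.univ.filter fun k => mixTag w h k = m).card : ℝ) with hn
  have hsum : ∑ k, g (mixTag w h k) = ∑ m, n m * g m := by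
    rw [← Finset.sum_fiberwise Finset.univ (fun k => mixTag w h k)]
    refine Finset.sum_congr rfl fun m _ => ?_
    rw [Finset.sum_congr rfl fun k hk => by rw [(Finset.mem_filter.mp hk).2], Finset.sum_const,
      nsmul_eq_mul]
  have htot : ∑ m, n m = h := by
    have := Finset.card_eq_sum_card_fiberwise (s := (Finset.univ : Finset (Fin h)))
      (t := Finset.univ) (f := fun k => mixTag w h k) fun _ _ => by simp
    rw [Finset.card_univ, Fintype.card_fin] at this
    simp only [hn]
    exact_mod_cast this.symm
  -- Each block falls short of `h * w m` by at most one, and the errors sum to zero.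
  have hdev := abs_le_of_neg_le_of_sum_le (fun m => n m - h * w m) (E := 0) (K := 1) le_rfl
    zero_le_one (fun m => by
      have h1 : (⌊w m * (h : ℝ)⌋₊ : ℝ) ≤ n m := Nat.cast_le.mpr (floor_le_card_mixTag hw hw1 h m)
      have h2 := Nat.lt_floor_add_one (w m * (h : ℝ))
      linarith)
    (by rw [Finset.sum_sub_distrib, htot, ← Finset.mul_sum, hw1]; simp)
  rw [hsum, Finset.mul_sum, ← Finset.sum_sub_distrib, Finset.mul_sum]
  refine (Finset.abs_sum_le_sum_abs _ _).trans (Finset.sum_le_sum fun m _ => ?_)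
  have e : n m * g m - h * (w m * g m) = (n m - h * w m) * g m := by ring
  rw [e, abs_mul]
  refine mul_le_mul_of_nonneg_right ((hdev m).trans (le_of_eq ?_)) (abs_nonneg _)
  simp

theorem tendsto_expCost_mixedPolicy (α : Fin (M + 1) → Q.LocalPolicy) {w : Fin (M + 1) → ℝ}
    (hw : ∀ m, 0 ≤ w m) (hw1 : ∑ m, w m = 1) :
    Tendsto (fun h => Q.expCost (Q.mixedPolicy α w h)) atTop
      (𝓝 (∑ m, w m * Q.localCost (α m))) := by
  rw [tendsto_iff_dist_tendsto_zero]
  refine squeeze_zero' (Eventually.of_forall fun h => dist_nonneg) ?_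
    (tendsto_const_div_atTop_nhds_zero_nat (((M : ℝ) + 1) * ∑ m, |Q.localCost (α m)|))
  filter_upwards [eventually_gt_atTop 0] with h hh
  have hh' : (0 : ℝ) < h := by exact_mod_cast hh
  have h1 := abs_sum_mixTag_sub_le hw hw1 h fun m => Q.localCost (α m)
  rw [Real.dist_eq, mixedPolicy, expCost_lift]
  set S := ∑ k, Q.localCost (α (mixTag w h k))
  set L := ∑ m, w m * Q.localCost (α m)
  have e : 1 / (h : ℝ) * S - L = (S - h * L) / h := by
    field_simp
  rw [e, abs_div, abs_of_pos hh']
  gcongr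

/-! ### Asymptotic optimality -/

/-- The applicable policy `φ` ensures that the infimum is over a nonempty set. -/
theorem dualObjective_le_relaxedOptCost (γ : Mult I J) (hh : 0 < h) {φ : Q.Policy h}
    (hφ : Q.IsApplicable φ) : Q.dualObjective (Q.value γ) ≤ Q.relaxedOptCost h := by
  refine le_csInf ⟨_, φ, hφ.isRelaxedApplicable, rfl⟩ ?_
  rintro x ⟨ψ, hψ, rfl⟩
  exact hψ.le_expCost Q γ hh

theorem IsApplicable.relaxedOptCost_le (hh : 0 < h) {φ : Q.Policy h} (hφ : Q.IsApplicable φ) :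
    Q.relaxedOptCost h ≤ Q.expCost φ := by
  -- Weak duality with zero multipliers shows that the set of costs is bounded below.
  refine csInf_le ⟨Q.dualObjective (Q.value fun _ _ _ => 0), ?_⟩ ⟨φ, hφ.isRelaxedApplicable, rfl⟩
  rintro x ⟨ψ, hψ, rfl⟩
  exact hψ.le_expCost Q _ hh

theorem IsApplicable.optCost_le (hh : 0 < h) {φ : Q.Policy h} (hφ : Q.IsApplicable φ) :
    Q.optCost h ≤ Q.expCost φ := by
  refine csInf_le ⟨Q.dualObjective (Q.value fun _ _ _ => 0), ?_⟩ ⟨φ, hφ, rfl⟩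
  rintro x ⟨ψ, hψ, rfl⟩
  exact hψ.isRelaxedApplicable.le_expCost Q _ hh

theorem IsApplicable.relaxedOptCost_le_optCost (hh : 0 < h) {φ : Q.Policy h}
    (hφ : Q.IsApplicable φ) : Q.relaxedOptCost h ≤ Q.optCost h := by
  refine le_csInf ⟨_, φ, hφ, rfl⟩ ?_
  rintro x ⟨ψ, hψ, rfl⟩
  exact hψ.relaxedOptCost_le hh

end PatrolProblem

end

/-! ### Assembly: all costs have the same limit. -/

theorem corollary1 {I J T : ℕ} (Q : PatrolProblem I J T)
    (γ : PatrolProblem.Mult I J) (hγ : Q.IsDualOptimal γ) (hstrict : Q.StrictlyIndexable γ)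
    {M : ℕ} (α : Fin (M + 1) → Q.LocalPolicy) (hα : ∀ m, Q.IsThreshold γ (α m))
    (w : Fin (M + 1) → ℝ) (hw_nonneg : ∀ m, 0 ≤ w m) (hw_sum : ∑ m, w m = 1)
    (hbalanced : Q.IsBalancedMixture α w) :
    (∀ h : ℕ, 0 < h → ∃ φ : Q.Policy h, Q.IsMAI γ φ) ∧
    ∀ φ : (h : ℕ) → Q.Policy h, (∀ h, 0 < h → Q.IsMAI γ (φ h)) →
      (∀ h, 0 < h → Q.IsApplicable (φ h)) ∧
      Tendsto (fun h => |Q.expCost (φ h) - Q.expCost (Q.mixedPolicy α w h)|) atTop (𝓝 0) ∧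
      Tendsto (fun h => |Q.expCost (φ h) - Q.relaxedOptCost h|) atTop (𝓝 0) ∧
      Tendsto (fun h => |Q.expCost (φ h) - Q.optCost h|) atTop (𝓝 0) := by
  refine ⟨fun h _ => PatrolProblem.exists_isMAI Q γ h, fun φ hφ => ?_⟩
  have happ : ∀ h, 0 < h → Q.IsApplicable (φ h) := fun h hh => (hφ h hh).isApplicable
  obtain ⟨K, hK⟩ := PatrolProblem.exists_abs_expCost_sub_le hstrict hα hw_nonneg hw_sum hbalanced
  have hdual := hbalanced.sum_localCost Q hα hw_sum
  have hmai : Tendsto (fun h => Q.expCost (φ h)) atTop (𝓝 (∑ m, w m * Q.localCost (α m))) := by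
    rw [tendsto_iff_dist_tendsto_zero]
    refine squeeze_zero' (Eventually.of_forall fun h => dist_nonneg) ?_
      ((Real.tendsto_sqrt_atTop.comp tendsto_natCast_atTop_atTop).const_div_atTop K)
    filter_upwards [eventually_gt_atTop 0] with h hh
    exact hK h hh (φ h) (hφ h hh)
  have hmixed := PatrolProblem.tendsto_expCost_mixedPolicy α hw_nonneg hw_sum
  have hle : ∀ᶠ h in atTop, Q.dualObjective (Q.value γ) ≤ Q.relaxedOptCost h := by
    filter_upwards [eventually_gt_atTop 0] with h hh
    exact PatrolProblem.dualObjective_le_relaxedOptCost γ hh (happ h hh)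
  have hrel : Tendsto (fun h => Q.relaxedOptCost h) atTop
      (𝓝 (∑ m, w m * Q.localCost (α m))) := by
    -- The relaxed minimum lies between the dual value, which is the limit itself, and the MAI cost;
    -- the minimum over applicable policies is squeezed likewise below.
    refine tendsto_of_tendsto_of_tendsto_of_le_of_le' tendsto_const_nhds hmai ?_ ?_
    · rwa [hdual]
    · filter_upwards [eventually_gt_atTop 0] with h hh
      exact (happ h hh).relaxedOptCost_le hh
  have hopt : Tendsto (fun h => Q.optCost h) atTop (𝓝 (∑ m, w m * Q.localCost (α m))) := by
    refine tendsto_of_tendsto_of_tendsto_of_le_of_le' hrel hmai ?_ ?_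
    · filter_upwards [eventually_gt_atTop 0] with h hh
      exact (happ h hh).relaxedOptCost_le_optCost hh
    · filter_upwards [eventually_gt_atTop 0] with h hh
      exact (happ h hh).optCost_le hh
  have hlim : ∀ f : ℕ → ℝ, Tendsto f atTop (𝓝 (∑ m, w m * Q.localCost (α m))) →
      Tendsto (fun h => |Q.expCost (φ h) - f h|) atTop (𝓝 0) := by
    intro f hf
    have := (hmai.sub hf).abs
    rwa [sub_self, abs_zero] at this
  exact ⟨happ, hlim _ hmixed, hlim _ hrel, hlim _ hopt⟩
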